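/- **Setting.** $M$ workers; worker $m$ holds operators $F_{m,1},\dots,F_{m,n}:\mathbb R^d\to\mathbb R^d$, $F_m=\frac1n\sum_{i=1}^nF_{m,i}$ and $F=\sum_{m=1}^MF_m$. Let $g:\mathbb R^d\to\mathbb R\cup\{+\infty\}$ be proper, lower semicontinuous and convex, and let $z^*\in\mathrm{dom}\,g$ solve $\langle F(z^*),z-z^*\rangle+g(z)-g(z^*)\ge 0$ for all $z\in\mathbb R^d$. For constants $L,\overline L,\mu>0$ and all $m$: $F_m$ is $L$-Lipschitz and $\mu$-strongly monotone, and $\frac1n\sum_i\|F_{m,i}(u)-F_{m,i}(v)\|^2\le\overline L^2\|u-v\|^2$. For $\mathbf z=(z_1,\dots,z_M)\in(\mathbb R^d)^M$ put $\mathbf F(\mathbf z)=(F_m(z_m))_m$, $\mathbf g(\mathbf z)=\frac1M\sum_mg(z_m)$, $\mathbf z^*=(z^*,\dots,z^*)$; $\mathcal L$ is the consensus space $\{z_1=\dots=z_M\}$, $\mathcal L^\perp=\{\mathbf z:\sum_mz_m=0\}$, $\mathbf P$ the orthogonal projection onto $\mathcal L^\perp$; $\mathbf F_j(\mathbf z)=(F_{m,j_m}(z_m))_m$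 for $j\in[n]^M$; $\mathrm{prox}_{\eta\mathbf g}(\mathbf v)=\arg\min_{\mathbf u}\{\eta\mathbf g(\mathbf u)+\frac12\|\mathbf u-\mathbf v\|^2\}$. **Network.** Directed graphs $\mathcal G(t)$, $t=0,1,\dots$, on the workers are $B$-connected ($B\ge1$): for all $t$ the union of $\mathcal G(t),\dots,\mathcal G(t+B-1)$ is connected. The matrices $\mathbf W(t)\in\mathbb R^{M\times M}$ satisfy $w_{ij}(t)\ne0\Rightarrow i=j$ or $(i,j)\in\mathcal E(t)$, and have zero row and column sums. Put $\mathbf W_T(t)=\mathbf I-(\mathbf I-\mathbf W(t+T-1))\cdots(\mathbf I-\mathbf W(t))$; a multiplication by $\mathbf W_T(t)$ takes $T$ communication rounds. We say that $\mathbf W_T$ has characteristic number $\chi(T)\ge1$ if for all $t$ and all $\mathbf z\in\mathcal L^\perp$ one has $\|(\mathbf W_T(t)\otimes\mathbf I_d)\mathbf z-\mathbf z\|^2\le(1-\chi(T)^{-1})\|\mathbf z\|^2$. **Algorithm 2.** Batch size $b\in\{1,\dots,n\}$, probability $p\in(0,\frac1{16}]$. Start: $\mathbf z^{-1}=\mathbf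 z^0=\mathbf w^{-1}=\mathbf w^0\in(\mathrm{dom}\,g)^M$, $\mathbf y_f^0=\mathbf y^{-1}=\mathbf y^0\in(\mathbb R^d)^M$, $\mathbf x_f^0=\mathbf x^0\in\mathcal L^\perp$, $\mathbf m^0=0$. In iteration $k$ (with $W=\mathbf W_T(Tk)\otimes\mathbf I_d$) each worker draws indices for $S^k=(j^k_1,\dots,j^k_b)$ and $S^{k+1/2}$ (so $j^k_l\in[n]^M$), all uniform on $[n]$ and independent, and $$\begin{aligned} \delta^k&=\tfrac1b\textstyle\sum_{j\in S^k}\big(\mathbf F_j(\mathbf z^k)-\mathbf F_j(\mathbf w^{k-1})+\alpha[\mathbf F_j(\mathbf z^k)-\mathbf F_j(\mathbf z^{k-1})]\big)+\mathbf F(\mathbf w^{k-1}),\\ \mathbf z^{k+1}&=\mathrm{prox}_{\eta_z\mathbf g}\big(\mathbf z^k+\omega(\mathbf w^k-\mathbf z^k)-\eta_z[\delta^k-\nu\mathbf z^k-\mathbf y^k-\alpha(\mathbf y^k-\mathbf y^{k-1})]\big),\\ \mathbf y_c^k&=\tau\mathbf y^k+(1-\tau)\mathbf y_f^k,\qquad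 \mathbf x_c^k=\tau\mathbf x^k+(1-\tau)\mathbf x_f^k,\\ \delta^{k+1/2}&=\tfrac1b\textstyle\sum_{j\in S^{k+1/2}}\big(\mathbf F_j(\mathbf z^{k+1})-\mathbf F_j(\mathbf w^k)\big)+\mathbf F(\mathbf w^k),\\ \Delta_x^k&=\nu^{-1}(\mathbf y_c^k+\mathbf x_c^k)+\beta(\mathbf x^k+\delta^{k+1/2}),\\ \mathbf y^{k+1}&=\mathbf y^k-\eta_y\big[\nu^{-1}(\mathbf y_c^k+\mathbf x_c^k)+\mathbf z^{k+1}+\gamma(\mathbf y^k+\mathbf x^k+\nu\mathbf z^k)\big],\\ \mathbf x^{k+1}&=\mathbf x^k-W(\eta_x\Delta_x^k+\mathbf m^k),\qquad \mathbf m^{k+1}=\eta_x\Delta_x^k+\mathbf m^k-W(\eta_x\Delta_x^k+\mathbf m^k),\\ \mathbf y_f^{k+1}&=\mathbf y_c^k+\tau(\mathbf y^{k+1}-\mathbf y^k),\qquad \mathbf x_f^{k+1}=\mathbf x_c^k-\theta W(\mathbf y_c^k+\mathbf x_c^k), \end{aligned}$$ and $\mathbf w^{k+1}=\mathbf z^k$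 with probability $p$, $\mathbf w^{k+1}=\mathbf w^k$ otherwise, independently of everything else. **Tuning** for $\chi(T)$: $\eta_x,\eta_y,\eta_z,\gamma>0$ and $\omega=p$, $\theta=\frac12$, $\beta=5\gamma$, $\nu=\frac\mu4$, $\tau=\min\{\frac{\mu}{32L\chi(T)},\frac{\mu\sqrt{bp}}{32\overline L}\}$, $\eta_z=\min\{\frac1{8L\chi(T)},\frac1{32\eta_y},\frac{\sqrt{\alpha b\omega}}{8\overline L}\}$, $\eta_y=\min\{\frac1{4\gamma},\frac{\nu}{8\tau}\}$, $\eta_x=\min\{\frac1{900\chi(T)\gamma},\frac{\nu}{36\tau\chi^2(T)}\}$, $\gamma=\min\{\frac{\mu}{16L^2},\frac{b\omega}{24\overline L^2\eta_z}\}$, $\alpha=\max\{1-\frac{p\eta_z\nu}{p+\eta_z\nu},1-\eta_y\gamma,1-\eta_x\gamma,1-\frac{\mu\eta_z}8,1-\tau,1-\frac1{4\chi(T)}\}$. With $\mathbf y^*=\mathbf P\mathbf F(\mathbf z^*)-\nu\mathbf z^*$ and $\mathbf x^*=-\mathbf P\mathbf F(\mathbf z^*)$ put $$R=4\eta_z\Big[\tfrac1{\eta_y}\|\mathbf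 y^0-\mathbf y^*\|^2+\tfrac1{\eta_x}\|\mathbf x^0-\mathbf x^*\|^2+\tfrac1{\nu\tau}\|\mathbf y^0+\mathbf x^0-\mathbf y^*-\mathbf x^*\|^2+\Big(\tfrac1{\eta_z}+\tfrac{3\mu}2+\tfrac{\omega+\eta_z\nu}{p\eta_z}\Big)\|\mathbf z^0-\mathbf z^*\|^2\Big].$$ **Theorem.** There is a universal constant $C>0$ such that in this setting: 1. For every value $\chi(T)\ge1$ the (implicit) tuning relations have a solution. 2. Let $T\ge B$, let $\mathbf W_T$ have characteristic number $\chi(T)$, and let the parameters be tuned for $\chi(T)$. Then for every $\varepsilon>0$ one has $\mathbb E\|\mathbf z^k-\mathbf z^*\|^2\le\varepsilon$ for all $$k\ \ge\ C\Big[\chi^2(T)+\frac1p+\chi(T)\frac L\mu+\frac1{\sqrt{bp}}\frac{\overline L}\mu\Big]\log\frac R\varepsilon ,$$ that is, after $O\big([\chi^2(T)+\frac1p+\chi(T)\frac L\mu+\frac1{\sqrt{bp}}\frac{\overline L}\mu]\log\frac1\varepsilon\big)$ iterations. 3. Let $\mathbf W_B$ have characteristic number $\chi\ge1$ and let $T=B\lceil\chi\ln2\rceil$.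 Then $\mathbf W_T$ has characteristic number $\chi(T)=2$. If moreover the parameters are tuned for $\chi(T)=2$, with $b\asymp\overline L\sqrt n/L$ and $p\asymp b/n$ (precisely $\frac{\overline L\sqrt n}L\le b\le\frac{2\overline L\sqrt n}L$ and $\frac b{16n}\le p\le\frac bn$), then for every $\varepsilon>0$ there is $N$ such that $\mathbb E\|\mathbf z^k-\mathbf z^*\|^2\le\varepsilon$ for all $k\ge N$, and, with $\ell=\max\{1,\log(R/\varepsilon)\}$, the first $N$ iterations take at most $$C\Big[B\chi+B\chi\frac{\sqrt nL}{\overline L}+B\chi\frac L\mu\Big]\ell$$ communication rounds, hence at most $C\,B\chi\frac L\mu\,\ell$ of them if $\sqrt n\,\mu\le\overline L$, and in expectation at most $$C\Big[n+\sqrt n\,\frac{\overline L}\mu\Big]\ell$$ evaluations of the operators $F_{m,i}$ per worker. -/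

import Mathlib

open MeasureTheory ProbabilityTheory

noncomputable section

namespace DecVI

/-- The space `ℝ^d` with its Euclidean norm. -/
abbrev Vec (d : ℕ) := EuclideanSpace ℝ (Fin d)

/-- The space `(ℝ^d)^M` with its Euclidean norm: one vector per worker. -/
abbrev Stack (M d : ℕ) := PiLp 2 (fun _ : Fin M => Vec d)

variable {M d n b : ℕ}

/-! ### The variational inequality -/

/-- The local operator `F_m = (1/n) ∑ i, F_{m,i}` of worker `m`. -/
def localOp (F : Fin M → Fin n → Vec d → Vec d) (m : Fin M) (z : Vec d) : Vec d :=
  (n : ℝ)⁻¹ • ∑ i, F m i z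

/-- The operator `F = ∑ m, F_m` of the variational inequality. -/
def sumOp (F : Fin M → Fin n → Vec d → Vec d) (z : Vec d) : Vec d :=
  ∑ m, localOp F m z

/-- The lifted operator `𝐅(𝐳) = (F_1(z_1), …, F_M(z_M))`. -/
def liftOp (F : Fin M → Fin n → Vec d → Vec d) (z : Stack M d) : Stack M d :=
  WithLp.toLp 2 fun m => localOp F m (z m)

/-- The lifted sampled operator `𝐅_j(𝐳) = (F_{1,j_1}(z_1), …, F_{M,j_M}(z_M))`. -/
def sampledOp (F : Fin M → Fin n → Vec d → Vec d) (j : Fin M → Fin n) (z : Stack M d) :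
    Stack M d :=
  WithLp.toLp 2 fun m => F m (j m) (z m)

/-- The lifted regularizer `𝐠(𝐳) = (1/M) ∑ m, g(z_m)`. -/
def liftReg (g : Vec d → EReal) (z : Stack M d) : EReal :=
  (((M : ℝ)⁻¹ : ℝ) : EReal) * ∑ m, g (z m)

/-- Proper lower semicontinuous convex functions `ℝ^d → ℝ ∪ {+∞}`
(convexity is convexity of the epigraph). -/
structure ProperClosedConvex (g : Vec d → EReal) : Prop where
  ne_bot : ∀ z, g z ≠ ⊥
  proper : ∃ z, g z ≠ ⊤
  lsc : LowerSemicontinuous g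
  convex : Convex ℝ {q : Vec d × ℝ | g q.1 ≤ (q.2 : EReal)}

/-- Lipschitz continuity of every `F_m` with constant `L`, average Lipschitz continuity of every
family `F_{m,1}, …, F_{m,n}` with constant `Lbar`, and `μ`-strong monotonicity of every `F_m`. -/
structure OperatorAssumptions (F : Fin M → Fin n → Vec d → Vec d) (L Lbar μ : ℝ) : Prop where
  lipschitz : ∀ m u v, ‖localOp F m u - localOp F m v‖ ≤ L * ‖u - v‖
  avgLipschitz : ∀ m u v,
    (n : ℝ)⁻¹ * ∑ i, ‖F m i u - F m i v‖ ^ 2 ≤ Lbar ^ 2 * ‖u - v‖ ^ 2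
  strongMono : ∀ m u v,
    μ * ‖u - v‖ ^ 2 ≤ inner ℝ (localOp F m u - localOp F m v) (u - v)

/-- `zs` solves `⟪F(zs), z - zs⟫ + g(z) - g(zs) ≥ 0` for all `z`, with `zs ∈ dom g`. -/
def IsSolution (F : Fin M → Fin n → Vec d → Vec d) (g : Vec d → EReal) (zs : Vec d) : Prop :=
  g zs ≠ ⊤ ∧ ∀ z, g zs ≤ ((inner ℝ (sumOp F zs) (z - zs) : ℝ) : EReal) + g z

/-- The consensus vector `(z, …, z)`. -/
def diag (M : ℕ) (z : Vec d) : Stack M d := WithLp.toLp 2 fun _ => z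

/-- `u` minimizes `η 𝐠(·) + ½ ‖· - v‖²`. -/
def IsProxPoint (g : Vec d → EReal) (η : ℝ) (v u : Stack M d) : Prop :=
  ∀ u' : Stack M d,
    (η : EReal) * liftReg g u + ((‖u - v‖ ^ 2 / 2 : ℝ) : EReal) ≤
      (η : EReal) * liftReg g u' + ((‖u' - v‖ ^ 2 / 2 : ℝ) : EReal)

/-- `prox_{η 𝐠}(v)`, the minimizer of `η 𝐠(·) + ½ ‖· - v‖²`
(it exists and is unique for `η > 0` and `g` proper, lower semicontinuous and convex). -/
def prox (g : Vec d → EReal) (η : ℝ) (v : Stack M d) : Stack M d :=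
  Classical.epsilon (IsProxPoint g η v)

/-! ### The time-varying network -/

/-- Action of `A ⊗ I_d` on `(ℝ^d)^M`. -/
def gossip (A : Matrix (Fin M) (Fin M) ℝ) (z : Stack M d) : Stack M d :=
  WithLp.toLp 2 fun i => ∑ j, A i j • z j

/-- Membership in `{𝐳 : ∑ m, z_m = 0}`, the orthogonal complement of the consensus space. -/
def ZeroSum (z : Stack M d) : Prop := ∑ m, z m = 0

/-- Orthogonal projection onto the orthogonal complement of the consensus space. -/
def proj (z : Stack M d) : Stack M d :=
  WithLp.toLp 2 fun m => z m - (M : ℝ)⁻¹ • ∑ i, z i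

/-- Gossip matrices `W(t)` on a `B`-connected sequence of directed graphs `G(t)`. The kernel of
`W(t)` contains the constant vectors, its range consists of vectors with zero sum. -/
structure GossipNetwork (B : ℕ) (G : ℕ → Digraph (Fin M))
    (W : ℕ → Matrix (Fin M) (Fin M) ℝ) : Prop where
  connected : ∀ t, (SimpleGraph.fromRel fun i j : Fin M =>
    ∃ s, t ≤ s ∧ s < t + B ∧ (G s).Adj i j).Connected
  support : ∀ t i j, W t i j ≠ 0 → i = j ∨ (G t).Adj i j
  ker : ∀ t i, ∑ j, W t i j = 0
  range : ∀ t j, ∑ i, W t i j = 0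

/-- The effect `(I - W(t+T-1)) ⋯ (I - W(t))` of `T` successive gossip rounds from time `t` on. -/
def mixing (W : ℕ → Matrix (Fin M) (Fin M) ℝ) (t : ℕ) : ℕ → Matrix (Fin M) (Fin M) ℝ
  | 0 => 1
  | T + 1 => (1 - W (t + T)) * mixing W t T

/-- The multi-consensus gossip matrix `W_T(t) = I - (I - W(t+T-1)) ⋯ (I - W(t))`. -/
def multiGossip (W : ℕ → Matrix (Fin M) (Fin M) ℝ) (T t : ℕ) : Matrix (Fin M) (Fin M) ℝ :=
  1 - mixing W t T

/-- The contraction property of a gossip matrix with characteristic number `χ` on `(ℝ^d)^M`. -/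
def Contracts (d : ℕ) (A : Matrix (Fin M) (Fin M) ℝ) (χ : ℝ) : Prop :=
  ∀ z : Stack M d, ZeroSum z → ‖gossip A z - z‖ ^ 2 ≤ (1 - χ⁻¹) * ‖z‖ ^ 2

/-! ### Randomness -/

/-- Every worker draws `b` indices of `[n]`. -/
abbrev Batch (M n b : ℕ) := Fin M → Fin b → Fin n

/-- The random choices of one iteration: the batches `S^k` and `S^{k+1/2}`, and the coin that
decides about the update of `w`. -/
abbrev Draw (M n b : ℕ) := Batch M n b × Batch M n b × Bool

/-- All indices drawn in all iterations by all workers are uniform on `[n]`, all coins show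
`true` with probability `p`, and all these choices are mutually independent. -/
structure IsSampling {Ω : Type*} [MeasurableSpace Ω] (P : Measure Ω) (p : ℝ)
    (ξ : ℕ → Ω → Draw M n b) : Prop where
  measurable : ∀ k, Measurable (ξ k)
  indep : iIndepFun ξ P
  law : ∀ k (s : Draw M n b), P (ξ k ⁻¹' {s}) =
    ENNReal.ofReal (((n : ℝ)⁻¹) ^ (M * b) * ((n : ℝ)⁻¹) ^ (M * b) *
      (if s.2.2 then p else 1 - p))

/-! ### The algorithm -/

/-- Stepsizes, momentums and parameters of the algorithm. -/
structure Params where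
  (ηz ηy ηx θ α γ ω τ ν β : ℝ)

/-- The variables `z^k, z^{k-1}, w^k, w^{k-1}, y^k, y^{k-1}, y_f^k, x^k, x_f^k, m^k`. -/
structure State (M d : ℕ) where
  (z zPrev w wPrev y yPrev yf x xf m : Stack M d)

/-- The initial state. -/
def initState (z0 y0 x0 : Stack M d) : State M d where
  z := z0
  zPrev := z0
  w := z0
  wPrev := z0
  y := y0
  yPrev := y0
  yf := y0
  x := x0
  xf := x0
  m := 0

/-- One iteration, with gossip matrix `A` and random choices `ξ = (S^k, S^{k+1/2}, coin)`. -/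
def step (F : Fin M → Fin n → Vec d → Vec d) (g : Vec d → EReal) (c : Params)
    (A : Matrix (Fin M) (Fin M) ℝ) (ξ : Draw M n b) (s : State M d) : State M d :=
  let S (l : Fin b) : Fin M → Fin n := fun m => ξ.1 m l
  let S' (l : Fin b) : Fin M → Fin n := fun m => ξ.2.1 m l
  let δ := (b : ℝ)⁻¹ • ∑ l, (sampledOp F (S l) s.z - sampledOp F (S l) s.wPrev +
      c.α • (sampledOp F (S l) s.z - sampledOp F (S l) s.zPrev)) + liftOp F s.wPrev
  let Δz := δ - c.ν • s.z - s.y - c.α • (s.y - s.yPrev)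
  let z' := prox g c.ηz (s.z + c.ω • (s.w - s.z) - c.ηz • Δz)
  let yc := c.τ • s.y + (1 - c.τ) • s.yf
  let xc := c.τ • s.x + (1 - c.τ) • s.xf
  let Δy := c.ν⁻¹ • (yc + xc) + z' + c.γ • (s.y + s.x + c.ν • s.z)
  let δ' := (b : ℝ)⁻¹ • ∑ l, (sampledOp F (S' l) z' - sampledOp F (S' l) s.w) + liftOp F s.w
  let Δx := c.ν⁻¹ • (yc + xc) + c.β • (s.x + δ')
  let y' := s.y - c.ηy • Δy
  { z := z'
    zPrev := s.z
    w := if ξ.2.2 then s.z else s.w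
    wPrev := s.w
    y := y'
    yPrev := s.y
    yf := yc + c.τ • (y' - s.y)
    x := s.x - gossip A (c.ηx • Δx + s.m)
    xf := xc - c.θ • gossip A (yc + xc)
    m := c.ηx • Δx + s.m - gossip A (c.ηx • Δx + s.m) }

/-- The state after `k` iterations; iteration `k` uses the gossip matrix `W_T(Tk)`. -/
def run (F : Fin M → Fin n → Vec d → Vec d) (g : Vec d → EReal) (c : Params)
    (W : ℕ → Matrix (Fin M) (Fin M) ℝ) (T : ℕ) (z0 y0 x0 : Stack M d)
    (ξ : ℕ → Draw M n b) : ℕ → State M d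
  | 0 => initState z0 y0 x0
  | k + 1 => step F g c (multiGossip W T (T * k)) (ξ k) (run F g c W T z0 y0 x0 ξ k)

/-- The tuning of the parameters, for given `χT`, batch size `b` and probability `p`. -/
structure Tuned (L Lbar μ χT p : ℝ) (b : ℕ) (c : Params) : Prop where
  ηz_pos : 0 < c.ηz
  ηy_pos : 0 < c.ηy
  ηx_pos : 0 < c.ηx
  γ_pos : 0 < c.γ
  ω_eq : c.ω = p
  θ_eq : c.θ = 1 / 2
  β_eq : c.β = 5 * c.γ
  ν_eq : c.ν = μ / 4
  τ_eq : c.τ = min (μ / (32 * L * χT)) (μ * √(b * p) / (32 * Lbar))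
  ηz_eq : c.ηz = min (1 / (8 * L * χT)) (min (1 / (32 * c.ηy)) (√(c.α * b * c.ω) / (8 * Lbar)))
  ηy_eq : c.ηy = min (1 / (4 * c.γ)) (c.ν / (8 * c.τ))
  ηx_eq : c.ηx = min (1 / (900 * χT * c.γ)) (c.ν / (36 * c.τ * χT ^ 2))
  γ_eq : c.γ = min (μ / (16 * L ^ 2)) (b * c.ω / (24 * Lbar ^ 2 * c.ηz))
  α_eq : c.α = max (1 - p * c.ηz * c.ν / (p + c.ηz * c.ν)) (max (1 - c.ηy * c.γ)
    (max (1 - c.ηx * c.γ) (max (1 - μ * c.ηz / 8) (max (1 - c.τ) (1 - 1 / (4 * χT))))))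

/-! ### Complexity -/

/-- The bracket `χ² + 1/p + χ L/μ + (1/√(bp)) Lbar/μ` of the iteration complexity. -/
def iterBound (L Lbar μ χT p : ℝ) (b : ℕ) : ℝ :=
  χT ^ 2 + 1 / p + χT * (L / μ) + 1 / √(b * p) * (Lbar / μ)

/-- A weighted squared distance of the starting point from the solution, where
`𝐲* = 𝐏𝐅(𝐳*) - ν𝐳*` and `𝐱* = -𝐏𝐅(𝐳*)`. It plays the role of `R₀²`. -/
def startGap (F : Fin M → Fin n → Vec d → Vec d) (c : Params) (μ p : ℝ)
    (z0 y0 x0 : Stack M d) (zs : Vec d) : ℝ :=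
  let zst : Stack M d := diag M zs
  let yst : Stack M d := proj (liftOp F zst) - c.ν • zst
  let xst : Stack M d := -proj (liftOp F zst)
  4 * c.ηz * (1 / c.ηy * ‖y0 - yst‖ ^ 2 + 1 / c.ηx * ‖x0 - xst‖ ^ 2
    + 1 / (c.ν * c.τ) * ‖y0 + x0 - yst - xst‖ ^ 2
    + (1 + 3 * μ * c.ηz / 2) * (1 / c.ηz) * ‖z0 - zst‖ ^ 2
    + (c.ω + c.ηz * c.ν) / (p * c.ηz) * ‖z0 - zst‖ ^ 2)

/-- Communication rounds in `k` iterations: each multiplication by `W_T(Tk)` multiplies by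
`W(Tk), …, W(Tk+T-1)` in `T` rounds, and the vectors that an iteration multiplies share them. -/
def commRounds (T k : ℕ) : ℕ := T * k

/-- Evaluations of operators `F_{m,i}` by one worker in `k` iterations: the full `F_m` at `w^0`,
then, in each iteration, the batch `S^k` at `z^k, w^{k-1}, z^{k-1}`, the batch `S^{k+1/2}` at
`z^{k+1}, w^k`, and the full `F_m` at `w^{k+1}` if it is replaced by `z^k`. -/
def localCalls (ξ : ℕ → Draw M n b) (k : ℕ) : ℕ :=
  n + ∑ i ∈ Finset.range k, (3 * b + 2 * b + if (ξ i).2.2 then n else 0)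

end DecVI

end

noncomputable section

namespace DecVI

/-! ### One-step inequalities in an inner product space, and abstract gossip operators. -/

section InnerProductSpace

variable {E : Type*} [NormedAddCommGroup E] [InnerProductSpace ℝ E]

/-! The problem is treated as a primal-dual system. Strong monotonicity leaves room to split off the
quadratic ν‖z‖²/2 with ν = μ/4 and to dualize it. At the solution this gives y* + x* = -ν z*, where
z* is a consensus vector, x* has zero sum, P(x* + F(z*)) = 0, and F(z*) - ν z* - y* is a consensus
vector, the negative of a subgradient of the lifted regularizer at z*. `lyapunov` adds up weighted
squared deviations from this point, and the core of the proof is that its mean shrinks by the factor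
α in each iteration (`drawMean_lyapunov_le`).

Four mechanisms produce the contraction. (1) Optimistic extrapolation of F and of y: the errors made
by using old values telescope into the inner products contained in `lyapunov`
(`StepsizeBounds.primal_update_le`). (2) Nesterov coupling of y, x with y_f, x_f, where a gossip
step replaces the gradient step in x (`acceleration_le`, `IsGossip.half_step_le`). (3) Error
feedback: m stores what gossip failed to transmit, so that x - P m moves as if the exact projection
P had been applied, while P m is itself contracted (`IsGossip.error_feedback_le`). (4) Variance
reduction: the batches only sample differences, whose variance is bounded by squared distances that
`lyapunov` or the one-step estimate already pays for (`expect_norm_primalNoise_sq_le`,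
`expect_norm_dualNoise_sq_le`). The bilinear coupling of z and y cancels between the primal and the
dual inequality.

The draws of an iteration are independent of its past, so the conditional estimate integrates to
geometric decay (`integral_lyapunov_le`), and `le_lyapunov` turns it into decay of the distance to
z*. The tuning gives 1 - α ≥ 1/(900 I), where I is the bracket of the complexity bound
(`Tuned.one_le_mul_iterBound`). That the implicit tuning is solvable follows from a one-dimensional
fixed-point argument (`exists_tuned`). For part 3, enough consecutive gossip blocks multiply their
contraction factors to at most 1/2 (`GossipNetwork.contracts_two`); the remaining bounds are
arithmetic. -/

/-- Three-point inequality of a proximal step towards the reference point `zs`. -/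
theorem proximal_step_le {z zp w y yPrev δ Fs zs ys : E} {ηz ω α ν : ℝ} (hη : 0 < ηz)
    (h : 0 ≤ inner ℝ (z + ω • (w - z) - ηz • (δ - ν • z - y - α • (y - yPrev)) - zp
      + ηz • (Fs - ν • zs - ys)) (zp - zs)) :
    ηz⁻¹ * ‖zp - zs‖ ^ 2 ≤ ηz⁻¹ * ‖z - zs‖ ^ 2 - ηz⁻¹ * ‖zp - z‖ ^ 2
      + ω * ηz⁻¹ * (‖w - zs‖ ^ 2 - ‖zp - w‖ ^ 2 + ‖zp - z‖ ^ 2 - ‖z - zs‖ ^ 2)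
      - 2 * inner ℝ (δ - Fs) (zp - zs)
      + ν * (‖z - zs‖ ^ 2 + ‖zp - zs‖ ^ 2 - ‖zp - z‖ ^ 2)
      + 2 * inner ℝ (y - ys + α • (y - yPrev)) (zp - zs) := by
  have hav : ηz⁻¹ * ηz = 1 := inv_mul_cancel₀ hη.ne'
  have ha0 : 0 < ηz⁻¹ := by positivity
  have e1 : z + ω • (w - z) - ηz • (δ - ν • z - y - α • (y - yPrev)) - zp
      + ηz • (Fs - ν • zs - ys) = (z - zp) + ω • (w - z)
        - ηz • ((δ - Fs) - ν • (z - zs) - (y - ys + α • (y - yPrev))) := by module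
  rw [e1] at h
  generalize δ - Fs = D at *
  generalize y - ys + α • (y - yPrev) = D' at *
  obtain ⟨q, hq⟩ : ∃ q, q = inner ℝ (D - ν • (z - zs) - D') (zp - zs) := ⟨_, rfl⟩
  rw [inner_sub_left _ (ηz • _), real_inner_smul_left, ← hq] at h
  obtain ⟨a, rfl⟩ : ∃ a, z = zs + a := ⟨z - zs, by abel⟩
  obtain ⟨b, rfl⟩ : ∃ b, zp = zs + b := ⟨zp - zs, by abel⟩
  obtain ⟨e, rfl⟩ : ∃ e, w = zs + e := ⟨w - zs, by abel⟩
  have h' := mul_nonneg ha0.le h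
  simp only [add_sub_cancel_left, add_sub_add_left_eq_sub,
    ← real_inner_self_eq_norm_sq, inner_add_left, inner_sub_left, inner_sub_right,
    real_inner_smul_left] at h' hq ⊢
  rw [real_inner_comm a b, real_inner_comm e b] at *
  linear_combination 2 * h' - 2 * q * hav - 2 * hq

/-- The update direction vanishes at the optimum, because `ys + xs = -ν zs` annihilates both
brackets. Hence it may be written in deviations from the optimum, and the identity is polarization
of the square. -/
theorem dual_step_eq {y x yp zp z zs ys xs sc : E} {ηy ν γ : ℝ} (hη : 0 < ηy)
    (hyp : yp = y - ηy • (ν⁻¹ • sc + zp + γ • (y + x + ν • z)))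
    (hν : ν ≠ 0) (hs : ys + xs = -(ν • zs)) :
    ηy⁻¹ * ‖yp - ys‖ ^ 2 = ηy⁻¹ * ‖y - ys‖ ^ 2 - ηy⁻¹ * ‖yp - y‖ ^ 2
      - 2 * ν⁻¹ * inner ℝ (sc - (ys + xs)) (yp - ys) - 2 * inner ℝ (zp - zs) (yp - ys)
      - 2 * γ * inner ℝ (y - ys + (x - xs) + ν • (z - zs)) (yp - ys) := by
  have hav : ηy⁻¹ * ηy = 1 := inv_mul_cancel₀ hη.ne'
  have h1 : ν⁻¹ • sc + zp + γ • (y + x + ν • z) = ν⁻¹ • (sc - (ys + xs)) + (zp - zs)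
      + γ • (y - ys + (x - xs) + ν • (z - zs)) := by
    have h2 : y - ys + (x - xs) + ν • (z - zs) = y + x + ν • z := by
      have : y - ys + (x - xs) + ν • (z - zs) = y + x + ν • z - (ys + xs) - ν • zs := by module
      rw [this, hs]; abel
    have h3 : ν⁻¹ • (sc - (ys + xs)) = ν⁻¹ • sc + zs := by
      rw [hs, sub_neg_eq_add, smul_add, smul_smul, inv_mul_cancel₀ hν, one_smul]
    rw [h2, h3]; abel
  rw [h1] at hyp
  generalize sc - (ys + xs) = A at *
  generalize zp - zs = B at *
  generalize y - ys + (x - xs) + ν • (z - zs) = D at *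
  obtain ⟨q, hq⟩ : ∃ q, q = ν⁻¹ * inner ℝ A (yp - ys) + inner ℝ B (yp - ys)
      + γ * inner ℝ D (yp - ys) := ⟨_, rfl⟩
  have h4 : inner ℝ (yp - y) (yp - ys) = - ηy * q := by
    have : yp - y = - (ηy • (ν⁻¹ • A + B + γ • D)) := by rw [hyp]; abel
    rw [this, hq]
    simp only [inner_neg_left, real_inner_smul_left, inner_add_left]
    ring
  have h5 : ‖yp - ys‖ ^ 2 = ‖y - ys‖ ^ 2 - ‖yp - y‖ ^ 2 + 2 * inner ℝ (yp - y) (yp - ys) := by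
    obtain ⟨a, rfl⟩ : ∃ a, y = ys + a := ⟨y - ys, by abel⟩
    obtain ⟨b, rfl⟩ : ∃ b, yp = ys + b := ⟨yp - ys, by abel⟩
    simp only [add_sub_cancel_left, add_sub_add_left_eq_sub,
      ← real_inner_self_eq_norm_sq, inner_sub_left, inner_sub_right]
    rw [real_inner_comm a b]
    ring
  rw [h4] at h5
  linear_combination ηy⁻¹ * h5 - 2 * hq - 2 * q * hav

/-- Young's inequality for inner products. -/
theorem two_mul_inner_le (u v : E) {s : ℝ} (hs : 0 < s) :
    2 * inner ℝ u v ≤ s * ‖u‖ ^ 2 + s⁻¹ * ‖v‖ ^ 2 := by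
  have h := norm_sub_sq_real (s • u) v
  rw [norm_smul, real_inner_smul_left, mul_pow, Real.norm_eq_abs, sq_abs] at h
  have h2 := mul_nonneg (inv_pos.2 hs).le (sq_nonneg ‖s • u - v‖)
  rw [h] at h2
  have h3 : s⁻¹ * s = 1 := inv_mul_cancel₀ hs.ne'
  have : s⁻¹ * (s ^ 2 * ‖u‖ ^ 2 - 2 * (s * inner ℝ u v) + ‖v‖ ^ 2)
      = s * ‖u‖ ^ 2 - 2 * inner ℝ u v + s⁻¹ * ‖v‖ ^ 2 := by
    linear_combination (s * ‖u‖ ^ 2 - 2 * inner ℝ u v) * h3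
  linarith

theorem neg_two_mul_inner_le (u v : E) {s : ℝ} (hs : 0 < s) :
    -(2 * inner ℝ u v) ≤ s * ‖u‖ ^ 2 + s⁻¹ * ‖v‖ ^ 2 := by
  have := two_mul_inner_le (-u) v hs
  rw [inner_neg_left, norm_neg] at this
  linarith

theorem norm_add_sq_le_two (u v : E) : ‖u + v‖ ^ 2 ≤ 2 * ‖u‖ ^ 2 + 2 * ‖v‖ ^ 2 := by
  have := two_mul_inner_le u v one_pos
  rw [norm_add_sq_real]
  linarith

/-- The γ-term is the source of the decay in y. Polarizing ⟨Y, Yp⟩ yields -γ‖Y‖² and -γ‖Yp‖²; the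
latter pays exactly for the two Young inequalities, each of which costs ½‖Yp‖². -/
theorem regularization_term_le {Y X Z Yp : E} {γ ν : ℝ} (hγ : 0 < γ) :
    -(2 * γ * inner ℝ (Y + X + ν • Z) Yp) ≤ -(γ * ‖Y‖ ^ 2) + γ * ‖Yp - Y‖ ^ 2
      + 2 * γ * ‖X‖ ^ 2 + 2 * γ * ν ^ 2 * ‖Z‖ ^ 2 := by
  have h1 := neg_two_mul_inner_le X Yp (s := 2) (by norm_num)
  have h2 := neg_two_mul_inner_le (ν • Z) Yp (s := 2) (by norm_num)
  have h3 := norm_sub_sq_real Yp Y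
  rw [norm_smul, mul_pow, Real.norm_eq_abs, sq_abs] at h2
  rw [real_inner_comm] at h3
  rw [inner_add_left, inner_add_left]
  have := mul_le_mul_of_nonneg_left (add_le_add h1 h2) hγ.le
  have e : γ * ‖Yp - Y‖ ^ 2 = γ * (‖Yp‖ ^ 2 - 2 * inner ℝ Y Yp + ‖Y‖ ^ 2) := by rw [h3]
  nlinarith

/-- Nesterov's coupling for the quadratic ‖a‖²/2, whose gradient at `ac` is `ac`. Solving the convex
combination for `Y + X` expresses `Yp + X` through `ac`, `ac - af` and `Yp - Y`; convexity handles
the second part, and the third completes a square at the new point `ac + τ (Yp - Y)`. -/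
theorem acceleration_le {Y X Yp af ac : E} {τ : ℝ} (hτ : 0 < τ) (hτ1 : τ ≤ 1)
    (hac : ac = τ • (Y + X) + (1 - τ) • af) :
    -(2 * inner ℝ ac (Yp + X)) ≤ -‖ac‖ ^ 2 + (τ⁻¹ - 1) * ‖af‖ ^ 2
      - τ⁻¹ * ‖ac + τ • (Yp - Y)‖ ^ 2 + τ * ‖Yp - Y‖ ^ 2 := by
  have hτi : τ⁻¹ * τ = 1 := inv_mul_cancel₀ hτ.ne'
  have h1 : 1 ≤ τ⁻¹ := (one_le_inv₀ hτ).2 hτ1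
  have e : Yp + X = ac + (τ⁻¹ - 1) • (ac - af) + (Yp - Y) := by
    have : τ⁻¹ • ac = Y + X + (τ⁻¹ - 1) • af := by
      rw [hac, smul_add, smul_smul, smul_smul, hτi, one_smul, mul_sub, mul_one, hτi]
    rw [sub_smul, smul_sub, one_smul, this]
    module
  rw [e]
  generalize Yp - Y = d
  have h2 := mul_nonneg (sub_nonneg.2 h1) (sq_nonneg ‖ac - af‖)
  simp only [← real_inner_self_eq_norm_sq, inner_add_left, inner_sub_left, inner_sub_right,
    inner_add_right, real_inner_smul_left, real_inner_smul_right] at h2 ⊢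
  rw [real_inner_comm ac af, real_inner_comm ac d] at *
  linear_combination h2 + (2 * inner ℝ ac d + τ * inner ℝ d d) * hτi

/-- A self-adjoint projection `P` and an operator `W` that lives on its range and contracts there
with characteristic number `χ`. -/
structure IsGossip (P W : E →ₗ[ℝ] E) (χ : ℝ) : Prop where
  symm : ∀ u v, inner ℝ (P u) v = inner ℝ u (P v)
  idem : ∀ v, P (P v) = P v
  proj_gossip : ∀ v, P (W v) = W v
  gossip_proj : ∀ v, W (P v) = W v
  contract : ∀ v, ‖W v - P v‖ ^ 2 ≤ (1 - χ⁻¹) * ‖P v‖ ^ 2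

namespace IsGossip

variable {P W : E →ₗ[ℝ] E} {χ : ℝ}

theorem inner_proj (h : IsGossip P W χ) (u v : E) : inner ℝ (P u) (P v) = inner ℝ u (P v) := by
  rw [h.symm, h.idem]

theorem norm_proj_sq_le (h : IsGossip P W χ) (v : E) : ‖P v‖ ^ 2 ≤ ‖v‖ ^ 2 := by
  have h1 := sq_nonneg ‖v - P v‖
  rw [norm_sub_sq_real, ← h.inner_proj, real_inner_self_eq_norm_sq] at h1
  linarith

/-- Expanding the contraction gives ⟨W a, a⟩ ≥ ½‖W a‖² + (2χ)⁻¹‖P a‖², so W acts as a descent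
direction for ‖a‖². With step ½ a quarter of ‖W a‖² is left over, and this absorbs the cross term
with `d`. -/
theorem half_step_le (h : IsGossip P W χ) (ac d : E) {τ : ℝ} :
    ‖ac + τ • d - (1 / 2 : ℝ) • W ac‖ ^ 2 ≤ ‖ac + τ • d‖ ^ 2 - (2 * χ)⁻¹ * ‖P ac‖ ^ 2
      + τ ^ 2 * ‖d‖ ^ 2 := by
  have h1 := h.contract ac
  rw [norm_sub_sq_real] at h1
  have h2 : inner ℝ (W ac) (P ac) = inner ℝ (W ac) ac := by
    rw [← h.symm, h.proj_gossip]
  rw [h2] at h1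
  have h3 := sq_nonneg ‖(1 / 2 : ℝ) • W ac + τ • d‖
  rw [norm_add_sq_real, norm_smul, norm_smul, mul_pow, mul_pow, Real.norm_eq_abs, sq_abs,
    Real.norm_eq_abs, sq_abs, real_inner_smul_left, real_inner_smul_right] at h3
  rw [norm_sub_sq_real, real_inner_smul_right, inner_add_left, real_inner_smul_left, norm_smul,
    mul_pow, Real.norm_eq_abs, sq_abs, real_inner_comm, real_inner_comm _ d]
  rw [mul_inv]
  linarith

/-- The new memory is the gossip residual, which is shorter than its input by the factor 1 - 1/χ.
Young's inequality with weight 2χ gives up half of this gain to separate the old memory from the new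
increment. -/
theorem memory_le (h : IsGossip P W χ) (hχ : 1 ≤ χ) (m D : E) {η : ℝ} :
    ‖P (η • D + m - W (η • D + m))‖ ^ 2 ≤ (1 - (2 * χ)⁻¹) * ‖P m‖ ^ 2
      + 2 * χ * η ^ 2 * ‖P D‖ ^ 2 := by
  have h1 := h.contract (η • D + m)
  rw [map_sub, h.proj_gossip, norm_sub_rev]
  have h0 : 0 < χ := by linarith
  have hi : χ⁻¹ * χ = 1 := inv_mul_cancel₀ h0.ne'
  have hi1 : χ⁻¹ ≤ 1 := inv_le_one_of_one_le₀ hχ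
  have hi0 : 0 < χ⁻¹ := by positivity
  have h2 : ‖P (η • D + m)‖ ^ 2 ≤ (1 + 2 * χ) * (η ^ 2 * ‖P D‖ ^ 2)
      + (1 + (2 * χ)⁻¹) * ‖P m‖ ^ 2 := by
    rw [map_add, map_smul, norm_add_sq_real]
    have := two_mul_inner_le (η • P D) (P m) (s := 2 * χ) (by linarith)
    rw [norm_smul, mul_pow, Real.norm_eq_abs, sq_abs] at *
    linarith
  refine h1.trans ((mul_le_mul_of_nonneg_left h2 (by linarith)).trans ?_)
  have a1 : 0 ≤ η ^ 2 * ‖P D‖ ^ 2 := by positivity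
  have a2 : 0 ≤ ‖P m‖ ^ 2 := by positivity
  have b1 : (1 - χ⁻¹) * (1 + 2 * χ) ≤ 2 * χ := by nlinarith
  have b2 : (1 - χ⁻¹) * (1 + (2 * χ)⁻¹) ≤ 1 - (2 * χ)⁻¹ := by
    rw [mul_inv]; nlinarith
  nlinarith [mul_le_mul_of_nonneg_right b1 a1, mul_le_mul_of_nonneg_right b2 a2]

end IsGossip

end InnerProductSpace

end DecVI

/-! ### Parameter inequalities and the error-feedback estimate. -/

namespace DecVI

/-- The inequalities between the parameters on which the convergence proof rests. -/
structure StepsizeBounds (L Lbar μ χ p : ℝ) (b : ℕ) (c : Params) : Prop where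
  ηz_pos : 0 < c.ηz
  ηy_pos : 0 < c.ηy
  ηx_pos : 0 < c.ηx
  γ_pos : 0 < c.γ
  τ_pos : 0 < c.τ
  μ_pos : 0 < μ
  L_pos : 0 < L
  p_pos : 0 < p
  b_pos : 1 ≤ b
  one_le_χ : 1 ≤ χ
  μ_le : μ ≤ L
  p_le : p ≤ 1 / 16
  ω_eq : c.ω = p
  θ_eq : c.θ = 1 / 2
  β_eq : c.β = 5 * c.γ
  ν_eq : c.ν = μ / 4
  τ_le : c.τ ≤ 1
  ηz_L : 8 * L * c.ηz ≤ 1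
  ηy_ηz : 32 * c.ηy * c.ηz ≤ 1
  ηz_sq : 64 * Lbar ^ 2 * c.ηz ^ 2 ≤ c.α * b * p
  ηy_γ : 4 * c.γ * c.ηy ≤ 1
  ηy_τ : 8 * c.τ * c.ηy ≤ c.ν
  ηx_γ : 900 * χ * c.γ * c.ηx ≤ 1
  ηx_τ : 36 * c.τ * χ ^ 2 * c.ηx ≤ c.ν
  γ_L : 16 * L ^ 2 * c.γ ≤ μ
  γ_ηz : 24 * Lbar ^ 2 * c.ηz * c.γ ≤ b * p
  α_le : c.α ≤ 1
  le_α_w : 1 - p * c.ηz * c.ν / (p + c.ηz * c.ν) ≤ c.α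
  le_α_y : 1 - c.ηy * c.γ ≤ c.α
  le_α_x : 1 - c.ηx * c.γ ≤ c.α
  le_α_z : 1 - μ * c.ηz / 8 ≤ c.α
  le_α_τ : 1 - c.τ ≤ c.α
  le_α_χ : 1 - 1 / (4 * χ) ≤ c.α

theorem StepsizeBounds.α_nonneg {L Lbar μ χ p : ℝ} {b : ℕ} {c : Params}
    (hc : StepsizeBounds L Lbar μ χ p b c) :
    0 ≤ c.α := by
  have h1 := hc.le_α_χ
  have : 1 / (4 * χ) ≤ 1 / 4 := by
    apply one_div_le_one_div_of_le <;> linarith [hc.one_le_χ]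
  linarith

section InnerProductSpace

variable {E : Type*} [NormedAddCommGroup E] [InnerProductSpace ℝ E]

/-- The virtual iterate `x - P m` takes an exact projected step, whatever W is: W u leaves x and
enters the memory, so it cancels in the difference. The price is that the direction is tested
against `x - P m - xs` and not `x - xs`; the mismatch is paid by the contraction of `P m`. With β =
5γ the terms in ‖x - xs‖² leave -2γ‖x - xs‖², which the dual estimate needs for the cross term of
`regularization_term_le`. -/
theorem IsGossip.error_feedback_le {P W : E →ₗ[ℝ] E} {L Lbar μ χ p : ℝ} {b : ℕ} {c : Params}
    (h : IsGossip P W χ) (hc : StepsizeBounds L Lbar μ χ p b c)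
    {x xs m sc s0 Fs Fz e u : E} (hx : P x = x) (hxs : P xs = xs) (hs0 : P s0 = 0)
    (hFs : P (xs + Fs) = 0)
    (hu : u = c.ηx • (c.ν⁻¹ • sc + c.β • (x + (Fz + e))) + m) :
    c.ηx⁻¹ * ‖x - W u - P (u - W u) - xs‖ ^ 2 + 2 * c.ηx⁻¹ * ‖P (u - W u)‖ ^ 2
      ≤ (c.ηx⁻¹ - c.γ) * ‖x - P m - xs‖ ^ 2 + 2 * c.ηx⁻¹ * (1 - (4 * χ)⁻¹) * ‖P m‖ ^ 2
        - 2 * c.γ * ‖x - xs‖ ^ 2 + 6 * c.γ * ‖Fz - Fs‖ ^ 2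
        - 2 * c.ν⁻¹ * inner ℝ (sc - s0) (x - xs)
        + (2 * χ * c.ν * c.τ)⁻¹ * ‖P (sc - s0)‖ ^ 2
        + c.β / 10 * ‖e‖ ^ 2
        + inner ℝ e ((-2 * c.β) • (x - xs) + (c.β / 5) • (x - xs + (Fz - Fs))) := by
  have hη0 := hc.ηx_pos
  have hγ0 := hc.γ_pos
  have hτ0 := hc.τ_pos
  have hν0 : 0 < c.ν := by rw [hc.ν_eq]; linarith [hc.μ_pos]
  have hχ0 : 0 < χ := by linarith [hc.one_le_χ]
  have hχ1 := hc.one_le_χ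
  have g1 := hc.ηx_γ
  have g2 := hc.ηx_τ
  rw [hc.β_eq] at hu ⊢
  generalize c.ηx = η at hη0 hu g1 g2 ⊢
  generalize c.γ = γ at hγ0 hu g1 ⊢
  generalize c.ν = ν at hν0 hu g2 ⊢
  generalize c.τ = τ at hτ0 g2 ⊢
  have hηi : η⁻¹ * η = 1 := inv_mul_cancel₀ hη0.ne'
  set X := x - xs with hX
  have hPX : P X = X := by rw [hX, map_sub, hx, hxs]
  obtain ⟨A, hA⟩ : ∃ A, A = sc - s0 := ⟨_, rfl⟩
  obtain ⟨D, hD⟩ : ∃ D, D = ν⁻¹ • sc + (5 * γ) • (x + (Fz + e)) := ⟨_, rfl⟩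
  obtain ⟨G, hG⟩ : ∃ G, G = Fz - Fs := ⟨_, rfl⟩
  rw [← hG, ← hA]
  have hPD : P D = P (ν⁻¹ • A + (5 * γ) • (X + G + e)) := by
    have : D = ν⁻¹ • A + (5 * γ) • (X + G + e) + ν⁻¹ • s0 + (5 * γ) • (xs + Fs) := by
      rw [hD, hA, hG, hX]; module
    rw [this, map_add, map_add, map_smul, map_smul, hs0, hFs, smul_zero, smul_zero, add_zero,
      add_zero]
  rw [← hD] at hu
  have hmem := h.memory_le hχ1 m D (η := η)
  rw [← hu] at hmem
  have hxh : x - W u - P (u - W u) - xs = x - P m - xs - η • P D := by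
    rw [map_sub, h.proj_gossip, hu, map_add P, map_smul]; abel
  rw [hxh, norm_sub_sq_real, real_inner_smul_right, norm_smul, mul_pow, Real.norm_eq_abs, sq_abs]
  have hin : inner ℝ (x - P m - xs) (P D) = inner ℝ X (P D) - inner ℝ (P m) (P D) := by
    rw [← inner_sub_left, hX]; congr 1; abel
  have hXD : inner ℝ X (P D) = ν⁻¹ * inner ℝ A X + 5 * γ * inner ℝ (X + G + e) X := by
    rw [hPD, ← h.symm, hPX, inner_add_right, real_inner_smul_right, real_inner_smul_right,
      real_inner_comm, real_inner_comm (X + G + e)]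
  -- This weight uses half of the memory decay that the conclusion releases; the other half covers
  -- the 2γ‖P m‖² from passing between `x - xs` and the virtual iterate.
  have hmD := two_mul_inner_le (P m) (P D) (s := (4 * χ * η)⁻¹) (by positivity)
  rw [inv_inv] at hmD
  have hDn : ‖P D‖ ^ 2 ≤ 2 * (ν⁻¹ ^ 2 * ‖P A‖ ^ 2) + 2 * ((5 * γ) ^ 2 * ‖X + G + e‖ ^ 2) := by
    rw [hPD, map_add, map_smul, map_smul]
    refine (norm_add_sq_le_two _ _).trans ?_
    rw [norm_smul, norm_smul, mul_pow, mul_pow, Real.norm_eq_abs, sq_abs, Real.norm_eq_abs, sq_abs]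
    have := h.norm_proj_sq_le (X + G + e)
    gcongr
  have hXhat : ‖x - P m - xs‖ ^ 2 ≤ 2 * ‖X‖ ^ 2 + 2 * ‖P m‖ ^ 2 := by
    have : x - P m - xs = X + -P m := by rw [hX]; abel
    rw [this]; simpa using norm_add_sq_le_two X (-P m)
  have hXG := norm_add_sq_le_two X G
  have hGX := neg_two_mul_inner_le G X one_pos
  have hXGe := norm_add_sq_real (X + G) e
  -- coefficients
  have c1 : 9 * χ * η * (2 * ν⁻¹ ^ 2) ≤ (2 * χ * ν * τ)⁻¹ := by
    rw [← one_div (2 * χ * ν * τ), le_div_iff₀ (by positivity)]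
    have : 9 * χ * η * (2 * ν⁻¹ ^ 2) * (2 * χ * ν * τ) = (36 * τ * χ ^ 2 * η) * ν⁻¹ := by
      field_simp; ring
    rw [this]
    calc _ ≤ ν * ν⁻¹ := by gcongr
      _ = 1 := mul_inv_cancel₀ hν0.ne'
  have c2 : 9 * χ * η * (2 * (5 * γ) ^ 2) ≤ 5 * γ / 10 := by
    linear_combination (1 / 2) * mul_le_mul_of_nonneg_left g1 hγ0.le
  have c3 : 2 * γ ≤ (4 * χ * η)⁻¹ := by
    rw [← one_div, le_div_iff₀ (by positivity)]
    linear_combination (8 / 900) * g1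
  have e1 : (4 * χ * η)⁻¹ = η⁻¹ * (4 * χ)⁻¹ := by rw [mul_inv, mul_comm]
  have e2 : (2 * χ)⁻¹ = 2 * (4 * χ)⁻¹ := by rw [mul_inv, mul_inv]; ring
  have k1 := mul_le_mul_of_nonneg_right c1 (sq_nonneg ‖P A‖)
  have k2 := mul_le_mul_of_nonneg_right c2 (sq_nonneg ‖X + G + e‖)
  have k3 := mul_le_mul_of_nonneg_right c3 (sq_nonneg ‖P m‖)
  -- The factor 9χη collects all multiples of ‖P D‖²: 4χη from twice the memory estimate, 4χη from
  -- `hmD`, and η ≤ χη from the square of the step.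
  have k4 := mul_le_mul_of_nonneg_left hDn (show 0 ≤ 9 * χ * η by positivity)
  have k5 := mul_le_mul_of_nonneg_left hmem (show 0 ≤ 2 * η⁻¹ by positivity)
  have k6 := mul_le_mul_of_nonneg_left hXhat hγ0.le
  have k7 := mul_le_mul_of_nonneg_left hXG hγ0.le
  have k8 := mul_le_mul_of_nonneg_left hGX hγ0.le
  have k9 : η * ‖P D‖ ^ 2 ≤ χ * η * ‖P D‖ ^ 2 := by
    have : 0 ≤ η * ‖P D‖ ^ 2 := by positivity
    linear_combination mul_le_mul_of_nonneg_right hχ1 this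
  rw [hXGe] at k2 k4
  rw [hin, hXD]
  have f1 : η⁻¹ * (‖x - P m - xs‖ ^ 2 - 2 * (η * (ν⁻¹ * inner ℝ A X
      + 5 * γ * inner ℝ (X + G + e) X - inner ℝ (P m) (P D))) + η ^ 2 * ‖P D‖ ^ 2)
      = η⁻¹ * ‖x - P m - xs‖ ^ 2 - 2 * (ν⁻¹ * inner ℝ A X
      + 5 * γ * inner ℝ (X + G + e) X - inner ℝ (P m) (P D)) + η * ‖P D‖ ^ 2 := by
    linear_combination (- 2 * (ν⁻¹ * inner ℝ A X
      + 5 * γ * inner ℝ (X + G + e) X - inner ℝ (P m) (P D)) + η * ‖P D‖ ^ 2) * hηi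
  have f2 : 2 * η⁻¹ * (2 * χ * η ^ 2 * ‖P D‖ ^ 2) = 4 * χ * η * ‖P D‖ ^ 2 := by
    linear_combination 4 * χ * η * ‖P D‖ ^ 2 * hηi
  rw [f1]
  rw [mul_add, f2, e2] at k5
  rw [e1] at hmD k3
  simp only [inner_add_left, inner_add_right, real_inner_smul_right, real_inner_self_eq_norm_sq]
    at k2 k4 ⊢
  rw [real_inner_comm e X, real_inner_comm e G] at k2 k4
  linear_combination k5 + hmD + k9 + k4 + k1 + k2 + k3 + k6 + k7 / 2 + 5 * k8

end InnerProductSpace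

end DecVI

namespace DecVI

/-! ### The dual and the primal half of the descent estimate. -/

section InnerProductSpace

variable {E : Type*} [NormedAddCommGroup E] [InnerProductSpace ℝ E]

/-- The weight (ντ)⁻¹ is what makes the pieces fit: the inner products with `yc + xc` from the y-
and the x-step add up to the left side of `acceleration_le`, and the ‖P(·)‖² left by error feedback
is cancelled by the gain of `half_step_le`. What remains open is the coupling with `zp` and the
noise `e`. -/
theorem IsGossip.dual_update_le {P W : E →ₗ[ℝ] E} {L Lbar μ χ p : ℝ} {b : ℕ} {c : Params}
    (h : IsGossip P W χ) (hc : StepsizeBounds L Lbar μ χ p b c)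
    {z zp zs y yp yf yc ys x xf xc xs m Fs Fz e u : E}
    (hx : P x = x) (hxs : P xs = xs) (hzs : P zs = 0) (hs : ys + xs = -(c.ν • zs))
    (hFs : P (xs + Fs) = 0)
    (hyc : yc = c.τ • y + (1 - c.τ) • yf) (hxc : xc = c.τ • x + (1 - c.τ) • xf)
    (hyp : yp = y - c.ηy • (c.ν⁻¹ • (yc + xc) + zp + c.γ • (y + x + c.ν • z)))
    (hu : u = c.ηx • (c.ν⁻¹ • (yc + xc) + c.β • (x + (Fz + e))) + m) :
    c.ηy⁻¹ * ‖yp - ys‖ ^ 2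
      + (c.ηx⁻¹ * ‖x - W u - P (u - W u) - xs‖ ^ 2 + 2 * c.ηx⁻¹ * ‖P (u - W u)‖ ^ 2)
      + (c.ν * c.τ)⁻¹ *
        ‖yc + c.τ • (yp - y) + (xc - c.θ • W (yc + xc)) - (ys + xs)‖ ^ 2
      ≤ (c.ηy⁻¹ - c.γ) * ‖y - ys‖ ^ 2 + (c.ηx⁻¹ - c.γ) * ‖x - P m - xs‖ ^ 2
        + 2 * c.ηx⁻¹ * (1 - (4 * χ)⁻¹) * ‖P m‖ ^ 2
        + (c.ν * c.τ)⁻¹ * (1 - c.τ) * ‖yf + xf - (ys + xs)‖ ^ 2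
        - c.ηy⁻¹ / 2 * ‖yp - y‖ ^ 2 - 2 * inner ℝ (zp - zs) (yp - ys)
        + 2 * c.γ * c.ν ^ 2 * ‖z - zs‖ ^ 2 + 6 * c.γ * ‖Fz - Fs‖ ^ 2
        + c.β / 10 * ‖e‖ ^ 2
        + inner ℝ e ((-2 * c.β) • (x - xs) + (c.β / 5) • (x - xs + (Fz - Fs))) := by
  have hηy0 := hc.ηy_pos
  have hτ0 := hc.τ_pos
  have hν0 : 0 < c.ν := by rw [hc.ν_eq]; linarith [hc.μ_pos]
  have hχ0 : 0 < χ := by linarith [hc.one_le_χ]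
  have hs0 : P (ys + xs) = 0 := by rw [hs, map_neg, map_smul, hzs, smul_zero, neg_zero]
  have h1 := h.error_feedback_le hc (s0 := ys + xs) hx hxs hs0 hFs hu
  have h2 := dual_step_eq hηy0 hyp hν0.ne' hs
  have h3 := regularization_term_le (Y := y - ys) (X := x - xs) (Z := z - zs) (Yp := yp - ys)
    (ν := c.ν) hc.γ_pos
  have hac : yc + xc - (ys + xs) = c.τ • (y - ys + (x - xs))
      + (1 - c.τ) • (yf + xf - (ys + xs)) := by rw [hyc, hxc]; module
  have h4 := acceleration_le (Yp := yp - ys) hτ0 hc.τ_le hac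
  have hdd : yp - ys - (y - ys) = yp - y := by abel
  have h5 := h.half_step_le (yc + xc - (ys + xs)) (yp - y) (τ := c.τ)
  -- The optimum `ys + xs` is a multiple of the consensus vector `zs`, which W annihilates.
  have hWs : W (yc + xc) = W (yc + xc - (ys + xs)) := by
    rw [map_sub, ← h.gossip_proj (ys + xs), hs0, map_zero, sub_zero]
  have hnew : yc + c.τ • (yp - y) + (xc - c.θ • W (yc + xc)) - (ys + xs)
      = yc + xc - (ys + xs) + c.τ • (yp - y) - (1 / 2 : ℝ) • W (yc + xc - (ys + xs)) := by
    rw [hc.θ_eq, hWs]; abel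
  rw [hnew]
  rw [hdd] at h3 h4
  generalize yc + xc - (ys + xs) = A at *
  generalize yf + xf - (ys + xs) = Af at *
  have k4 := mul_le_mul_of_nonneg_left h4 (show 0 ≤ c.ν⁻¹ by positivity)
  have k5 := mul_le_mul_of_nonneg_left h5 (show 0 ≤ (c.ν * c.τ)⁻¹ by positivity)
  -- The costs in ‖yp - y‖²: ν⁻¹τ each from acceleration and gossip, and γ from the regularization.
  -- Half of ηy⁻¹ survives for the extrapolation term of the primal estimate.
  have hd : 2 * (c.ν⁻¹ * c.τ) + c.γ ≤ c.ηy⁻¹ / 2 := by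
    have e1 : c.γ ≤ c.ηy⁻¹ / 4 := by
      rw [le_div_iff₀ (by norm_num), ← one_div, le_div_iff₀ hηy0]; linarith [hc.ηy_γ]
    have e2 : 2 * (c.ν⁻¹ * c.τ) ≤ c.ηy⁻¹ / 4 := by
      rw [inv_mul_eq_div, ← one_div, mul_div_assoc', div_div, div_le_div_iff₀ hν0 (by positivity)]
      linarith [hc.ηy_τ]
    linarith
  have kd := mul_le_mul_of_nonneg_right hd (sq_nonneg ‖yp - y‖)
  have kA := mul_nonneg (show 0 ≤ c.ν⁻¹ by positivity) (sq_nonneg ‖A‖)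
  rw [inner_add_right] at k4
  have hττ : c.τ⁻¹ * c.τ = 1 := inv_mul_cancel₀ hτ0.ne'
  have i1 : (c.ν * c.τ)⁻¹ = c.ν⁻¹ * c.τ⁻¹ := mul_inv _ _
  have i2 : (2 * χ * c.ν * c.τ)⁻¹ = c.ν⁻¹ * c.τ⁻¹ * (2 * χ)⁻¹ := by
    simp only [mul_inv]; ring
  rw [i1] at k5 ⊢
  rw [i2] at h1
  linear_combination h1 + h2 + h3 + k4 + k5 + kd + kA
    + (c.ν⁻¹ * c.τ * ‖yp - y‖ ^ 2 + c.ν⁻¹ * ‖Af‖ ^ 2) * hττ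

/-- The extrapolations predict `F zp` and `yp`. Each prediction error is a new difference minus α
times the previous one, and its inner product with `zp - zs` splits into a term of the new Lyapunov
function, α times the corresponding old term, and a remainder against `zp - z` bounded by Young. The
left side also holds the terms that the dual estimate passes on. -/
theorem StepsizeBounds.primal_update_le {L Lbar μ χ p : ℝ} {b : ℕ} {c : Params}
    (hc : StepsizeBounds L Lbar μ χ p b c) {F : E → E}
    (hL : ∀ u v, ‖F u - F v‖ ≤ L * ‖u - v‖)
    (hμ : ∀ u v, μ * ‖u - v‖ ^ 2 ≤ inner ℝ (F u - F v) (u - v))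
    {z zPrev zp zs w y yPrev yp ys δ : E}
    (h : 0 ≤ inner ℝ (z + c.ω • (w - z) - c.ηz • (δ - c.ν • z - y - c.α • (y - yPrev)) - zp
      + c.ηz • (F zs - c.ν • zs - ys)) (zp - zs)) :
    (c.ηz⁻¹ + μ) * ‖zp - zs‖ ^ 2 + c.ηz⁻¹ / 2 * ‖zp - z‖ ^ 2 + p * c.ηz⁻¹ / 2 * ‖zp - w‖ ^ 2
      + 2 * inner ℝ (yp - y) (zp - zs) - 2 * inner ℝ (F zp - F z) (zp - zs)
      + (c.ηz⁻¹ + c.ν / p) * ((1 - p) * ‖w - zs‖ ^ 2 + p * ‖z - zs‖ ^ 2)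
      + 6 * c.γ * ‖F zp - F zs‖ ^ 2 + 2 * c.γ * c.ν ^ 2 * ‖z - zs‖ ^ 2
      - 2 * inner ℝ (zp - zs) (yp - ys) + c.β / 10 * (Lbar ^ 2 / b * ‖zp - w‖ ^ 2)
      ≤ c.α * ((c.ηz⁻¹ + μ) * ‖z - zs‖ ^ 2 + (c.ηz⁻¹ + c.ν / p) * ‖w - zs‖ ^ 2
          + c.ηz⁻¹ / 2 * ‖z - zPrev‖ ^ 2 + c.ηy⁻¹ / 2 * ‖y - yPrev‖ ^ 2
          + 2 * inner ℝ (y - yPrev) (z - zs) - 2 * inner ℝ (F z - F zPrev) (z - zs))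
        - 2 * inner ℝ (δ - (F z + c.α • (F z - F zPrev))) (z - zs)
        + 4 * c.ηz * ‖δ - (F z + c.α • (F z - F zPrev))‖ ^ 2
        - 3 * c.α * c.ηz⁻¹ / 8 * ‖z - zPrev‖ ^ 2 := by
  have hη0 := hc.ηz_pos
  have hηy0 := hc.ηy_pos
  have hμ0 := hc.μ_pos
  have hL0 := hc.L_pos
  have hγ0 := hc.γ_pos
  have hp0 := hc.p_pos
  have hp1 := hc.p_le
  have hb0 : (0 : ℝ) < b := by exact_mod_cast hc.b_pos
  have hν := hc.ν_eq
  have hν0 : 0 < c.ν := by rw [hν]; positivity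
  have hηi : c.ηz⁻¹ * c.ηz = 1 := inv_mul_cancel₀ hη0.ne'
  have ha0 : 0 < c.ηz⁻¹ := by positivity
  have hα0 := hc.α_nonneg
  have h0 := proximal_step_le hη0 h
  have hmono := hμ zp zs
  have hLs := hL zp zs
  have hLp := hL z zPrev
  obtain ⟨e, he⟩ : ∃ e, e = δ - (F z + c.α • (F z - F zPrev)) := ⟨_, rfl⟩
  rw [← he]
  have hδ : δ - F zs = e + (F zp - F zs) - (F zp - F z) + c.α • (F z - F zPrev) := by
    rw [he]; abel
  rw [hδ] at h0
  have hY : y - ys + c.α • (y - yPrev) = (yp - ys) - (yp - y) + c.α • (y - yPrev) := by abel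
  rw [hY] at h0
  obtain ⟨dz, hdz⟩ : ∃ dz, dz = zp - z := ⟨_, rfl⟩
  have hZp : zp - zs = (z - zs) + dz := by rw [hdz]; abel
  -- The Young weights make the shares of ηz⁻¹‖dz‖² equal to 1/16, 1/4 and 1/8. With the anchor
  -- term, p ≤ 1/16, they add up to 1/2, exactly what the half kept on the left leaves available.
  have y1 := two_mul_inner_le (y - yPrev) dz (s := c.ηy⁻¹ / 2) (by positivity)
  have y2 := neg_two_mul_inner_le e dz (s := 4 * c.ηz) (by positivity)
  have y3 := neg_two_mul_inner_le (F z - F zPrev) dz (s := 8 * c.ηz) (by positivity)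
  have s1 : inner ℝ e (zp - zs) = inner ℝ e (z - zs) + inner ℝ e dz := by
    rw [hZp, inner_add_right]
  have s2 : inner ℝ (F z - F zPrev) (zp - zs)
      = inner ℝ (F z - F zPrev) (z - zs) + inner ℝ (F z - F zPrev) dz := by
    rw [hZp, inner_add_right]
  have s3 : inner ℝ (y - yPrev) (zp - zs)
      = inner ℝ (y - yPrev) (z - zs) + inner ℝ (y - yPrev) dz := by
    rw [hZp, inner_add_right]
  rw [← hdz] at h0 ⊢
  simp only [inner_add_left, inner_sub_left _ (yp - y), inner_sub_left _ (F zp - F z),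
    real_inner_smul_left] at h0
  rw [s1, s2, s3] at h0
  rw [real_inner_comm (yp - ys) (zp - zs)]
  -- scalar inequalities
  have a1 : (c.ηy⁻¹ / 2)⁻¹ ≤ c.ηz⁻¹ / 16 := by
    rw [inv_div, div_inv_eq_mul, le_div_iff₀ (by norm_num), ← one_div, le_div_iff₀ hη0]
    linarith [hc.ηy_ηz]
  have a2 : (4 * c.ηz)⁻¹ = c.ηz⁻¹ / 4 := by rw [mul_inv]; ring
  have a3 : (8 * c.ηz)⁻¹ = c.ηz⁻¹ / 8 := by rw [mul_inv]; ring
  have hLη := hc.ηz_L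
  have a4 : 8 * c.ηz * L ^ 2 ≤ c.ηz⁻¹ / 8 := by
    rw [le_div_iff₀ (by norm_num), ← one_div, le_div_iff₀ hη0]
    have : 8 * L * c.ηz * (8 * L * c.ηz) ≤ 1 * 1 := by gcongr
    linarith
  have q1 := sq_nonneg ‖dz‖
  have n1 : ‖F z - F zPrev‖ ^ 2 ≤ L ^ 2 * ‖z - zPrev‖ ^ 2 := by
    rw [← mul_pow]; gcongr
  have n2 : ‖F zp - F zs‖ ^ 2 ≤ L ^ 2 * ‖zp - zs‖ ^ 2 := by
    rw [← mul_pow]; gcongr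
  have k1 : 2 * inner ℝ (y - yPrev) dz
      ≤ c.ηy⁻¹ / 2 * ‖y - yPrev‖ ^ 2 + c.ηz⁻¹ / 16 * ‖dz‖ ^ 2 := by
    linarith [mul_le_mul_of_nonneg_right a1 q1]
  have k3 : -(2 * inner ℝ (F z - F zPrev) dz)
      ≤ c.ηz⁻¹ / 8 * ‖z - zPrev‖ ^ 2 + c.ηz⁻¹ / 8 * ‖dz‖ ^ 2 := by
    have t1 := mul_le_mul_of_nonneg_left n1 (show 0 ≤ 8 * c.ηz by positivity)
    have t2 := mul_le_mul_of_nonneg_right a4 (sq_nonneg ‖z - zPrev‖)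
    rw [a3] at y3
    linarith
  rw [a2] at y2
  have k1' := mul_le_mul_of_nonneg_left k1 hα0
  have k3' := mul_le_mul_of_nonneg_left k3 hα0
  have kα := mul_le_mul_of_nonneg_right hc.α_le
    (show 0 ≤ c.ηz⁻¹ * ‖dz‖ ^ 2 * (3 / 16) by positivity)
  have kp := mul_le_mul_of_nonneg_right hp1 (show 0 ≤ c.ηz⁻¹ * ‖dz‖ ^ 2 by positivity)
  have kν : 0 ≤ c.ν * ‖dz‖ ^ 2 := by positivity
  have b1 : c.β / 10 * (Lbar ^ 2 / b) ≤ p * c.ηz⁻¹ / 2 := by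
    have t : 0 ≤ Lbar ^ 2 * c.ηz * c.γ := by positivity
    have t' : Lbar ^ 2 * c.γ / b ≤ p * c.ηz⁻¹ := by
      rw [div_le_iff₀ hb0, ← div_eq_mul_inv, div_mul_eq_mul_div, le_div_iff₀ hη0]
      linarith [hc.γ_ηz]
    rw [hc.β_eq]
    linear_combination t' / 2
  have kb := mul_le_mul_of_nonneg_right b1 (sq_nonneg ‖zp - w‖)
  have g1 := hc.γ_L
  have kL := mul_le_mul_of_nonneg_left n2 (show 0 ≤ 6 * c.γ by positivity)
  have kL' := mul_le_mul_of_nonneg_right g1 (sq_nonneg ‖zp - zs‖)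
  -- The summand ν/p in the weight of w makes the w-part contract: without it both sides would be
  -- ηz⁻¹. Its cost is ν‖z - zs‖² when the coin moves w to z, which strong monotonicity pays.
  have hw : (1 - p) * (c.ηz⁻¹ + c.ν / p) + p * c.ηz⁻¹ ≤ c.α * (c.ηz⁻¹ + c.ν / p) := by
    have e1 : c.ηz⁻¹ + c.ν / p = (p + c.ηz * c.ν) / (p * c.ηz) := by field_simp
    have e2 : (1 - p) * (c.ηz⁻¹ + c.ν / p) + p * c.ηz⁻¹
        = (1 - p * c.ηz * c.ν / (p + c.ηz * c.ν)) * (c.ηz⁻¹ + c.ν / p) := by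
      rw [e1]; field_simp; ring
    rw [e2]
    have := hc.le_α_w
    gcongr
  have kw := mul_le_mul_of_nonneg_right hw (sq_nonneg ‖w - zs‖)
  -- The μ/2 is 2ν: one ν from the split-off quadratic, one from the refresh of w.
  have hz : c.ηz⁻¹ + μ / 2 + 2 * c.γ * c.ν ^ 2 ≤ c.α * (c.ηz⁻¹ + μ) := by
    have e1 : (1 - μ * c.ηz / 8) * (c.ηz⁻¹ + μ) ≤ c.α * (c.ηz⁻¹ + μ) := by
      have := hc.le_α_z
      gcongr
    have e2 : (1 - μ * c.ηz / 8) * (c.ηz⁻¹ + μ) = c.ηz⁻¹ + 7 / 8 * μ - μ * (μ * c.ηz) / 8 := by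
      linear_combination (-μ / 8) * hηi
    have e3 : μ * c.ηz ≤ 1 / 8 := by
      have := mul_le_mul_of_nonneg_right hc.μ_le hη0.le
      linarith
    have e4 : μ * (μ * c.ηz) ≤ μ * (1 / 8) := by gcongr
    have e5 : c.γ * μ ^ 2 ≤ c.γ * L ^ 2 := by
      have := hc.μ_le
      gcongr
    rw [hν]
    linarith
  have kz := mul_le_mul_of_nonneg_right hz (sq_nonneg ‖z - zs‖)
  have hpp : c.ν / p * p = c.ν := div_mul_cancel₀ _ hp0.ne'
  rw [hc.ω_eq] at h0
  have hν' : c.ν * ‖zp - zs‖ ^ 2 = μ / 4 * ‖zp - zs‖ ^ 2 := by rw [hν]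
  have hν'' : c.ν * ‖z - zs‖ ^ 2 = μ / 4 * ‖z - zs‖ ^ 2 := by rw [hν]
  linear_combination h0 + y2 + k1' + k3' + kα + kp + kν + kb + kL + (3 / 8) * kL' + 2 * hmono
    + kw + kz + ‖z - zs‖ ^ 2 * hpp + hν' + 2 * hν''
    + (3 / 8) * mul_nonneg hμ0.le (sq_nonneg ‖zp - zs‖)

end InnerProductSpace

end DecVI

namespace DecVI

variable {M d n b : ℕ}

theorem Stack.norm_sq_eq (u : Stack M d) : ‖u‖ ^ 2 = ∑ m, ‖u m‖ ^ 2 :=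
  PiLp.norm_sq_eq_of_L2 _ u

theorem Stack.inner_eq (u v : Stack M d) : inner ℝ u v = ∑ m, inner ℝ (u m) (v m) :=
  PiLp.inner_apply u v

/-! ### Batch sampling: unbiasedness and variance. -/

section Sampling

open scoped BigOperators

/-- Averaging over all configurations may be preceded by resampling one coordinate. -/
theorem expect_resample {A κ : Type*} [Fintype A] [Fintype κ] [Nonempty κ] (get : A → κ)
    (set : A → κ → A) (hgs : ∀ S a, get (set S a) = a) (hss : ∀ S a, set (set S a) (get S) = S)
    (f : A → ℝ) : 𝔼 S, f S = 𝔼 S, 𝔼 a, f (set S a) := by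
  -- Exchanging the chosen coordinate with a fresh value is an involution, so it preserves the
  -- uniform mean.
  let e : A × κ ≃ A × κ :=
    { toFun := fun q => (set q.1 q.2, get q.1)
      invFun := fun q => (set q.1 q.2, get q.1)
      left_inv := fun q => by simp [hgs, hss]
      right_inv := fun q => by simp [hgs, hss] }
  have h1 : 𝔼 S, 𝔼 a, f (set S a) = 𝔼 q : A × κ, f (set q.1 q.2) := by
    rw [← Finset.univ_product_univ, Finset.expect_product]
  have h2 : 𝔼 S, f S = 𝔼 q : A × κ, f q.1 := by
    rw [← Finset.univ_product_univ, Finset.expect_product]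
    simp
  rw [h1, h2]
  exact (Fintype.expect_equiv e _ _ fun q => rfl).symm

/-- The batch `S` with the `l`-th index of worker `m` replaced by `a`. -/
def resample (m : Fin M) (l : Fin b) (S : Batch M n b) (a : Fin n) : Batch M n b :=
  Function.update S m (Function.update (S m) l a)

theorem expect_batch_resample [NeZero n] (m : Fin M) (l : Fin b) (f : Batch M n b → ℝ) :
    𝔼 S, f S = 𝔼 S, 𝔼 a, f (resample m l S a) := by
  refine expect_resample (fun S => S m l) (resample m l) ?_ ?_ f
  · intro S a; simp [resample]
  · intro S a; simp [resample]

theorem expect_batch_marginal [NeZero n] (m : Fin M) (l : Fin b) (f : Fin n → ℝ) :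
    𝔼 S : Batch M n b, f (S m l) = 𝔼 a, f a := by
  rw [expect_batch_resample m l]
  simp [resample]

variable {V : Type*} [NormedAddCommGroup V] [InnerProductSpace ℝ V]

theorem expect_inner_left {ι : Type*} [Fintype ι] (h : ι → V) (v : V) (hh : ∑ i, h i = 0) :
    𝔼 i, inner ℝ (h i) v = 0 := by
  rw [Fintype.expect_eq_sum_div_card, ← sum_inner, hh, inner_zero_left, zero_div]

/-- Resampling the index `l` does not touch `l'`, and the mean over the fresh index vanishes. This
is pairwise uncorrelatedness, which removes the off-diagonal part of the variance of a batch sum. -/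
theorem expect_batch_inner [NeZero n] (m : Fin M) {l l' : Fin b} (hl : l ≠ l') (h : Fin n → V)
    (hh : ∑ i, h i = 0) : 𝔼 S : Batch M n b, inner ℝ (h (S m l)) (h (S m l')) = 0 := by
  rw [expect_batch_resample m l]
  refine Finset.expect_eq_zero fun S _ => ?_
  have : ∀ a, resample m l S a m l' = S m l' := fun a => by
    simp [resample, Function.update_of_ne hl.symm]
  simp only [this]
  simp only [resample, Function.update_self]
  exact expect_inner_left h _ hh

theorem expect_batch_norm_sum_sq [NeZero n] (m : Fin M) (h : Fin n → V) (hh : ∑ i, h i = 0) :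
    𝔼 S : Batch M n b, ‖∑ l, h (S m l)‖ ^ 2 = b * 𝔼 i, ‖h i‖ ^ 2 := by
  have : ∀ S : Batch M n b, ‖∑ l, h (S m l)‖ ^ 2
      = ∑ l, ∑ l', inner ℝ (h (S m l)) (h (S m l')) := fun S => by
    rw [← real_inner_self_eq_norm_sq, sum_inner]
    simp only [inner_sum]
  simp only [this]
  rw [Finset.expect_sum_comm]
  have h2 : ∀ l : Fin b, 𝔼 S : Batch M n b, ∑ l', inner ℝ (h (S m l)) (h (S m l'))
      = 𝔼 i, ‖h i‖ ^ 2 := fun l => by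
    rw [Finset.expect_sum_comm, Finset.sum_eq_single l]
    · simp only [real_inner_self_eq_norm_sq]
      exact expect_batch_marginal m l (fun i => ‖h i‖ ^ 2)
    · intro l' _ hl'
      exact expect_batch_inner m hl'.symm h hh
    · simp
  simp [h2]

theorem sum_norm_sub_mean_sq_le [NeZero n] (h : Fin n → V) :
    ∑ i, ‖h i - (n : ℝ)⁻¹ • ∑ j, h j‖ ^ 2 ≤ ∑ i, ‖h i‖ ^ 2 := by
  have hn : (n : ℝ) ≠ 0 := Nat.cast_ne_zero.2 (NeZero.ne n)
  obtain ⟨s, hs⟩ : ∃ s, s = (n : ℝ)⁻¹ • ∑ j, h j := ⟨_, rfl⟩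
  have h1 : ∑ j, h j = (n : ℝ) • s := by rw [hs, smul_smul, mul_inv_cancel₀ hn, one_smul]
  rw [← hs]
  have : ∀ i, ‖h i - s‖ ^ 2 = ‖h i‖ ^ 2 - 2 * inner ℝ (h i) s + ‖s‖ ^ 2 :=
    fun i => norm_sub_sq_real _ _
  simp only [this, Finset.sum_add_distrib, Finset.sum_sub_distrib, ← Finset.mul_sum, ← sum_inner,
    h1, real_inner_smul_left, real_inner_self_eq_norm_sq]
  simp
  nlinarith [show (0 : ℝ) ≤ n * ‖s‖ ^ 2 by positivity]

/-- The deviation of a batch mean from the mean over all indices, for every worker. -/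
def batchNoise (H : Fin M → Fin n → Vec d) (S : Batch M n b) : Stack M d :=
  WithLp.toLp 2 fun m => (b : ℝ)⁻¹ • ∑ l, H m (S m l) - (n : ℝ)⁻¹ • ∑ i, H m i

theorem batchNoise_apply [NeZero b] (H : Fin M → Fin n → Vec d) (S : Batch M n b) (m : Fin M) :
    batchNoise H S m = (b : ℝ)⁻¹ • ∑ l, (H m (S m l) - (n : ℝ)⁻¹ • ∑ i, H m i) := by
  have hb : (b : ℝ) ≠ 0 := Nat.cast_ne_zero.2 (NeZero.ne b)
  rw [Finset.sum_sub_distrib, smul_sub]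
  simp [batchNoise, ← Nat.cast_smul_eq_nsmul ℝ, smul_smul, hb]

theorem sum_sub_mean [NeZero n] (h : Fin n → V) :
    ∑ i, (h i - (n : ℝ)⁻¹ • ∑ j, h j) = 0 := by
  have hn : (n : ℝ) ≠ 0 := Nat.cast_ne_zero.2 (NeZero.ne n)
  rw [Finset.sum_sub_distrib]
  simp [← Nat.cast_smul_eq_nsmul ℝ, smul_smul, hn]

theorem expect_inner_batchNoise [NeZero n] [NeZero b] (H : Fin M → Fin n → Vec d)
    (v : Stack M d) : 𝔼 S : Batch M n b, inner ℝ (batchNoise H S) v = 0 := by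
  simp only [Stack.inner_eq]
  rw [Finset.expect_sum_comm]
  refine Finset.sum_eq_zero fun m _ => ?_
  simp only [batchNoise_apply, real_inner_smul_left, sum_inner]
  rw [← Finset.mul_expect, Finset.expect_sum_comm, Finset.sum_eq_zero, mul_zero]
  intro l _
  rw [expect_batch_marginal m l (fun i => inner ℝ (H m i - (n : ℝ)⁻¹ • ∑ j, H m j) (v m))]
  exact expect_inner_left _ _ (sum_sub_mean _)

theorem expect_norm_batchNoise_sq_le [NeZero n] [NeZero b] (H : Fin M → Fin n → Vec d) :
    𝔼 S : Batch M n b, ‖batchNoise H S‖ ^ 2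
      ≤ (b : ℝ)⁻¹ * ∑ m, (n : ℝ)⁻¹ * ∑ i, ‖H m i‖ ^ 2 := by
  have hb : (b : ℝ) ≠ 0 := Nat.cast_ne_zero.2 (NeZero.ne b)
  simp only [Stack.norm_sq_eq]
  rw [Finset.expect_sum_comm, Finset.mul_sum]
  refine Finset.sum_le_sum fun m _ => ?_
  simp only [batchNoise_apply, norm_smul, mul_pow]
  rw [← Finset.mul_expect, expect_batch_norm_sum_sq m _ (sum_sub_mean _),
    Fintype.expect_eq_sum_div_card, Real.norm_eq_abs, sq_abs, Fintype.card_fin]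
  have h1 : (b : ℝ)⁻¹ ^ 2 * (b * ((∑ i, ‖H m i - (n : ℝ)⁻¹ • ∑ j, H m j‖ ^ 2) / n))
      = (b : ℝ)⁻¹ * ((n : ℝ)⁻¹ * ∑ i, ‖H m i - (n : ℝ)⁻¹ • ∑ j, H m j‖ ^ 2) := by
    field_simp
  rw [h1]
  have := sum_norm_sub_mean_sq_le (H m)
  gcongr

theorem OperatorAssumptions.sum_le {F : Fin M → Fin n → Vec d → Vec d} {L Lbar μ : ℝ}
    (hF : OperatorAssumptions F L Lbar μ) (u v : Stack M d) :
    ∑ m, (n : ℝ)⁻¹ * ∑ i, ‖F m i (u m) - F m i (v m)‖ ^ 2 ≤ Lbar ^ 2 * ‖u - v‖ ^ 2 := by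
  rw [Stack.norm_sq_eq, Finset.mul_sum]
  exact Finset.sum_le_sum fun m _ => hF.avgLipschitz m _ _

theorem OperatorAssumptions.lift_lipschitz {F : Fin M → Fin n → Vec d → Vec d} {L Lbar μ : ℝ}
    (hF : OperatorAssumptions F L Lbar μ) (hL : 0 ≤ L) (u v : Stack M d) :
    ‖liftOp F u - liftOp F v‖ ≤ L * ‖u - v‖ := by
  refine le_of_sq_le_sq ?_ (by positivity)
  rw [mul_pow, Stack.norm_sq_eq, Stack.norm_sq_eq, Finset.mul_sum]
  refine Finset.sum_le_sum fun m _ => ?_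
  rw [← mul_pow]
  exact pow_le_pow_left₀ (norm_nonneg _) (hF.lipschitz m (u m) (v m)) 2

theorem OperatorAssumptions.lift_strongMono {F : Fin M → Fin n → Vec d → Vec d} {L Lbar μ : ℝ}
    (hF : OperatorAssumptions F L Lbar μ) (u v : Stack M d) :
    μ * ‖u - v‖ ^ 2 ≤ inner ℝ (liftOp F u - liftOp F v) (u - v) := by
  rw [Stack.norm_sq_eq, Stack.inner_eq, Finset.mul_sum]
  exact Finset.sum_le_sum fun m _ => hF.strongMono m (u m) (v m)

/-- The stochastic part `δ^{k+1/2} - 𝐅(z^{k+1})` of the estimator in the dual update. -/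
def dualNoise (F : Fin M → Fin n → Vec d → Vec d) (zp w : Stack M d) (S : Batch M n b) :
    Stack M d :=
  batchNoise (fun m i => F m i (zp m) - F m i (w m)) S

/-- The stochastic part of the estimator `δ^k` in the primal update. -/
def primalNoise (F : Fin M → Fin n → Vec d → Vec d) (α : ℝ) (z w zPrev : Stack M d)
    (S : Batch M n b) : Stack M d :=
  batchNoise (fun m i => (F m i (z m) - F m i (w m)) + α • (F m i (z m) - F m i (zPrev m))) S

/-- The full operator at w is a control variate: the estimator is exact up to the batch noise of the
differences between `zp` and `w`. -/
theorem dual_estimator_eq (F : Fin M → Fin n → Vec d → Vec d) (zp w : Stack M d)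
    (S : Batch M n b) :
    (b : ℝ)⁻¹ • ∑ l, (sampledOp F (fun m => S m l) zp - sampledOp F (fun m => S m l) w)
      + liftOp F w = liftOp F zp + dualNoise F zp w S := by
  ext1 m
  simp only [dualNoise, batchNoise, liftOp, localOp, sampledOp, PiLp.add_apply, PiLp.smul_apply,
    WithLp.ofLp_sum, Finset.sum_apply, PiLp.sub_apply, Finset.sum_sub_distrib, smul_sub]
  abel

/-- The estimator has the optimistic value as its mean; sampling the extrapolation with the same
batch keeps the noise a function of differences only. -/
theorem primal_estimator_eq (F : Fin M → Fin n → Vec d → Vec d) (α : ℝ)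
    (z w zPrev : Stack M d) (S : Batch M n b) :
    (b : ℝ)⁻¹ • ∑ l, (sampledOp F (fun m => S m l) z - sampledOp F (fun m => S m l) w
        + α • (sampledOp F (fun m => S m l) z - sampledOp F (fun m => S m l) zPrev))
      + liftOp F w
      = (liftOp F z + α • (liftOp F z - liftOp F zPrev)) + primalNoise F α z w zPrev S := by
  ext1 m
  simp only [primalNoise, batchNoise, liftOp, localOp, sampledOp, PiLp.add_apply, PiLp.smul_apply,
    WithLp.ofLp_sum, Finset.sum_apply, PiLp.sub_apply, Finset.sum_sub_distrib,
    Finset.sum_add_distrib, ← Finset.smul_sum]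
  module

theorem expect_norm_dualNoise_sq_le [NeZero n] [NeZero b]
    {F : Fin M → Fin n → Vec d → Vec d} {L Lbar μ : ℝ}
    (hF : OperatorAssumptions F L Lbar μ) (zp w : Stack M d) :
    𝔼 S : Batch M n b, ‖dualNoise F zp w S‖ ^ 2 ≤ Lbar ^ 2 / b * ‖zp - w‖ ^ 2 := by
  refine (expect_norm_batchNoise_sq_le _).trans ?_
  rw [div_eq_inv_mul, mul_assoc]
  have := hF.sum_le zp w
  gcongr

theorem expect_norm_primalNoise_sq_le [NeZero n] [NeZero b]
    {F : Fin M → Fin n → Vec d → Vec d} {L Lbar μ : ℝ}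
    (hF : OperatorAssumptions F L Lbar μ) (α : ℝ) (z w zPrev : Stack M d) :
    𝔼 S : Batch M n b, ‖primalNoise F α z w zPrev S‖ ^ 2
      ≤ 2 * (Lbar ^ 2 / b) * (‖z - w‖ ^ 2 + α ^ 2 * ‖z - zPrev‖ ^ 2) := by
  refine (expect_norm_batchNoise_sq_le _).trans ?_
  have h1 := hF.sum_le z w
  have h2 := hF.sum_le z zPrev
  have h3 : ∑ m, (n : ℝ)⁻¹ * ∑ i, ‖F m i (z m) - F m i (w m)
      + α • (F m i (z m) - F m i (zPrev m))‖ ^ 2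
      ≤ 2 * (∑ m, (n : ℝ)⁻¹ * ∑ i, ‖F m i (z m) - F m i (w m)‖ ^ 2)
        + 2 * α ^ 2 * (∑ m, (n : ℝ)⁻¹ * ∑ i, ‖F m i (z m) - F m i (zPrev m)‖ ^ 2) := by
    rw [Finset.mul_sum, Finset.mul_sum, ← Finset.sum_add_distrib]
    refine Finset.sum_le_sum fun m _ => ?_
    rw [mul_left_comm 2, mul_left_comm (2 * α ^ 2), ← mul_add, Finset.mul_sum _ _ 2,
      Finset.mul_sum _ _ (2 * α ^ 2), ← Finset.sum_add_distrib]
    gcongr with i _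
    refine (norm_add_sq_le_two _ _).trans (le_of_eq ?_)
    rw [norm_smul, mul_pow, Real.norm_eq_abs, sq_abs]
    ring
  have h4 : 2 * (Lbar ^ 2 / b) * (‖z - w‖ ^ 2 + α ^ 2 * ‖z - zPrev‖ ^ 2)
      = (b : ℝ)⁻¹ * (2 * (Lbar ^ 2 * ‖z - w‖ ^ 2)
        + 2 * α ^ 2 * (Lbar ^ 2 * ‖z - zPrev‖ ^ 2)) := by ring
  rw [h4]
  gcongr
  refine h3.trans ?_
  gcongr

end Sampling

end DecVI

namespace DecVI

variable {M d n b : ℕ}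

/-! ### Existence and optimality of the proximal point. -/

section Prox

variable {g : Vec d → EReal}

theorem ProperClosedConvex.coe_toReal (hg : ProperClosedConvex g) {x : Vec d} (hx : g x ≠ ⊤) :
    ((g x).toReal : EReal) = g x := EReal.coe_toReal hx (hg.ne_bot x)

theorem IsSolution.toReal_le {F : Fin M → Fin n → Vec d → Vec d} {zs : Vec d}
    (hg : ProperClosedConvex g) (hs : IsSolution F g zs) {x : Vec d} (hx : g x ≠ ⊤) :
    (g zs).toReal ≤ inner ℝ (sumOp F zs) (x - zs) + (g x).toReal := by
  have h := hs.2 x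
  rw [← hg.coe_toReal hx, ← hg.coe_toReal hs.1] at h
  exact_mod_cast h

theorem ProperClosedConvex.combo (hg : ProperClosedConvex g) {x y : Vec d} (hx : g x ≠ ⊤)
    (hy : g y ≠ ⊤) {t : ℝ} (h0 : 0 ≤ t) (h1 : t ≤ 1) :
    g ((1 - t) • x + t • y) ≠ ⊤ ∧
      (g ((1 - t) • x + t • y)).toReal ≤ (1 - t) * (g x).toReal + t * (g y).toReal := by
  have hmx : (x, (g x).toReal) ∈ {q : Vec d × ℝ | g q.1 ≤ (q.2 : EReal)} :=
    (hg.coe_toReal hx).ge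
  have hmy : (y, (g y).toReal) ∈ {q : Vec d × ℝ | g q.1 ≤ (q.2 : EReal)} :=
    (hg.coe_toReal hy).ge
  have h := hg.convex hmx hmy (sub_nonneg.2 h1) h0 (by ring)
  simp only [Prod.smul_mk, Prod.mk_add_mk, Set.mem_ofPred_eq, smul_eq_mul] at h
  have hne : g ((1 - t) • x + t • y) ≠ ⊤ := fun hh => by
    rw [hh] at h; exact absurd h (by simp [-EReal.coe_add])
  refine ⟨hne, ?_⟩
  rw [← hg.coe_toReal hne] at h
  exact_mod_cast h

/-- A closed convex function with an affine minorant has proximal points. -/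
theorem ProperClosedConvex.exists_prox (hg : ProperClosedConvex g) {zs q : Vec d}
    (hzs : g zs ≠ ⊤)
    (hq : ∀ x, g x ≠ ⊤ → (g zs).toReal ≤ inner ℝ q (x - zs) + (g x).toReal) {c : ℝ} (hc : 0 < c)
    (v : Vec d) :
    ∃ x, g x ≠ ⊤ ∧ ∀ x', g x' ≠ ⊤ →
      c * (g x).toReal + ‖x - v‖ ^ 2 / 2 ≤ c * (g x').toReal + ‖x' - v‖ ^ 2 / 2 := by
  -- Beyond this radius around `zs` the quadratic beats the affine minorant and the objective is at
  -- least its value at `zs`, so a minimizer over the compact ball is global.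
  obtain ⟨r, hr⟩ : ∃ r, r = 2 * ‖zs - v‖ + 2 * c * ‖q‖ := ⟨_, rfl⟩
  have hr0 : 0 ≤ r := by rw [hr]; positivity
  have hlsc : LowerSemicontinuous
      (fun x => g x + (((2 * c)⁻¹ * ‖x - v‖ ^ 2 : ℝ) : EReal)) := by
    refine hg.lsc.add' (Continuous.lowerSemicontinuous ?_) fun x => ?_
    · exact continuous_coe_real_ereal.comp (by fun_prop)
    · exact EReal.continuousAt_add (Or.inr (EReal.coe_ne_bot _)) (Or.inr (EReal.coe_ne_top _))
  obtain ⟨x, hxm, hx⟩ := LowerSemicontinuousOn.exists_isMinOn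
    (s := Metric.closedBall zs r) ⟨zs, Metric.mem_closedBall_self hr0⟩
    (isCompact_closedBall _ _) (hlsc.lowerSemicontinuousOn _)
  have hxzs := hx (Metric.mem_closedBall_self hr0)
  simp only [Set.mem_ofPred_eq] at hxzs
  have hgx : g x ≠ ⊤ := fun hh => by
    rw [hh, EReal.top_add_coe, ← hg.coe_toReal hzs, ← EReal.coe_add, top_le_iff] at hxzs
    exact EReal.coe_ne_top _ hxzs
  have hball : ∀ x', g x' ≠ ⊤ → x' ∈ Metric.closedBall zs r →
      c * (g x).toReal + ‖x - v‖ ^ 2 / 2 ≤ c * (g x').toReal + ‖x' - v‖ ^ 2 / 2 := by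
    intro x' hx' hm
    have h := hx hm
    simp only [Set.mem_ofPred_eq] at h
    rw [← hg.coe_toReal hx', ← hg.coe_toReal hgx] at h
    have h' : (g x).toReal + (2 * c)⁻¹ * ‖x - v‖ ^ 2
        ≤ (g x').toReal + (2 * c)⁻¹ * ‖x' - v‖ ^ 2 := by exact_mod_cast h
    have h2 := mul_le_mul_of_nonneg_left h' hc.le
    have e : ∀ s : ℝ, c * ((2 * c)⁻¹ * s) = s / 2 := fun s => by field_simp
    rw [mul_add, mul_add, e, e] at h2
    exact h2
  refine ⟨x, hgx, fun x' hx' => ?_⟩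
  by_cases hm : x' ∈ Metric.closedBall zs r
  · exact hball x' hx' hm
  refine (hball zs hzs (Metric.mem_closedBall_self hr0)).trans ?_
  rw [Metric.mem_closedBall, not_le, dist_eq_norm] at hm
  have h1 := mul_le_mul_of_nonneg_left (hq x' hx') hc.le
  have h2 : inner ℝ q (x' - zs) ≤ ‖q‖ * ‖x' - zs‖ := real_inner_le_norm _ _
  have h3 : ‖x' - zs‖ - ‖zs - v‖ ≤ ‖x' - v‖ := by
    have := norm_sub_le (x' - v) (zs - v)
    rw [sub_sub_sub_cancel_right] at this
    linarith
  have h4 : (‖x' - zs‖ - ‖zs - v‖) ^ 2 ≤ ‖x' - v‖ ^ 2 := by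
    refine pow_le_pow_left₀ ?_ h3 2
    have : 0 ≤ c * ‖q‖ := by positivity
    linarith [norm_nonneg (zs - v)]
  have h5 : 0 ≤ ‖x' - zs‖ * (‖x' - zs‖ - r) :=
    mul_nonneg (norm_nonneg _) (by linarith)
  rw [hr] at h5
  nlinarith [mul_le_mul_of_nonneg_left h2 hc.le]

theorem ProperClosedConvex.sum_eq_coe (hg : ProperClosedConvex g) {u : Stack M d}
    (hu : ∀ m, g (u m) ≠ ⊤) : ∑ m, g (u m) = ((∑ m, (g (u m)).toReal : ℝ) : EReal) := by
  have h : ∀ s : Finset (Fin M), ∑ m ∈ s, g (u m) = ((∑ m ∈ s, (g (u m)).toReal : ℝ) : EReal) :=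
    fun s => by
      induction s using Finset.cons_induction with
      | empty => simp
      | cons m s hm ih =>
        rw [Finset.sum_cons, Finset.sum_cons, ih, EReal.coe_add, hg.coe_toReal (hu m)]
  exact h _

theorem ProperClosedConvex.sum_eq_top (hg : ProperClosedConvex g) {u : Stack M d}
    {m : Fin M} (hu : g (u m) = ⊤) : ∑ m, g (u m) = ⊤ := by
  rw [← Finset.add_sum_erase _ _ (Finset.mem_univ m), hu]
  refine EReal.top_add_of_ne_bot ?_
  refine Finset.sum_induction _ (fun x => x ≠ ⊥) (fun a b ha hb => ?_) (by simp)
    fun i _ => hg.ne_bot _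
  simp [EReal.add_eq_bot_iff, ha, hb]

theorem ProperClosedConvex.objective_eq_coe (hg : ProperClosedConvex g) {u : Stack M d}
    (hu : ∀ m, g (u m) ≠ ⊤) (η r : ℝ) :
    (η : EReal) * liftReg g u + (r : EReal)
      = ((η * ((M : ℝ)⁻¹ * ∑ m, (g (u m)).toReal) + r : ℝ) : EReal) := by
  rw [liftReg, hg.sum_eq_coe hu, ← EReal.coe_mul, ← EReal.coe_mul, ← EReal.coe_add]

theorem ProperClosedConvex.objective_eq_top (hg : ProperClosedConvex g) (hM : 0 < M)
    {u : Stack M d} {m : Fin M} (hu : g (u m) = ⊤) {η : ℝ} (hη : 0 < η) (r : ℝ) :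
    (η : EReal) * liftReg g u + (r : EReal) = ⊤ := by
  have : (0 : ℝ) < (M : ℝ)⁻¹ := by positivity
  rw [liftReg, hg.sum_eq_top hu, EReal.coe_mul_top_of_pos this, EReal.coe_mul_top_of_pos hη,
    EReal.top_add_coe]

theorem exists_isProxPoint {F : Fin M → Fin n → Vec d → Vec d} {zs : Vec d}
    (hg : ProperClosedConvex g) (hs : IsSolution F g zs) (hM : 0 < M) {η : ℝ} (hη : 0 < η)
    (v : Stack M d) : ∃ u, IsProxPoint g η v u := by
  have hc : 0 < η * (M : ℝ)⁻¹ := by positivity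
  choose u hu hmin using fun m => hg.exists_prox hs.1 (fun x hx => hs.toReal_le hg hx) hc (v m)
  refine ⟨WithLp.toLp 2 u, fun u' => ?_⟩
  by_cases hu' : ∀ m, g (u' m) ≠ ⊤
  · rw [hg.objective_eq_coe hu', hg.objective_eq_coe (u := WithLp.toLp 2 u) hu]
    refine EReal.coe_le_coe_iff.2 ?_
    rw [Stack.norm_sq_eq, Stack.norm_sq_eq, ← mul_assoc, ← mul_assoc, Finset.mul_sum,
      Finset.mul_sum, Finset.sum_div, Finset.sum_div, ← Finset.sum_add_distrib,
      ← Finset.sum_add_distrib]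
    exact Finset.sum_le_sum fun m _ => hmin m (u' m) (hu' m)
  · push Not at hu'
    obtain ⟨m, hm⟩ := hu'
    rw [hg.objective_eq_top hM hm hη]
    exact le_top

/-- If `t A ≤ t B + t² C` for all `t ∈ (0, 1]`, then `A ≤ B`. -/
theorem le_of_forall_scaled {A B C : ℝ} (hC : 0 ≤ C)
    (h : ∀ t, 0 < t → t ≤ 1 → t * A ≤ t * B + t ^ 2 * C) : A ≤ B := by
  by_contra hlt
  push Not at hlt
  have h1 : 0 < C + 1 + (A - B) := by linarith
  have h0 : 0 < (A - B) / (C + 1 + (A - B)) := div_pos (by linarith) h1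
  have h2 := h _ h0 (by rw [div_le_one h1]; linarith)
  have h3 : A ≤ B + (A - B) / (C + 1 + (A - B)) * C := by
    refine le_of_mul_le_mul_left ?_ h0
    linarith
  rw [div_mul_eq_mul_div, ← sub_le_iff_le_add', le_div_iff₀ h1] at h3
  nlinarith

/-- First-order optimality of the proximal point, combined with that of the solution. -/
theorem prox_inner_nonneg {F : Fin M → Fin n → Vec d → Vec d} {zs : Vec d}
    (hg : ProperClosedConvex g) (hs : IsSolution F g zs) (hM : 0 < M) {η : ℝ} (hη : 0 < η)
    (v : Stack M d) :
    0 ≤ inner ℝ (v - prox g η v + η • diag M ((M : ℝ)⁻¹ • sumOp F zs))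
      (prox g η v - diag M zs) := by
  have hu : IsProxPoint g η v (prox g η v) :=
    Classical.epsilon_spec (exists_isProxPoint hg hs hM hη v)
  generalize prox g η v = u at *
  have hM' : (0 : ℝ) < (M : ℝ)⁻¹ := by positivity
  have hdiag : ∀ m : Fin M, g (diag M zs m) ≠ ⊤ := fun m => hs.1
  have hdom : ∀ m, g (u m) ≠ ⊤ := by
    intro m hm
    have h := hu (diag M zs)
    rw [hg.objective_eq_top hM hm hη, hg.objective_eq_coe hdiag, top_le_iff] at h
    exact EReal.coe_ne_top _ h
  have hopt : η * ((M : ℝ)⁻¹ * ∑ m, (g (u m)).toReal)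
      - η * ((M : ℝ)⁻¹ * ∑ m : Fin M, (g zs).toReal) ≤ inner ℝ (v - u) (u - diag M zs) := by
    -- The minimizer is compared with the points at parameter t on the segment from u to the
    -- solution; convexity bounds the regularizer, and the quadratic term in t disappears as t tends
    -- to 0.
    refine le_of_forall_scaled (C := ‖diag M zs - u‖ ^ 2 / 2) (by positivity) fun t h0 h1 => ?_
    have hcombo := fun m => hg.combo (hdom m) hs.1 h0.le h1
    have h := hu ((1 - t) • u + t • diag M zs)
    rw [hg.objective_eq_coe hdom, hg.objective_eq_coe (fun m => (hcombo m).1)] at h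
    replace h := EReal.coe_le_coe_iff.1 h
    have hsum : ∑ m, (g (((1 - t) • u + t • diag M zs : Stack M d) m)).toReal
        ≤ (1 - t) * ∑ m, (g (u m)).toReal + t * ∑ m : Fin M, (g zs).toReal := by
      rw [Finset.mul_sum, Finset.mul_sum, ← Finset.sum_add_distrib]
      exact Finset.sum_le_sum fun m _ => (hcombo m).2
    have hsum' := mul_le_mul_of_nonneg_left hsum (mul_pos hη hM').le
    have e1 : (1 - t) • u + t • diag M zs - v = (u - v) + t • (diag M zs - u) := by module
    have e2 : inner ℝ (u - v) (diag M zs - u) = inner ℝ (v - u) (u - diag M zs) := by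
      rw [← neg_sub v u, ← neg_sub u (diag M zs), inner_neg_neg]
    rw [e1, norm_add_sq_real, real_inner_smul_right, e2, norm_smul, mul_pow, Real.norm_eq_abs,
      sq_abs] at h
    linarith
  have hsol : ∑ m : Fin M, (g zs).toReal
      ≤ ∑ m, inner ℝ (sumOp F zs) (u m - zs) + ∑ m, (g (u m)).toReal := by
    rw [← Finset.sum_add_distrib]
    exact Finset.sum_le_sum fun m _ => hs.toReal_le hg (hdom m)
  have hin : inner ℝ (diag M ((M : ℝ)⁻¹ • sumOp F zs)) (u - diag M zs)
      = (M : ℝ)⁻¹ * ∑ m, inner ℝ (sumOp F zs) (u m - zs) := by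
    rw [Stack.inner_eq, Finset.mul_sum]
    exact Finset.sum_congr rfl fun m _ => real_inner_smul_left _ _ _
  have hsol' := mul_le_mul_of_nonneg_left hsol (mul_pos hη hM').le
  rw [inner_add_left, real_inner_smul_left, hin]
  linarith

end Prox

end DecVI

namespace DecVI

variable {M d n b : ℕ}

/-! ### Gossip matrices and multi-consensus. -/

section Network

/-- `proj` as a linear map. -/
def projLin (M d : ℕ) : Stack M d →ₗ[ℝ] Stack M d where
  toFun := proj
  map_add' u v := by
    ext1 m
    simp only [proj, PiLp.add_apply, Finset.sum_add_distrib, smul_add]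
    abel
  map_smul' r u := by
    ext1 m
    simp only [proj, PiLp.smul_apply, ← Finset.smul_sum, RingHom.id_apply, smul_sub]
    rw [smul_comm]

/-- `gossip A` as a linear map. -/
def gossipLin (d : ℕ) (A : Matrix (Fin M) (Fin M) ℝ) : Stack M d →ₗ[ℝ] Stack M d where
  toFun := gossip A
  map_add' u v := by
    ext1 m
    simp only [gossip, PiLp.add_apply, Finset.sum_add_distrib, smul_add]
  map_smul' r u := by
    ext1 m
    simp only [gossip, PiLp.smul_apply, Finset.smul_sum, RingHom.id_apply]
    exact Finset.sum_congr rfl fun j _ => smul_comm _ _ _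

theorem projLin_apply (u : Stack M d) : projLin M d u = proj u := rfl

theorem proj_apply (u : Stack M d) (m : Fin M) : proj u m = u m - (M : ℝ)⁻¹ • ∑ i, u i := rfl

theorem gossip_apply (A : Matrix (Fin M) (Fin M) ℝ) (u : Stack M d) (m : Fin M) :
    gossip A u m = ∑ j, A m j • u j := rfl

theorem ZeroSum.proj_eq {u : Stack M d} (hu : ZeroSum u) : proj u = u := by
  ext1 m
  rw [proj_apply, show ∑ i, u i = 0 from hu, smul_zero, sub_zero]

theorem zeroSum_proj (hM : 0 < M) (u : Stack M d) : ZeroSum (proj u) := by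
  have hM' : (M : ℝ) ≠ 0 := by positivity
  simp [ZeroSum, proj_apply, ← Nat.cast_smul_eq_nsmul ℝ, smul_smul, hM']

theorem proj_diag (hM : 0 < M) (a : Vec d) : proj (diag M a) = 0 := by
  have hM' : (M : ℝ) ≠ 0 := by positivity
  ext1 m
  rw [proj_apply]
  simp [diag, ← Nat.cast_smul_eq_nsmul ℝ, smul_smul, hM']

theorem zeroSum_gossip {A : Matrix (Fin M) (Fin M) ℝ} (hA : ∀ j, ∑ i, A i j = 0)
    (u : Stack M d) : ZeroSum (gossip A u) := by
  simp only [ZeroSum, gossip_apply]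
  rw [Finset.sum_comm]
  simp [← Finset.sum_smul, hA]

theorem gossip_proj_eq {A : Matrix (Fin M) (Fin M) ℝ} (hA : ∀ i, ∑ j, A i j = 0)
    (u : Stack M d) : gossip A (proj u) = gossip A u := by
  ext1 m
  simp only [gossip_apply, proj_apply, smul_sub, Finset.sum_sub_distrib]
  rw [← Finset.sum_smul, hA, zero_smul, sub_zero]

theorem ZeroSum.add {u v : Stack M d} (hu : ZeroSum u) (hv : ZeroSum v) : ZeroSum (u + v) := by
  simp only [ZeroSum, PiLp.add_apply, Finset.sum_add_distrib] at *
  rw [hu, hv, add_zero]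

theorem ZeroSum.smul {u : Stack M d} (hu : ZeroSum u) (r : ℝ) : ZeroSum (r • u) := by
  simp only [ZeroSum, PiLp.smul_apply, ← Finset.smul_sum] at *
  rw [hu, smul_zero]

theorem ZeroSum.sub {u v : Stack M d} (hu : ZeroSum u) (hv : ZeroSum v) : ZeroSum (u - v) := by
  simp only [ZeroSum, PiLp.sub_apply, Finset.sum_sub_distrib] at *
  rw [hu, hv, sub_zero]

theorem ZeroSum.neg {u : Stack M d} (hu : ZeroSum u) : ZeroSum (-u) := by
  simp only [ZeroSum, PiLp.neg_apply, Finset.sum_neg_distrib] at *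
  rw [hu, neg_zero]

theorem isGossip_of_contracts (hM : 0 < M) {A : Matrix (Fin M) (Fin M) ℝ} {χ : ℝ}
    (hrow : ∀ i, ∑ j, A i j = 0) (hcol : ∀ j, ∑ i, A i j = 0) (hA : Contracts d A χ) :
    IsGossip (projLin M d) (gossipLin d A) χ where
  symm u v := by
    simp only [projLin_apply, Stack.inner_eq, proj_apply, inner_sub_left, inner_sub_right,
      Finset.sum_sub_distrib, real_inner_smul_left, real_inner_smul_right, ← Finset.mul_sum,
      ← inner_sum, ← sum_inner]
  idem v := (zeroSum_proj hM v).proj_eq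
  proj_gossip v := (zeroSum_gossip hcol v).proj_eq
  gossip_proj v := gossip_proj_eq hrow v
  contract v := by
    have := hA (proj v) (zeroSum_proj hM v)
    rwa [gossip_proj_eq hrow] at this

variable {B : ℕ} {G : ℕ → Digraph (Fin M)} {W : ℕ → Matrix (Fin M) (Fin M) ℝ}

theorem GossipNetwork.pos (hW : GossipNetwork B G W) : 0 < M :=
  have := (hW.connected 0).nonempty
  Fin.pos_iff_nonempty.2 this

theorem GossipNetwork.mixing_mulVec_one (hW : GossipNetwork B G W) (t T : ℕ) :
    (mixing W t T).mulVec 1 = 1 := by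
  induction T with
  | zero => simp [mixing]
  | succ T ih =>
    rw [mixing, ← Matrix.mulVec_mulVec, ih, Matrix.sub_mulVec, Matrix.one_mulVec]
    have : (W (t + T)).mulVec 1 = 0 := by
      ext i; simpa [Matrix.mulVec, dotProduct] using hW.ker (t + T) i
    rw [this, sub_zero]

theorem GossipNetwork.one_vecMul_mixing (hW : GossipNetwork B G W) (t T : ℕ) :
    Matrix.vecMul 1 (mixing W t T) = 1 := by
  induction T with
  | zero => simp [mixing]
  | succ T ih =>
    have : Matrix.vecMul 1 (W (t + T)) = 0 := by
      ext i; simpa [Matrix.vecMul, dotProduct] using hW.range (t + T) i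
    rw [mixing, ← Matrix.vecMul_vecMul, Matrix.vecMul_sub, Matrix.vecMul_one, this, sub_zero, ih]

theorem GossipNetwork.multiGossip_row (hW : GossipNetwork B G W) (T t : ℕ) (i : Fin M) :
    ∑ j, multiGossip W T t i j = 0 := by
  have h : (multiGossip W T t).mulVec 1 = 0 := by
    rw [multiGossip, Matrix.sub_mulVec, hW.mixing_mulVec_one, Matrix.one_mulVec, sub_self]
  simpa [Matrix.mulVec, dotProduct] using congrFun h i

theorem GossipNetwork.multiGossip_col (hW : GossipNetwork B G W) (T t : ℕ) (j : Fin M) :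
    ∑ i, multiGossip W T t i j = 0 := by
  have h : Matrix.vecMul 1 (multiGossip W T t) = 0 := by
    rw [multiGossip, Matrix.vecMul_sub, hW.one_vecMul_mixing, Matrix.vecMul_one, sub_self]
  simpa [Matrix.vecMul, dotProduct] using congrFun h j

theorem GossipNetwork.isGossip (hW : GossipNetwork B G W) {T t : ℕ} {χ : ℝ}
    (hc : Contracts d (multiGossip W T t) χ) :
    IsGossip (projLin M d) (gossipLin d (multiGossip W T t)) χ :=
  isGossip_of_contracts hW.pos (hW.multiGossip_row T t) (hW.multiGossip_col T t) hc

theorem mixing_add (W : ℕ → Matrix (Fin M) (Fin M) ℝ) (t S T : ℕ) :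
    mixing W t (S + T) = mixing W (t + S) T * mixing W t S := by
  induction T with
  | zero => simp [mixing]
  | succ T ih => rw [← add_assoc, mixing, mixing, ih, Matrix.mul_assoc, add_assoc]

theorem gossip_mul (A A' : Matrix (Fin M) (Fin M) ℝ) (u : Stack M d) :
    gossip (A * A') u = gossip A (gossip A' u) := by
  ext1 m
  simp only [gossip_apply, Matrix.mul_apply, Finset.sum_smul, Finset.smul_sum, smul_smul]
  exact Finset.sum_comm

theorem gossip_one (u : Stack M d) : gossip (1 : Matrix (Fin M) (Fin M) ℝ) u = u := by
  ext1 m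
  simp [gossip_apply, Matrix.one_apply, ite_smul]

theorem gossip_multiGossip (W : ℕ → Matrix (Fin M) (Fin M) ℝ) (T t : ℕ) (u : Stack M d) :
    gossip (multiGossip W T t) u = u - gossip (mixing W t T) u := by
  ext1 m
  conv_rhs => rw [← gossip_one u]
  rw [PiLp.sub_apply, gossip_apply, gossip_apply, gossip_one, gossip_apply,
    ← Finset.sum_sub_distrib]
  simp only [multiGossip, Matrix.sub_apply, sub_smul]

theorem GossipNetwork.zeroSum_mixing (hW : GossipNetwork B G W) (T t : ℕ) {u : Stack M d}
    (hu : ZeroSum u) : ZeroSum (gossip (mixing W t T) u) := by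
  have h1 := zeroSum_gossip (hW.multiGossip_col T t) u
  rw [gossip_multiGossip] at h1
  simpa using hu.sub h1

/-- Consecutive blocks of S rounds compose, and each maps zero-sum vectors to zero-sum vectors, so
the contraction can be applied again. -/
theorem GossipNetwork.norm_mixing_sq_le (hW : GossipNetwork B G W) {χ : ℝ} (hχ : 1 ≤ χ) {S : ℕ}
    (hc : ∀ t, Contracts d (multiGossip W S t) χ) (q t : ℕ) {u : Stack M d} (hu : ZeroSum u) :
    ‖gossip (mixing W t (S * q)) u‖ ^ 2 ≤ (1 - χ⁻¹) ^ q * ‖u‖ ^ 2 := by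
  have hχ' : 0 ≤ 1 - χ⁻¹ := sub_nonneg.2 (inv_le_one_of_one_le₀ hχ)
  induction q with
  | zero => simp [mixing, gossip_one]
  | succ q ih =>
    rw [Nat.mul_succ, mixing_add, gossip_mul]
    have h := hc (t + S * q) _ (hW.zeroSum_mixing (S * q) t hu)
    rw [gossip_multiGossip, sub_sub_cancel_left, norm_neg] at h
    calc _ ≤ _ := h
      _ ≤ (1 - χ⁻¹) * ((1 - χ⁻¹) ^ q * ‖u‖ ^ 2) := by gcongr
      _ = _ := by ring

/-- The estimate (1 - 1/χ)^q ≤ exp(-q/χ) ≤ 1/2 holds as soon as q ≥ χ ln 2. -/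
theorem GossipNetwork.contracts_two (hW : GossipNetwork B G W) {χ : ℝ} (hχ : 1 ≤ χ) {S : ℕ}
    (hc : ∀ t, Contracts d (multiGossip W S t) χ) {q : ℕ} (hq : χ * Real.log 2 ≤ q) (t : ℕ) :
    Contracts d (multiGossip W (S * q) t) 2 := by
  intro u hu
  have h := hW.norm_mixing_sq_le hχ hc q t hu
  rw [gossip_multiGossip, sub_sub_cancel_left, norm_neg]
  refine h.trans ?_
  have hχ0 : 0 < χ := by linarith
  have hχ' : 0 ≤ 1 - χ⁻¹ := sub_nonneg.2 (inv_le_one_of_one_le₀ hχ)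
  have h1 : (1 - χ⁻¹) ^ q ≤ 1 - 2⁻¹ := by
    calc (1 - χ⁻¹) ^ q ≤ Real.exp (-χ⁻¹) ^ q := by
          gcongr
          linarith [Real.add_one_le_exp (-χ⁻¹)]
      _ = Real.exp (-(χ⁻¹ * q)) := by rw [← Real.exp_nat_mul]; congr 1; ring
      _ ≤ Real.exp (-Real.log 2) := by
          gcongr
          rw [inv_mul_eq_div, le_div_iff₀ hχ0]; linarith
      _ = 1 - 2⁻¹ := by rw [Real.exp_neg, Real.exp_log (by norm_num)]; norm_num
  gcongr

end Network

/-! ### The Lyapunov function and its change in one iteration. -/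

section Descent

variable (F : Fin M → Fin n → Vec d → Vec d) (g : Vec d → EReal) (c : Params)

/-- The optimal dual variable `𝐏𝐅(𝐳*) - ν𝐳*`. -/
def yOpt (zs : Vec d) : Stack M d := proj (liftOp F (diag M zs)) - c.ν • diag M zs

/-- The optimal dual variable `-𝐏𝐅(𝐳*)`. -/
def xOpt (zs : Vec d) : Stack M d := -proj (liftOp F (diag M zs))

theorem yOpt_add_xOpt (zs : Vec d) : yOpt F c zs + xOpt F zs = -(c.ν • diag M zs) := by
  rw [yOpt, xOpt]; abel

theorem zeroSum_xOpt (hM : 0 < M) (zs : Vec d) : ZeroSum (xOpt F zs) := (zeroSum_proj hM _).neg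

theorem proj_xOpt_add (hM : 0 < M) (zs : Vec d) :
    projLin M d (xOpt F zs + liftOp F (diag M zs)) = 0 := by
  rw [map_add, projLin_apply, projLin_apply, (zeroSum_xOpt F hM zs).proj_eq, xOpt,
    neg_add_cancel]

/-- This links the dual optimum to the variational inequality: the right side is the vector for
which `prox_inner_nonneg` is stated, the left side the one that the primal estimate expects. -/
theorem liftOp_sub_yOpt (zs : Vec d) :
    liftOp F (diag M zs) - c.ν • diag M zs - yOpt F c zs = diag M ((M : ℝ)⁻¹ • sumOp F zs) := by
  ext1 m
  simp only [yOpt, PiLp.sub_apply, proj_apply]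
  simp only [diag, liftOp, sumOp]
  abel

/-- The Lyapunov function of the algorithm. -/
def lyapunov (μ p : ℝ) (zs : Vec d) (s : State M d) : ℝ :=
  (c.ηz⁻¹ + μ) * ‖s.z - diag M zs‖ ^ 2 + (c.ηz⁻¹ + c.ν / p) * ‖s.w - diag M zs‖ ^ 2
    + c.ηz⁻¹ / 2 * ‖s.z - s.zPrev‖ ^ 2 + c.ηy⁻¹ / 2 * ‖s.y - s.yPrev‖ ^ 2
    + p * c.ηz⁻¹ / 2 * ‖s.z - s.wPrev‖ ^ 2
    + 2 * inner ℝ (s.y - s.yPrev) (s.z - diag M zs)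
    - 2 * inner ℝ (liftOp F s.z - liftOp F s.zPrev) (s.z - diag M zs)
    + c.ηy⁻¹ * ‖s.y - yOpt F c zs‖ ^ 2
    + c.ηx⁻¹ * ‖s.x - projLin M d s.m - xOpt F zs‖ ^ 2 + 2 * c.ηx⁻¹ * ‖projLin M d s.m‖ ^ 2
    + (c.ν * c.τ)⁻¹ * ‖s.yf + s.xf - (yOpt F c zs + xOpt F zs)‖ ^ 2

/-- The primal update. It uses the first batch only. -/
def zNext (S : Batch M n b) (s : State M d) : Stack M d :=
  prox g c.ηz (s.z + c.ω • (s.w - s.z) - c.ηz • (((b : ℝ)⁻¹ • ∑ l,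
    (sampledOp F (fun m => S m l) s.z - sampledOp F (fun m => S m l) s.wPrev +
      c.α • (sampledOp F (fun m => S m l) s.z - sampledOp F (fun m => S m l) s.zPrev))
        + liftOp F s.wPrev) - c.ν • s.z - s.y - c.α • (s.y - s.yPrev)))

theorem step_z (A : Matrix (Fin M) (Fin M) ℝ) (ξ : Draw M n b) (s : State M d) :
    (step F g c A ξ s).z = zNext F g c ξ.1 s := rfl

theorem step_w (A : Matrix (Fin M) (Fin M) ℝ) (ξ : Draw M n b) (s : State M d) :
    (step F g c A ξ s).w = if ξ.2.2 then s.z else s.w := rfl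

/-- The vector to which the gossip matrix is applied in the update of `x`. -/
def xIncrement (S S' : Batch M n b) (s : State M d) : Stack M d :=
  c.ηx • (c.ν⁻¹ • (c.τ • s.y + (1 - c.τ) • s.yf + (c.τ • s.x + (1 - c.τ) • s.xf))
    + c.β • (s.x + ((b : ℝ)⁻¹ • ∑ l, (sampledOp F (fun m => S' m l) (zNext F g c S s)
      - sampledOp F (fun m => S' m l) s.w) + liftOp F s.w))) + s.m

theorem step_y (A : Matrix (Fin M) (Fin M) ℝ) (ξ : Draw M n b) (s : State M d) :
    (step F g c A ξ s).y = s.y - c.ηy • (c.ν⁻¹ • (c.τ • s.y + (1 - c.τ) • s.yf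
      + (c.τ • s.x + (1 - c.τ) • s.xf)) + zNext F g c ξ.1 s
      + c.γ • (s.y + s.x + c.ν • s.z)) := rfl

theorem step_yf (A : Matrix (Fin M) (Fin M) ℝ) (ξ : Draw M n b) (s : State M d) :
    (step F g c A ξ s).yf = c.τ • s.y + (1 - c.τ) • s.yf
      + c.τ • ((step F g c A ξ s).y - s.y) := rfl

theorem step_x (A : Matrix (Fin M) (Fin M) ℝ) (ξ : Draw M n b) (s : State M d) :
    (step F g c A ξ s).x = s.x - gossipLin d A (xIncrement F g c ξ.1 ξ.2.1 s) := rfl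

theorem step_m (A : Matrix (Fin M) (Fin M) ℝ) (ξ : Draw M n b) (s : State M d) :
    (step F g c A ξ s).m = xIncrement F g c ξ.1 ξ.2.1 s
      - gossipLin d A (xIncrement F g c ξ.1 ξ.2.1 s) := rfl

theorem step_xf (A : Matrix (Fin M) (Fin M) ℝ) (ξ : Draw M n b) (s : State M d) :
    (step F g c A ξ s).xf = c.τ • s.x + (1 - c.τ) • s.xf - c.θ • gossipLin d A
      (c.τ • s.y + (1 - c.τ) • s.yf + (c.τ • s.x + (1 - c.τ) • s.xf)) := rfl

variable {F g c}

theorem ZeroSum.step {A : Matrix (Fin M) (Fin M) ℝ} (hcol : ∀ j, ∑ i, A i j = 0)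
    (ξ : Draw M n b) {s : State M d} (hx : ZeroSum s.x) (hxf : ZeroSum s.xf) :
    ZeroSum (step F g c A ξ s).x ∧ ZeroSum (step F g c A ξ s).xf :=
  ⟨hx.sub (zeroSum_gossip hcol _),
    ((hx.smul _).add (hxf.smul _)).sub ((zeroSum_gossip hcol _).smul _)⟩

/-- One iteration changes the Lyapunov function by a factor `α`, up to terms that vanish or are
non-positive in expectation. -/
theorem lyapunov_step_le {L Lbar μ χ p : ℝ} {zs : Vec d} {A : Matrix (Fin M) (Fin M) ℝ}
    (hc : StepsizeBounds L Lbar μ χ p b c) (hF : OperatorAssumptions F L Lbar μ)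
    (hg : ProperClosedConvex g) (hs : IsSolution F g zs) (hM : 0 < M)
    (hA : IsGossip (projLin M d) (gossipLin d A) χ) (S S' : Batch M n b) (coin : Bool)
    {s : State M d} (hx : ZeroSum s.x) :
    lyapunov F c μ p zs (step F g c A (S, S', coin) s) ≤ c.α * lyapunov F c μ p zs s
      - 2 * inner ℝ (primalNoise F c.α s.z s.wPrev s.zPrev S) (s.z - diag M zs)
      + 4 * c.ηz * ‖primalNoise F c.α s.z s.wPrev s.zPrev S‖ ^ 2
      - c.α * (p * c.ηz⁻¹ / 2) * ‖s.z - s.wPrev‖ ^ 2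
      - 3 * c.α * c.ηz⁻¹ / 8 * ‖s.z - s.zPrev‖ ^ 2
      + c.β / 10 * (‖dualNoise F (zNext F g c S s) s.w S'‖ ^ 2
          - Lbar ^ 2 / b * ‖zNext F g c S s - s.w‖ ^ 2)
      + inner ℝ (dualNoise F (zNext F g c S s) s.w S') ((-2 * c.β) • (s.x - xOpt F zs)
          + (c.β / 5) • (s.x - xOpt F zs
            + (liftOp F (zNext F g c S s) - liftOp F (diag M zs))))
      + (c.ηz⁻¹ + c.ν / p) * (‖(if coin then s.z else s.w) - diag M zs‖ ^ 2
          - ((1 - p) * ‖s.w - diag M zs‖ ^ 2 + p * ‖s.z - diag M zs‖ ^ 2)) := by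
  have hprox := prox_inner_nonneg hg hs hM hc.ηz_pos (s.z + c.ω • (s.w - s.z)
    - c.ηz • (((b : ℝ)⁻¹ • ∑ l,
    (sampledOp F (fun m => S m l) s.z - sampledOp F (fun m => S m l) s.wPrev +
      c.α • (sampledOp F (fun m => S m l) s.z - sampledOp F (fun m => S m l) s.zPrev))
        + liftOp F s.wPrev) - c.ν • s.z - s.y - c.α • (s.y - s.yPrev)))
  change 0 ≤ inner ℝ (_ - zNext F g c S s + _) (zNext F g c S s - _) at hprox
  rw [← liftOp_sub_yOpt (c := c), primal_estimator_eq] at hprox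
  have hp := hc.primal_update_le (hF.lift_lipschitz hc.L_pos.le) hF.lift_strongMono
    (zPrev := s.zPrev) (yp := (step F g c A (S, S', coin) s).y) hprox
  rw [add_sub_cancel_left] at hp
  have hd := hA.dual_update_le hc (Fz := liftOp F (zNext F g c S s))
      (e := dualNoise F (zNext F g c S s) s.w S') (u := xIncrement F g c S S' s)
      hx.proj_eq (zeroSum_xOpt F hM zs).proj_eq (proj_diag hM zs) (yOpt_add_xOpt F c zs)
      (proj_xOpt_add F hM zs) rfl rfl (step_y F g c A (S, S', coin) s)
      (by rw [← dual_estimator_eq]; rfl)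
  have hpn : 0 < c.ηy⁻¹ := inv_pos.2 hc.ηy_pos
  have hxn : 0 < c.ηx⁻¹ := inv_pos.2 hc.ηx_pos
  have hν0 : 0 < c.ν := by rw [hc.ν_eq]; linarith [hc.μ_pos]
  have hτ0 := hc.τ_pos
  have c1 : c.ηy⁻¹ - c.γ ≤ c.α * c.ηy⁻¹ := by
    have h1 := mul_le_mul_of_nonneg_right hc.le_α_y hpn.le
    have h2 : c.ηy * c.ηy⁻¹ = 1 := mul_inv_cancel₀ hc.ηy_pos.ne'
    linear_combination h1 + c.γ * h2
  have c2 : c.ηx⁻¹ - c.γ ≤ c.α * c.ηx⁻¹ := by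
    have h1 := mul_le_mul_of_nonneg_right hc.le_α_x hxn.le
    have h2 : c.ηx * c.ηx⁻¹ = 1 := mul_inv_cancel₀ hc.ηx_pos.ne'
    linear_combination h1 + c.γ * h2
  have c3 : 1 - (4 * χ)⁻¹ ≤ c.α := by simpa using hc.le_α_χ
  have k1 := mul_le_mul_of_nonneg_right c1 (sq_nonneg ‖s.y - yOpt F c zs‖)
  have k2 := mul_le_mul_of_nonneg_right c2 (sq_nonneg ‖s.x - projLin M d s.m - xOpt F zs‖)
  have k3 := mul_le_mul_of_nonneg_right c3
    (show 0 ≤ 2 * c.ηx⁻¹ * ‖projLin M d s.m‖ ^ 2 by positivity)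
  have k4 := mul_le_mul_of_nonneg_right hc.le_α_τ
    (show 0 ≤ (c.ν * c.τ)⁻¹ * ‖s.yf + s.xf - (yOpt F c zs + xOpt F zs)‖ ^ 2 by positivity)
  rw [lyapunov, step_x, step_m, step_yf, step_xf, step_z, step_w, lyapunov]
  -- The fields `zPrev`, `yPrev`, `wPrev` of the new state are the old `z`, `y`, `w` by definition.
  change _ + _ * ‖(step F g c A (S, S', coin) s).z - s.z‖ ^ 2
    + _ * ‖(step F g c A (S, S', coin) s).y - s.y‖ ^ 2
    + _ * ‖(step F g c A (S, S', coin) s).z - s.w‖ ^ 2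
    + 2 * inner ℝ ((step F g c A (S, S', coin) s).y - s.y) _
    - 2 * inner ℝ (_ - liftOp F s.z) _ + _ + _ + _ + _ ≤ _
  rw [step_z]
  linear_combination hp + hd + k1 + k2 + k3 + k4

end Descent

end DecVI

namespace DecVI

variable {M d n b : ℕ}

/-! ### Averaging over one iteration, and the initial and final bounds. -/

section Expectation

open scoped BigOperators

/-- The mean over the random choices of one iteration. -/
def drawMean (p : ℝ) (f : Draw M n b → ℝ) : ℝ :=
  𝔼 S, 𝔼 S', (p * f (S, S', true) + (1 - p) * f (S, S', false))

variable {F : Fin M → Fin n → Vec d → Vec d} {g : Vec d → EReal} {c : Params}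

/-- The order of averaging matters. For fixed S the new z is fixed, so the coin averages the w-term
exactly, the dual noise has mean zero against a vector independent of S', and its variance cancels
the subtracted square. The mean over S then removes the primal noise, which is tested against the
old z; its variance is covered by the two negative squares. -/
theorem drawMean_lyapunov_le [NeZero n] [NeZero b] {L Lbar μ χ p : ℝ} {zs : Vec d}
    {A : Matrix (Fin M) (Fin M) ℝ}
    (hc : StepsizeBounds L Lbar μ χ p b c) (hF : OperatorAssumptions F L Lbar μ)
    (hg : ProperClosedConvex g) (hs : IsSolution F g zs) (hM : 0 < M)
    (hA : IsGossip (projLin M d) (gossipLin d A) χ) {s : State M d} (hx : ZeroSum s.x) :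
    drawMean p (fun ξ : Draw M n b => lyapunov F c μ p zs (step F g c A ξ s))
      ≤ c.α * lyapunov F c μ p zs s := by
  have hα0 := hc.α_nonneg
  have hη0 := hc.ηz_pos
  have hp0 := hc.p_pos
  have hp1 := hc.p_le
  have hb0 : (0 : ℝ) < b := by exact_mod_cast hc.b_pos
  have hβ0 : 0 ≤ c.β / 10 := by rw [hc.β_eq]; linarith [hc.γ_pos]
  have h1 : ∀ S : Batch M n b,
      𝔼 S' : Batch M n b, (p * lyapunov F c μ p zs (step F g c A (S, S', true) s)
        + (1 - p) * lyapunov F c μ p zs (step F g c A (S, S', false) s))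
      ≤ c.α * lyapunov F c μ p zs s
        - c.α * (p * c.ηz⁻¹ / 2) * ‖s.z - s.wPrev‖ ^ 2
        - 3 * c.α * c.ηz⁻¹ / 8 * ‖s.z - s.zPrev‖ ^ 2
        - 2 * inner ℝ (primalNoise F c.α s.z s.wPrev s.zPrev S) (s.z - diag M zs)
        + 4 * c.ηz * ‖primalNoise F c.α s.z s.wPrev s.zPrev S‖ ^ 2 := by
    intro S
    obtain ⟨ℓ, hℓ⟩ : ∃ ℓ, ℓ = (-2 * c.β) • (s.x - xOpt F zs)
          + (c.β / 5) • (s.x - xOpt F zs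
            + (liftOp F (zNext F g c S s) - liftOp F (diag M zs))) := ⟨_, rfl⟩
    have hb : ∀ S' : Batch M n b, p * lyapunov F c μ p zs (step F g c A (S, S', true) s)
        + (1 - p) * lyapunov F c μ p zs (step F g c A (S, S', false) s)
        ≤ (c.α * lyapunov F c μ p zs s
          - c.α * (p * c.ηz⁻¹ / 2) * ‖s.z - s.wPrev‖ ^ 2
          - 3 * c.α * c.ηz⁻¹ / 8 * ‖s.z - s.zPrev‖ ^ 2
          - 2 * inner ℝ (primalNoise F c.α s.z s.wPrev s.zPrev S) (s.z - diag M zs)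
          + 4 * c.ηz * ‖primalNoise F c.α s.z s.wPrev s.zPrev S‖ ^ 2
          - c.β / 10 * (Lbar ^ 2 / b * ‖zNext F g c S s - s.w‖ ^ 2))
          + c.β / 10 * ‖dualNoise F (zNext F g c S s) s.w S'‖ ^ 2
          + inner ℝ (dualNoise F (zNext F g c S s) s.w S') ℓ := by
      intro S'
      have ht := mul_le_mul_of_nonneg_left
        (lyapunov_step_le hc hF hg hs hM hA S S' true hx) hp0.le
      have hf := mul_le_mul_of_nonneg_left
        (lyapunov_step_le hc hF hg hs hM hA S S' false hx) (show 0 ≤ 1 - p by linarith)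
      rw [← hℓ] at ht hf
      simp only [if_true, Bool.false_eq_true, if_false] at ht hf
      linear_combination ht + hf
    refine (Finset.expect_le_expect fun S' _ => hb S').trans ?_
    rw [Finset.expect_add_distrib, Finset.expect_add_distrib, ← Finset.mul_expect,
      Fintype.expect_const]
    have e1 : 𝔼 S' : Batch M n b, inner ℝ (dualNoise F (zNext F g c S s) s.w S') ℓ = 0 :=
      expect_inner_batchNoise _ _
    have e2 := mul_le_mul_of_nonneg_left
      (expect_norm_dualNoise_sq_le (b := b) hF (zNext F g c S s) s.w) hβ0
    rw [e1]
    linarith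
  refine (Finset.expect_le_expect fun S _ => h1 S).trans ?_
  rw [Finset.expect_add_distrib, Finset.expect_sub_distrib, ← Finset.mul_expect,
    ← Finset.mul_expect, Fintype.expect_const]
  have e1 : 𝔼 S : Batch M n b, inner ℝ (primalNoise F c.α s.z s.wPrev s.zPrev S)
      (s.z - diag M zs) = 0 := expect_inner_batchNoise _ _
  have e2 := mul_le_mul_of_nonneg_left
    (expect_norm_primalNoise_sq_le (b := b) hF c.α s.z s.wPrev s.zPrev)
    (show 0 ≤ 4 * c.ηz by positivity)
  have e3 : 4 * c.ηz * (2 * (Lbar ^ 2 / b)) ≤ c.α * p * c.ηz⁻¹ / 8 := by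
    have : Lbar ^ 2 / b * c.ηz * 64 ≤ c.α * p * c.ηz⁻¹ := by
      rw [← div_eq_mul_inv, le_div_iff₀ hη0, div_mul_eq_mul_div, div_mul_eq_mul_div,
        div_mul_eq_mul_div, div_le_iff₀ hb0]
      linarith [hc.ηz_sq]
    linarith
  have k1 := mul_le_mul_of_nonneg_right e3 (show 0 ≤ ‖s.z - s.wPrev‖ ^ 2
    + c.α ^ 2 * ‖s.z - s.zPrev‖ ^ 2 by positivity)
  have k2 : c.α ^ 2 * p ≤ 1 * 1 := by
    have : c.α ^ 2 ≤ 1 := pow_le_one₀ hα0 hc.α_le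
    gcongr
    linarith
  have k3 := mul_le_mul_of_nonneg_left k2
    (show 0 ≤ c.α * c.ηz⁻¹ * ‖s.z - s.zPrev‖ ^ 2 by positivity)
  have k4 : 0 ≤ c.α * c.ηz⁻¹ * ‖s.z - s.zPrev‖ ^ 2 := by positivity
  have k5 : 0 ≤ c.α * p * c.ηz⁻¹ * ‖s.z - s.wPrev‖ ^ 2 := by positivity
  rw [e1]
  linear_combination e2 + k1 + (1 / 8) * k3 + (1 / 4) * k4 + (3 / 8) * k5

/-- Only the two inner products can be negative. Young's inequality with the weights of the primal
estimate bounds them by the squared increments and 3/16 of ηz⁻¹‖z - z*‖². -/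
theorem le_lyapunov {L Lbar μ χ p : ℝ} (hc : StepsizeBounds L Lbar μ χ p b c)
    (hF : OperatorAssumptions F L Lbar μ) (zs : Vec d) (s : State M d) :
    c.ηz⁻¹ / 2 * ‖s.z - diag M zs‖ ^ 2 ≤ lyapunov F c μ p zs s := by
  have hη0 := hc.ηz_pos
  have hηy0 := hc.ηy_pos
  have hηx0 := hc.ηx_pos
  have hp0 := hc.p_pos
  have hμ0 := hc.μ_pos
  have hL0 := hc.L_pos
  have hτ0 := hc.τ_pos
  have hν0 : 0 < c.ν := by rw [hc.ν_eq]; linarith [hc.μ_pos]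
  have y1 := neg_two_mul_inner_le (s.y - s.yPrev) (s.z - diag M zs) (s := c.ηy⁻¹ / 2)
    (by positivity)
  have y2 := two_mul_inner_le (liftOp F s.z - liftOp F s.zPrev) (s.z - diag M zs)
    (s := 8 * c.ηz) (by positivity)
  have a1 : (c.ηy⁻¹ / 2)⁻¹ ≤ c.ηz⁻¹ / 16 := by
    rw [inv_div, div_inv_eq_mul, le_div_iff₀ (by norm_num), ← one_div, le_div_iff₀ hη0]
    linarith [hc.ηy_ηz]
  have a3 : (8 * c.ηz)⁻¹ = c.ηz⁻¹ / 8 := by rw [mul_inv]; ring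
  have hLη := hc.ηz_L
  have a4 : 8 * c.ηz * L ^ 2 ≤ c.ηz⁻¹ / 8 := by
    rw [le_div_iff₀ (by norm_num), ← one_div, le_div_iff₀ hη0]
    have : 8 * L * c.ηz * (8 * L * c.ηz) ≤ 1 * 1 := by gcongr
    linarith
  have n1 : ‖liftOp F s.z - liftOp F s.zPrev‖ ^ 2 ≤ L ^ 2 * ‖s.z - s.zPrev‖ ^ 2 := by
    have := hF.lift_lipschitz hL0.le s.z s.zPrev
    rw [← mul_pow]; gcongr
  have t1 := mul_le_mul_of_nonneg_left n1 (show 0 ≤ 8 * c.ηz by positivity)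
  have t2 := mul_le_mul_of_nonneg_right a4 (sq_nonneg ‖s.z - s.zPrev‖)
  have t3 := mul_le_mul_of_nonneg_right a1 (sq_nonneg ‖s.z - diag M zs‖)
  have p1 : 0 ≤ μ * ‖s.z - diag M zs‖ ^ 2 := by positivity
  have p2 : 0 ≤ (c.ηz⁻¹ + c.ν / p) * ‖s.w - diag M zs‖ ^ 2 := by positivity
  have p3 : 0 ≤ p * c.ηz⁻¹ / 2 * ‖s.z - s.wPrev‖ ^ 2 := by positivity
  have p4 : 0 ≤ c.ηy⁻¹ * ‖s.y - yOpt F c zs‖ ^ 2 := by positivity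
  have p5 : 0 ≤ c.ηx⁻¹ * ‖s.x - projLin M d s.m - xOpt F zs‖ ^ 2 := by positivity
  have p6 : 0 ≤ 2 * c.ηx⁻¹ * ‖projLin M d s.m‖ ^ 2 := by positivity
  have p7 : 0 ≤ (c.ν * c.τ)⁻¹ * ‖s.yf + s.xf - (yOpt F c zs + xOpt F zs)‖ ^ 2 := by positivity
  have p8 : 0 ≤ c.ηz⁻¹ * ‖s.z - s.zPrev‖ ^ 2 := by positivity
  have p9 : 0 ≤ c.ηz⁻¹ * ‖s.z - diag M zs‖ ^ 2 := by positivity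
  rw [a3] at y2
  rw [lyapunov]
  linear_combination y1 + y2 + t1 + t2 + t3 + p1 + p2 + p3 + p4 + p5 + p6 + p7 + (3 / 8) * p8
    + (5 / 16) * p9

theorem lyapunov_initState_le {L Lbar μ χ p : ℝ} (hc : StepsizeBounds L Lbar μ χ p b c)
    (zs : Vec d) (z0 y0 x0 : Stack M d) :
    4 * c.ηz * lyapunov F c μ p zs (initState z0 y0 x0) ≤ startGap F c μ p z0 y0 x0 zs := by
  have hη0 := hc.ηz_pos
  have hp0 := hc.p_pos
  have hμ0 := hc.μ_pos
  have hηi : c.ηz⁻¹ * c.ηz = 1 := inv_mul_cancel₀ hη0.ne'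
  have e : startGap F c μ p z0 y0 x0 zs = 4 * c.ηz * (1 / c.ηy * ‖y0 - yOpt F c zs‖ ^ 2
    + 1 / c.ηx * ‖x0 - xOpt F zs‖ ^ 2
    + 1 / (c.ν * c.τ) * ‖y0 + x0 - yOpt F c zs - xOpt F zs‖ ^ 2
    + (1 + 3 * μ * c.ηz / 2) * (1 / c.ηz) * ‖z0 - diag M zs‖ ^ 2
    + (c.ω + c.ηz * c.ν) / (p * c.ηz) * ‖z0 - diag M zs‖ ^ 2) := rfl
  rw [e]
  refine mul_le_mul_of_nonneg_left ?_ (by positivity)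
  have e1 : (c.ω + c.ηz * c.ν) / (p * c.ηz) = c.ηz⁻¹ + c.ν / p := by
    rw [hc.ω_eq]; field_simp
  have e2 : (1 + 3 * μ * c.ηz / 2) * (1 / c.ηz) = c.ηz⁻¹ + 3 * μ / 2 := by field_simp
  rw [e1, e2]
  simp only [lyapunov, initState, sub_self, norm_zero, inner_zero_left, map_zero, sub_zero,
    one_div, sub_add_eq_sub_sub]
  linear_combination (1 / 2) * mul_nonneg hμ0.le (sq_nonneg ‖z0 - diag M zs‖)

theorem run_congr (W : ℕ → Matrix (Fin M) (Fin M) ℝ) (T : ℕ) (z0 y0 x0 : Stack M d)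
    {ξ ξ' : ℕ → Draw M n b} {k : ℕ} (h : ∀ i < k, ξ i = ξ' i) :
    run F g c W T z0 y0 x0 ξ k = run F g c W T z0 y0 x0 ξ' k := by
  induction k with
  | zero => rfl
  | succ k ih => rw [run, run, ih fun i hi => h i (by omega), h k (by omega)]

theorem run_zeroSum (W : ℕ → Matrix (Fin M) (Fin M) ℝ) (T : ℕ) {z0 y0 x0 : Stack M d}
    (hW : ∀ t j, ∑ i, multiGossip W T t i j = 0) (hx0 : ZeroSum x0) (ξ : ℕ → Draw M n b) (k : ℕ) :
    ZeroSum (run F g c W T z0 y0 x0 ξ k).x ∧ ZeroSum (run F g c W T z0 y0 x0 ξ k).xf := by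
  induction k with
  | zero => exact ⟨hx0, hx0⟩
  | succ k ih => exact ZeroSum.step (hW _) _ ih.1 ih.2

/-- The history of the first `k` draws. -/
def history {Ω : Type*} (ξ : ℕ → Ω → Draw M n b) (k : ℕ) (ω : Ω) (i : Finset.range k) : Draw M n b := ξ i ω

/-- The state is a function of finitely many finitely valued draws. This makes every functional of
it integrable and exposes its independence from the next draw. -/
theorem exists_run_eq [NeZero n] {Ω : Type*} (W : ℕ → Matrix (Fin M) (Fin M) ℝ) (T : ℕ)
    (z0 y0 x0 : Stack M d) (ξ : ℕ → Ω → Draw M n b) (k : ℕ) :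
    ∃ R : ((i : Finset.range k) → Draw M n b) → State M d,
      ∀ ω, run F g c W T z0 y0 x0 (fun i => ξ i ω) k = R (history ξ k ω) := by
  -- Draws from iteration k on do not influence the state, so any filler will do for them.
  refine ⟨fun h => run F g c W T z0 y0 x0
    (fun i => if hi : i ∈ Finset.range k then h ⟨i, hi⟩ else (0, 0, true)) k, fun ω => ?_⟩
  refine run_congr W T z0 y0 x0 fun i hi => ?_
  simp [hi, history]

theorem IsSampling.measurable_history {Ω : Type*} [MeasurableSpace Ω] {P : Measure Ω} {p : ℝ}
    {ξ : ℕ → Ω → Draw M n b} (hξ : IsSampling P p ξ) (k : ℕ) :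
    Measurable (history ξ k) :=
  measurable_pi_lambda _ fun i => hξ.measurable i

theorem IsSampling.sum_law {Ω : Type*} [MeasurableSpace Ω] {P : Measure Ω} {p : ℝ}
    {ξ : ℕ → Ω → Draw M n b} [NeZero n] (hξ : IsSampling P p ξ) (hp0 : 0 ≤ p) (hp1 : p ≤ 1) (k : ℕ)
    (f : Draw M n b → ℝ) : ∑ y, P.real (ξ k ⁻¹' {y}) * f y = drawMean p f := by
  have hcard : (Fintype.card (Batch M n b) : ℝ) = (n : ℝ) ^ (M * b) := by
    simp [Batch, pow_mul, mul_comm M b]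
  have hw : ∀ y : Draw M n b, P.real (ξ k ⁻¹' {y})
      = ((n : ℝ)⁻¹) ^ (M * b) * ((n : ℝ)⁻¹) ^ (M * b) * (if y.2.2 then p else 1 - p) := by
    intro y
    rw [measureReal_def, hξ.law, ENNReal.toReal_ofReal]
    have : 0 ≤ if y.2.2 then p else 1 - p := by split_ifs <;> linarith
    positivity
  simp only [hw, drawMean, Fintype.expect_eq_sum_div_card, hcard, Fintype.sum_prod_type,
    Fintype.sum_bool, if_true, Bool.false_eq_true, if_false, Finset.sum_mul, div_eq_mul_inv,
    inv_pow]
  exact Finset.sum_congr rfl fun S _ => Finset.sum_congr rfl fun S' _ => by ring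

/-! ### From conditional means to expectations over the whole run. -/

section Measure

variable {Ω : Type*} [MeasurableSpace Ω] {P : Measure Ω} [IsProbabilityMeasure P] {p : ℝ}
  {ξ : ℕ → Ω → Draw M n b}

/-- Integrating out a finitely valued variable that is independent of another one. -/
theorem integral_eq_integral_sum {α β : Type*} [Finite α] [Fintype β] [MeasurableSpace α]
    [MeasurableSpace β] [MeasurableSingletonClass α] [MeasurableSingletonClass β] {X : Ω → α}
    {Y : Ω → β} (hX : Measurable X) (hY : Measurable Y) (hXY : IndepFun X Y P) (f : α → β → ℝ) :
    ∫ ω, f (X ω) (Y ω) ∂P = ∫ ω, ∑ y, P.real (Y ⁻¹' {y}) * f (X ω) y ∂P := by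
  have : IsProbabilityMeasure (P.map X) := Measure.isProbabilityMeasure_map hX.aemeasurable
  have : IsProbabilityMeasure (P.map Y) := Measure.isProbabilityMeasure_map hY.aemeasurable
  have h1 : ∫ ω, f (X ω) (Y ω) ∂P = ∫ q, f q.1 q.2 ∂(P.map fun ω => (X ω, Y ω)) := by
    rw [integral_map (hX.prodMk hY).aemeasurable]
    exact (measurable_of_finite _).aestronglyMeasurable
  rw [h1, (indepFun_iff_map_prod_eq_prod_map_map hX.aemeasurable hY.aemeasurable).1 hXY,
    integral_prod _ Integrable.of_finite, integral_map hX.aemeasurable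
      (measurable_of_finite _).aestronglyMeasurable]
  congr 1
  ext ω
  rw [integral_fintype Integrable.of_finite]
  simp only [smul_eq_mul]
  exact Finset.sum_congr rfl fun y _ => by
    rw [map_measureReal_apply hY (measurableSet_singleton y)]

theorem IsSampling.integrable [NeZero n] (hξ : IsSampling P p ξ)
    (W : ℕ → Matrix (Fin M) (Fin M) ℝ) (T : ℕ)
    (z0 y0 x0 : Stack M d) (k : ℕ) (φ : State M d → ℝ) :
    Integrable (fun ω => φ (run F g c W T z0 y0 x0 (fun i => ξ i ω) k)) P := by
  obtain ⟨R, hR⟩ := exists_run_eq (F := F) (g := g) (c := c) W T z0 y0 x0 ξ k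
  simp only [hR]
  have : Integrable (fun h => φ (R h)) (P.map (history ξ k)) := Integrable.of_finite
  exact this.comp_measurable (hξ.measurable_history k)

/-- The tower property: the draw of iteration k is independent of the history that determines the
state, so it can be integrated out first. -/
theorem IsSampling.integral_step [NeZero n] (hξ : IsSampling P p ξ) (hp0 : 0 ≤ p) (hp1 : p ≤ 1)
    (W : ℕ → Matrix (Fin M) (Fin M) ℝ) (T : ℕ)
    (z0 y0 x0 : Stack M d) (k : ℕ) (φ : State M d → ℝ) :
    ∫ ω, φ (run F g c W T z0 y0 x0 (fun i => ξ i ω) (k + 1)) ∂P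
      = ∫ ω, drawMean p (fun D : Draw M n b => φ (step F g c (multiGossip W T (T * k)) D
          (run F g c W T z0 y0 x0 (fun i => ξ i ω) k))) ∂P := by
  obtain ⟨R, hR⟩ := exists_run_eq (F := F) (g := g) (c := c) W T z0 y0 x0 ξ k
  simp only [run, hR, ← hξ.sum_law hp0 hp1 k]
  have hind : IndepFun (history ξ k) (ξ k) P := by
    have h := hξ.indep.indepFun_finset (Finset.range k) {k} (by simp) hξ.measurable
    exact h.comp (φ := id) (ψ := fun f : (i : ({k} : Finset ℕ)) → Draw M n b =>
      f ⟨k, Finset.mem_singleton_self k⟩) measurable_id (measurable_pi_apply _)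
  exact integral_eq_integral_sum (hξ.measurable_history k) (hξ.measurable k) hind
    (fun h D => φ (step F g c (multiGossip W T (T * k)) D (R h)))

/-- Linear convergence of the Lyapunov function in expectation. -/
theorem integral_lyapunov_le [NeZero n] [NeZero b] {L Lbar μ χ : ℝ} {zs : Vec d} {B : ℕ}
    {G : ℕ → Digraph (Fin M)} {W : ℕ → Matrix (Fin M) (Fin M) ℝ} {z0 y0 x0 : Stack M d}
    (hc : StepsizeBounds L Lbar μ χ p b c) (hF : OperatorAssumptions F L Lbar μ)
    (hg : ProperClosedConvex g) (hs : IsSolution F g zs) (hW : GossipNetwork B G W)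
    {T : ℕ} (hT : ∀ t, Contracts d (multiGossip W T t) χ) (hx0 : ZeroSum x0)
    (hξ : IsSampling P p ξ) (k : ℕ) :
    ∫ ω, lyapunov F c μ p zs (run F g c W T z0 y0 x0 (fun i => ξ i ω) k) ∂P
      ≤ c.α ^ k * lyapunov F c μ p zs (initState z0 y0 x0) := by
  induction k with
  | zero => simp [run]
  | succ k ih =>
    rw [hξ.integral_step hc.p_pos.le (hc.p_le.trans (by norm_num))]
    have hstep : ∀ ω, drawMean p (fun D : Draw M n b => lyapunov F c μ p zs
        (step F g c (multiGossip W T (T * k)) D (run F g c W T z0 y0 x0 (fun i => ξ i ω) k)))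
        ≤ c.α * lyapunov F c μ p zs (run F g c W T z0 y0 x0 (fun i => ξ i ω) k) := fun ω =>
      drawMean_lyapunov_le hc hF hg hs hW.pos (hW.isGossip (hT _))
        (run_zeroSum W T (hW.multiGossip_col T) hx0 _ k).1
    calc _ ≤ ∫ ω, c.α * lyapunov F c μ p zs (run F g c W T z0 y0 x0 (fun i => ξ i ω) k) ∂P :=
          integral_mono (hξ.integrable W T z0 y0 x0 k fun s => drawMean p fun D : Draw M n b =>
              lyapunov F c μ p zs (step F g c (multiGossip W T (T * k)) D s))
            ((hξ.integrable W T z0 y0 x0 k _).const_mul _) hstep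
      _ = c.α * ∫ ω, lyapunov F c μ p zs (run F g c W T z0 y0 x0 (fun i => ξ i ω) k) ∂P :=
          integral_const_mul _ _
      _ ≤ c.α * (c.α ^ k * lyapunov F c μ p zs (initState z0 y0 x0)) :=
          mul_le_mul_of_nonneg_left ih hc.α_nonneg
      _ = c.α ^ (k + 1) * lyapunov F c μ p zs (initState z0 y0 x0) := by ring

theorem integral_norm_sq_le [NeZero n] [NeZero b] {L Lbar μ χ : ℝ} {zs : Vec d} {B : ℕ}
    {G : ℕ → Digraph (Fin M)} {W : ℕ → Matrix (Fin M) (Fin M) ℝ} {z0 y0 x0 : Stack M d}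
    (hc : StepsizeBounds L Lbar μ χ p b c) (hF : OperatorAssumptions F L Lbar μ)
    (hg : ProperClosedConvex g) (hs : IsSolution F g zs) (hW : GossipNetwork B G W)
    {T : ℕ} (hT : ∀ t, Contracts d (multiGossip W T t) χ) (hx0 : ZeroSum x0)
    (hξ : IsSampling P p ξ) (k : ℕ) :
    ∫ ω, ‖(run F g c W T z0 y0 x0 (fun i => ξ i ω) k).z - diag M zs‖ ^ 2 ∂P
      ≤ c.α ^ k * startGap F c μ p z0 y0 x0 zs := by
  have hη0 := hc.ηz_pos
  have h0 : 0 ≤ lyapunov F c μ p zs (initState z0 y0 x0) :=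
    le_trans (by positivity) (le_lyapunov hc hF zs _)
  have hα := pow_nonneg hc.α_nonneg k
  calc _ ≤ ∫ ω, 2 * c.ηz * lyapunov F c μ p zs (run F g c W T z0 y0 x0 (fun i => ξ i ω) k) ∂P := by
        refine integral_mono
          (hξ.integrable W T z0 y0 x0 k fun s => ‖s.z - diag M zs‖ ^ 2)
          ((hξ.integrable W T z0 y0 x0 k _).const_mul _) fun ω => ?_
        have h := mul_le_mul_of_nonneg_left (le_lyapunov hc hF zs
          (run F g c W T z0 y0 x0 (fun i => ξ i ω) k)) (show 0 ≤ 2 * c.ηz by positivity)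
        refine le_trans (le_of_eq ?_) h
        field_simp
    _ = 2 * c.ηz * ∫ ω, lyapunov F c μ p zs (run F g c W T z0 y0 x0 (fun i => ξ i ω) k) ∂P :=
        integral_const_mul _ _
    _ ≤ 2 * c.ηz * (c.α ^ k * lyapunov F c μ p zs (initState z0 y0 x0)) := by
        have := integral_lyapunov_le (z0 := z0) (y0 := y0) hc hF hg hs hW hT hx0 hξ k
        gcongr
    _ ≤ c.α ^ k * (4 * c.ηz * lyapunov F c μ p zs (initState z0 y0 x0)) := by
        have : 0 ≤ c.α ^ k * (c.ηz * lyapunov F c μ p zs (initState z0 y0 x0)) := by positivity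
        linarith
    _ ≤ _ := by
        have := lyapunov_initState_le (F := F) hc zs z0 y0 x0
        gcongr

end Measure

end Expectation

end DecVI

namespace DecVI

variable {M d n b : ℕ}

/-! ### Solvability of the tuning and the resulting contraction factor. -/

section Tuning

/-- The implicit tuning relations have a solution. -/
theorem exists_tuned {L Lbar μ p χ : ℝ} {b : ℕ} (hL : 0 < L) (hLbar : 0 < Lbar) (hμ : 0 < μ)
    (hb : 1 ≤ b) (hp : 0 < p) (hχ : 1 ≤ χ) : ∃ c : Params, Tuned L Lbar μ χ p b c := by
  have hb0 : (0 : ℝ) < b := by exact_mod_cast hb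
  have hχ0 : 0 < χ := by linarith
  have hbp : 0 < √(b * p) := Real.sqrt_pos.2 (by positivity)
  obtain ⟨τ, hτ⟩ : ∃ τ, τ = min (μ / (32 * L * χ)) (μ * √(b * p) / (32 * Lbar)) := ⟨_, rfl⟩
  obtain ⟨ν, hν⟩ : ∃ ν, ν = μ / 4 := ⟨_, rfl⟩
  have hτ0 : 0 < τ := by rw [hτ]; exact lt_min (by positivity) (by positivity)
  have hν0 : 0 < ν := by rw [hν]; positivity
  -- Once ηz = t is prescribed, every other parameter is explicit; the relation for ηz itself
  -- becomes the fixed-point equation h t = t.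
  let γ : ℝ → ℝ := fun t => min (μ / (16 * L ^ 2)) (b * p / (24 * Lbar ^ 2 * t))
  let ηy : ℝ → ℝ := fun t => min (1 / (4 * γ t)) (ν / (8 * τ))
  let ηx : ℝ → ℝ := fun t => min (1 / (900 * χ * γ t)) (ν / (36 * τ * χ ^ 2))
  let α : ℝ → ℝ := fun t => max (1 - p * t * ν / (p + t * ν)) (max (1 - ηy t * γ t)
    (max (1 - ηx t * γ t) (max (1 - μ * t / 8) (max (1 - τ) (1 - 1 / (4 * χ))))))
  let h : ℝ → ℝ := fun t => min (1 / (8 * L * χ))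
    (min (1 / (32 * ηy t)) (√(α t * b * p) / (8 * Lbar)))
  have hγ0 : ∀ t, 0 < t → 0 < γ t := fun t ht => lt_min (by positivity) (by positivity)
  have hηy0 : ∀ t, 0 < t → 0 < ηy t := fun t ht =>
    lt_min (by have := hγ0 t ht; positivity) (by positivity)
  have hηx0 : ∀ t, 0 < t → 0 < ηx t := fun t ht =>
    lt_min (by have := hγ0 t ht; positivity) (by positivity)
  have hα : ∀ t, 1 / 2 ≤ α t := fun t => by
    have h1 : 1 / (4 * χ) ≤ 1 / 2 := by
      apply one_div_le_one_div_of_le <;> linarith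
    have h2 : 1 - 1 / (4 * χ) ≤ α t := by simp [α]
    linarith
  -- This lower bound for h uses only ηy ≤ ν/(8τ) and α ≥ 1/2. It gives t0 ≤ h t0, while h ≤ 1/(8Lχ)
  -- always, so continuity yields a fixed point in between.
  obtain ⟨t0, ht0⟩ : ∃ t0, t0 = min (1 / (8 * L * χ))
    (min (1 / (32 * (ν / (8 * τ)))) (√(1 / 2 * b * p) / (8 * Lbar))) := ⟨_, rfl⟩
  have ht0' : 0 < t0 := by
    rw [ht0]
    have : 0 < √(1 / 2 * b * p) := Real.sqrt_pos.2 (by positivity)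
    refine lt_min (by positivity) (lt_min (by positivity) (by positivity))
  have ht1 : t0 ≤ 1 / (8 * L * χ) := by rw [ht0]; exact min_le_left _ _
  have hlow : t0 ≤ h t0 := by
    have h1 := hηy0 t0 ht0'
    have h2 : ηy t0 ≤ ν / (8 * τ) := min_le_right _ _
    have h3 := hα t0
    conv_lhs => rw [ht0]
    exact min_le_min le_rfl (min_le_min (by gcongr) (by gcongr))
  have hcont : ContinuousOn h (Set.Icc t0 (1 / (8 * L * χ))) := by
    have hpos : ∀ t ∈ Set.Icc t0 (1 / (8 * L * χ)), 0 < t := fun t ht => ht0'.trans_le ht.1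
    have cγ : ContinuousOn γ (Set.Icc t0 (1 / (8 * L * χ))) := by
      refine continuousOn_const.inf (ContinuousOn.div (by fun_prop) (by fun_prop) fun t ht => ?_)
      have := hpos t ht
      positivity
    have cηy : ContinuousOn ηy (Set.Icc t0 (1 / (8 * L * χ))) := by
      refine ContinuousOn.inf (ContinuousOn.div (by fun_prop) (by fun_prop) fun t ht => ?_)
        continuousOn_const
      have := hγ0 t (hpos t ht)
      positivity
    have cηx : ContinuousOn ηx (Set.Icc t0 (1 / (8 * L * χ))) := by
      refine ContinuousOn.inf (ContinuousOn.div (by fun_prop) (by fun_prop) fun t ht => ?_)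
        continuousOn_const
      have := hγ0 t (hpos t ht)
      positivity
    have cα : ContinuousOn α (Set.Icc t0 (1 / (8 * L * χ))) := by
      refine ContinuousOn.sup (continuousOn_const.sub
        (ContinuousOn.div (by fun_prop) (by fun_prop) fun t ht => ?_))
        (ContinuousOn.sup (by fun_prop) (ContinuousOn.sup (by fun_prop) (ContinuousOn.sup
          (by fun_prop) continuousOn_const)))
      have := hpos t ht
      positivity
    refine continuousOn_const.inf (ContinuousOn.inf
      (ContinuousOn.div (by fun_prop) (by fun_prop) fun t ht => ?_) (by fun_prop))
    have := hηy0 t (hpos t ht)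
    positivity
  obtain ⟨t, ht, hfix⟩ := exists_mem_Icc_isFixedPt hcont ht1 hlow (min_le_left _ _)
  have htp : 0 < t := ht0'.trans_le ht.1
  exact ⟨{ ηz := t, ηy := ηy t, ηx := ηx t, θ := 1 / 2, α := α t, γ := γ t, ω := p, τ := τ,
           ν := ν, β := 5 * γ t },
    { ηz_pos := htp, ηy_pos := hηy0 t htp, ηx_pos := hηx0 t htp, γ_pos := hγ0 t htp,
      ω_eq := rfl, θ_eq := rfl, β_eq := rfl, ν_eq := hν, τ_eq := hτ, ηz_eq := hfix.symm,
      ηy_eq := rfl, ηx_eq := rfl, γ_eq := rfl, α_eq := rfl }⟩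

theorem Tuned.stepsizeBounds {L Lbar μ p χ : ℝ} {b : ℕ} {c : Params}
    (h : Tuned L Lbar μ χ p b c) (hL : 0 < L) (hLbar : 0 < Lbar) (hμ : 0 < μ) (hμL : μ ≤ L)
    (hb : 1 ≤ b) (hp : 0 < p) (hp1 : p ≤ 1 / 16) (hχ : 1 ≤ χ) :
    StepsizeBounds L Lbar μ χ p b c := by
  have hb0 : (0 : ℝ) < b := by exact_mod_cast hb
  have hχ0 : 0 < χ := by linarith
  have hbp : 0 < √(b * p) := Real.sqrt_pos.2 (by positivity)
  have hηz := h.ηz_pos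
  have hηy := h.ηy_pos
  have hηx := h.ηx_pos
  have hγ := h.γ_pos
  have hν0 : 0 < c.ν := by rw [h.ν_eq]; positivity
  have hτ0 : 0 < c.τ := by rw [h.τ_eq]; exact lt_min (by positivity) (by positivity)
  have hα := h.α_eq.ge
  simp only [max_le_iff] at hα
  obtain ⟨a1, a2, a3, a4, a5, a6⟩ := hα
  have hα0 : 0 ≤ c.α := by
    have : 1 / (4 * χ) ≤ 1 / 4 := by
      apply one_div_le_one_div_of_le <;> linarith
    linarith
  have z1 := h.ηz_eq.le
  simp only [le_min_iff] at z1
  obtain ⟨z1, z2, z3⟩ := z1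
  have y1 := h.ηy_eq.le
  simp only [le_min_iff] at y1
  have x1 := h.ηx_eq.le
  simp only [le_min_iff] at x1
  have g1 := h.γ_eq.le
  simp only [le_min_iff] at g1
  have t1 := h.τ_eq.le
  simp only [le_min_iff] at t1
  rw [h.ω_eq] at z3 g1
  exact
  { ηz_pos := hηz, ηy_pos := hηy, ηx_pos := hηx, γ_pos := hγ, τ_pos := hτ0, μ_pos := hμ,
    L_pos := hL, p_pos := hp, b_pos := hb, one_le_χ := hχ, μ_le := hμL, p_le := hp1,
    ω_eq := h.ω_eq, θ_eq := h.θ_eq, β_eq := h.β_eq, ν_eq := h.ν_eq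
    τ_le := by
      refine t1.1.trans ((div_le_one (by positivity)).2 ?_)
      nlinarith [mul_le_mul_of_nonneg_left hχ hL.le]
    ηz_L := by
      rw [le_div_iff₀ (by positivity)] at z1
      nlinarith [mul_le_mul_of_nonneg_left hχ (mul_pos hηz hL).le]
    ηy_ηz := by
      rw [le_div_iff₀ (by positivity)] at z2
      linarith
    ηz_sq := by
      rw [le_div_iff₀ (by positivity)] at z3
      have := pow_le_pow_left₀ (by positivity) z3 2
      rw [Real.sq_sqrt (by positivity)] at this
      linarith
    ηy_γ := by
      have := y1.1
      rw [le_div_iff₀ (by positivity)] at this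
      linarith
    ηy_τ := by
      have := y1.2
      rw [le_div_iff₀ (by positivity)] at this
      linarith
    ηx_γ := by
      have := x1.1
      rw [le_div_iff₀ (by positivity)] at this
      linarith
    ηx_τ := by
      have := x1.2
      rw [le_div_iff₀ (by positivity)] at this
      linarith
    γ_L := by
      have := g1.1
      rw [le_div_iff₀ (by positivity)] at this
      linarith
    γ_ηz := by
      have := g1.2
      rw [le_div_iff₀ (by positivity)] at this
      linarith
    α_le := by
      rw [h.α_eq]
      have q1 : 0 ≤ p * c.ηz * c.ν / (p + c.ηz * c.ν) := by positivity
      have q2 : 0 ≤ 1 / (4 * χ) := by positivity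
      have q3 : 0 ≤ c.ηy * c.γ := by positivity
      have q4 : 0 ≤ c.ηx * c.γ := by positivity
      have q5 : 0 ≤ μ * c.ηz / 8 := by positivity
      simp only [max_le_iff]
      refine ⟨?_, ?_, ?_, ?_, ?_, ?_⟩ <;> linarith
    le_α_w := a1, le_α_y := a2, le_α_x := a3, le_α_z := a4, le_α_τ := a5, le_α_χ := a6 }

theorem one_le_iterBound {L Lbar μ p χ : ℝ} {b : ℕ} (hL : 0 < L) (hLbar : 0 < Lbar) (hμ : 0 < μ)
    (hp : 0 < p) (hχ : 1 ≤ χ) : 1 ≤ iterBound L Lbar μ χ p b := by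
  have h1 : 1 ≤ χ ^ 2 := one_le_pow₀ hχ
  have h2 : 0 < 1 / p := by positivity
  have h3 : 0 ≤ χ * (L / μ) := by positivity
  have h4 : 0 ≤ 1 / √(b * p) * (Lbar / μ) := by positivity
  unfold iterBound
  linarith

/-- The contraction factor `α` yields the iteration complexity `iterBound`. -/
theorem Tuned.one_le_mul_iterBound {L Lbar μ p χ : ℝ} {b : ℕ} {c : Params}
    (h : Tuned L Lbar μ χ p b c) (hL : 0 < L) (hLbar : 0 < Lbar) (hμ : 0 < μ) (hμL : μ ≤ L)
    (hb : 1 ≤ b) (hp : 0 < p) (hp1 : p ≤ 1 / 16) (hχ : 1 ≤ χ) :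
    1 ≤ 900 * (1 - c.α) * iterBound L Lbar μ χ p b := by
  have hc := h.stepsizeBounds hL hLbar hμ hμL hb hp hp1 hχ
  have hb0 : (0 : ℝ) < b := by exact_mod_cast hb
  have hχ0 : 0 < χ := by linarith
  have hηz := h.ηz_pos
  have hηy := h.ηy_pos
  have hγ := h.γ_pos
  have hτ0 := hc.τ_pos
  have hν0 : 0 < c.ν := by rw [h.ν_eq]; positivity
  obtain ⟨r, hr⟩ : ∃ r, r = √(b * p) := ⟨_, rfl⟩
  have hr0 : 0 < r := by rw [hr]; exact Real.sqrt_pos.2 (by positivity)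
  have hr2 : r ^ 2 = b * p := by rw [hr]; exact Real.sq_sqrt (by positivity)
  have hI1 := one_le_iterBound (b := b) hL hLbar hμ hp hχ
  have hχ2 : 1 ≤ χ ^ 2 := one_le_pow₀ hχ
  have b1 : 0 < 1 / p := by positivity
  have b2 : 0 ≤ χ * (L / μ) := by positivity
  have b3 : 0 ≤ 1 / r * (Lbar / μ) := by positivity
  obtain ⟨I, hI⟩ : ∃ I, I = iterBound L Lbar μ χ p b := ⟨_, rfl⟩
  have hIe : I = χ ^ 2 + 1 / p + χ * (L / μ) + 1 / r * (Lbar / μ) := by rw [hI, hr]; rfl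
  rw [← hI] at hI1 ⊢
  have hI0 : 0 < I := by linarith
  have i1 : χ ^ 2 ≤ I := by linarith
  have i2 : 1 / p ≤ I := by linarith
  have i3 : χ * L ≤ μ * I := by
    have : χ * (L / μ) ≤ I := by linarith
    rw [← mul_div_assoc, div_le_iff₀ hμ] at this
    linarith
  have i4 : Lbar ≤ μ * r * I := by
    have : 1 / r * (Lbar / μ) ≤ I := by linarith
    rw [div_mul_div_comm, one_mul, div_le_iff₀ (by positivity)] at this
    linarith
  have i5 : χ ≤ I := by nlinarith
  -- the parameters in terms of `I`
  have hτI : 1 ≤ 32 * c.τ * I := by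
    rw [h.τ_eq, ← hr]
    rcases min_choice (μ / (32 * L * χ)) (μ * r / (32 * Lbar)) with e | e <;> rw [e]
    · rw [mul_div_assoc', div_mul_eq_mul_div, le_div_iff₀ (by positivity)]
      linarith
    · rw [mul_div_assoc', div_mul_eq_mul_div, le_div_iff₀ (by positivity)]
      linarith
  have hzI : 1 ≤ 32 * (μ * c.ηz) * I := by
    have hsq : r / 2 ≤ √(c.α * b * c.ω) := by
      refine Real.le_sqrt_of_sq_le ?_
      have h34 : 1 / 4 ≤ c.α := by
        have : 1 / (4 * χ) ≤ 1 / 4 := by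
          apply one_div_le_one_div_of_le <;> linarith
        linarith [hc.le_α_χ]
      rw [div_pow, hr2, h.ω_eq]
      have : 0 < b * p := by positivity
      nlinarith
    rw [h.ηz_eq]
    rcases min_choice (1 / (8 * L * χ)) (min (1 / (32 * c.ηy)) (√(c.α * b * c.ω) / (8 * Lbar)))
      with e | e <;> rw [e]
    · rw [mul_one_div, mul_div_assoc', div_mul_eq_mul_div, le_div_iff₀ (by positivity)]
      nlinarith [mul_pos hL hχ0]
    rcases min_choice (1 / (32 * c.ηy)) (√(c.α * b * c.ω) / (8 * Lbar)) with e | e <;> rw [e]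
    · rw [mul_one_div, mul_div_assoc', div_mul_eq_mul_div, le_div_iff₀ (by positivity)]
      have h1 := hc.ηy_τ
      rw [h.ν_eq] at h1
      have h2 := mul_le_mul_of_nonneg_left hτI hηy.le
      have h3 := mul_le_mul_of_nonneg_right h1 hI0.le
      linarith
    · rw [mul_div_assoc', mul_div_assoc', div_mul_eq_mul_div, le_div_iff₀ (by positivity)]
      have := mul_le_mul_of_nonneg_left hsq (show 0 ≤ 32 * μ * I by positivity)
      linarith
  -- Both branches of γ are compared with τ, since ηy and ηx may be limited by τ and then ηy γ and
  -- ηx γ are governed by γ/τ.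
  have hQ : 2 * (μ * χ) * c.τ ≤ L * (μ * c.γ) ∨ 10 * c.τ ≤ μ * c.γ := by
    rcases min_choice (μ / (16 * L ^ 2)) (b * c.ω / (24 * Lbar ^ 2 * c.ηz)) with e | e
    · left
      have e1 : c.γ = μ / (16 * L ^ 2) := by rw [h.γ_eq, e]
      have e2 : c.τ ≤ μ / (32 * L * χ) := by rw [h.τ_eq]; exact min_le_left _ _
      rw [e1]
      calc 2 * (μ * χ) * c.τ ≤ 2 * (μ * χ) * (μ / (32 * L * χ)) := by gcongr
        _ = L * (μ * (μ / (16 * L ^ 2))) := by field_simp; ring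
    · right
      have e1 : c.γ = b * p / (24 * Lbar ^ 2 * c.ηz) := by rw [h.γ_eq, e, h.ω_eq]
      have e2 : c.τ * (32 * Lbar) ≤ μ * r := by
        rw [← le_div_iff₀ (by positivity), h.τ_eq, hr]; exact min_le_right _ _
      have e3 : 8 * Lbar * c.ηz ≤ r := by
        have h1 := hc.ηz_sq
        have h2 : c.α * b * p ≤ r ^ 2 := by
          rw [hr2, mul_assoc]
          exact mul_le_of_le_one_left (by positivity) hc.α_le
        refine le_of_sq_le_sq ?_ hr0.le
        linarith
      rw [e1, mul_div_assoc', le_div_iff₀ (by positivity), ← hr2]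
      have := mul_le_mul e2 e3 (by positivity) (by positivity)
      have hpos : 0 ≤ c.τ * Lbar ^ 2 * c.ηz := by positivity
      linarith
  -- the six terms of `α`
  have w1 : 1 ≤ 900 * (p * c.ηz * c.ν / (p + c.ηz * c.ν)) * I := by
    rw [mul_div_assoc', div_mul_eq_mul_div, le_div_iff₀ (by positivity), h.ν_eq]
    have h1 := mul_le_mul_of_nonneg_left hzI hp.le
    have h2 : 1 ≤ p * I := by
      rw [div_le_iff₀ hp] at i2; linarith
    have h3 := mul_le_mul_of_nonneg_left h2 (show 0 ≤ c.ηz * μ by positivity)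
    have h4 : 0 ≤ p * c.ηz * μ * I := by positivity
    linarith
  have w2 : 1 ≤ 900 * (c.ηy * c.γ) * I := by
    rw [h.ηy_eq]
    rcases min_choice (1 / (4 * c.γ)) (c.ν / (8 * c.τ)) with e | e <;> rw [e]
    · have : 1 / (4 * c.γ) * c.γ = 1 / 4 := by field_simp
      rw [this]; linarith
    · rw [div_mul_eq_mul_div, mul_div_assoc', div_mul_eq_mul_div, le_div_iff₀ (by positivity),
        h.ν_eq]
      rcases hQ with hQ | hQ
      · have h1 := mul_le_mul_of_nonneg_right hQ hI0.le
        have h2 := mul_le_mul_of_nonneg_left i3 (show 0 ≤ 2 * χ * c.τ by positivity)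
        have h3 : L * (2 * χ ^ 2 * c.τ) ≤ L * (μ * c.γ * I) := by linarith
        have h4 := le_of_mul_le_mul_left h3 hL
        have h5 := mul_le_mul_of_nonneg_right hχ2 hτ0.le
        linarith
      · have h1 := mul_le_mul_of_nonneg_right hQ hI0.le
        have h2 := mul_le_mul_of_nonneg_left hI1 hτ0.le
        linarith
  -- The constant 900 comes from here: in the first branch ηx γ = 1/(900χ), and χ ≤ I. In the second
  -- branch with γ limited by the variance, the summand χ² of I is needed.
  have w3 : 1 ≤ 900 * (c.ηx * c.γ) * I := by
    rw [h.ηx_eq]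
    rcases min_choice (1 / (900 * χ * c.γ)) (c.ν / (36 * c.τ * χ ^ 2)) with e | e <;> rw [e]
    · have : 1 / (900 * χ * c.γ) * c.γ = 1 / (900 * χ) := by field_simp
      rw [this, mul_one_div, div_mul_eq_mul_div, le_div_iff₀ (by positivity)]
      linarith
    · rw [div_mul_eq_mul_div, mul_div_assoc', div_mul_eq_mul_div, le_div_iff₀ (by positivity),
        h.ν_eq]
      rcases hQ with hQ | hQ
      · have h1 := mul_le_mul_of_nonneg_right hQ hI0.le
        have h2 := mul_le_mul_of_nonneg_left i3 (show 0 ≤ 2 * χ * c.τ by positivity)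
        have h3 : L * (2 * χ ^ 2 * c.τ) ≤ L * (μ * c.γ * I) := by linarith
        have h4 := le_of_mul_le_mul_left h3 hL
        have h5 : 0 ≤ χ ^ 2 * c.τ := by positivity
        linarith
      · have h1 := mul_le_mul_of_nonneg_right hQ hI0.le
        have h2 := mul_le_mul_of_nonneg_left i1 hτ0.le
        have h5 : 0 ≤ χ ^ 2 * c.τ := by positivity
        linarith
  have w4 : 1 ≤ 900 * (μ * c.ηz / 8) * I := by
    have : 0 ≤ μ * c.ηz * I := by positivity
    linarith
  have w5 : 1 ≤ 900 * c.τ * I := by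
    have : 0 ≤ c.τ * I := by positivity
    linarith
  have w6 : 1 ≤ 900 * (1 / (4 * χ)) * I := by
    rw [mul_one_div, div_mul_eq_mul_div, le_div_iff₀ (by positivity)]
    linarith
  have key : ∀ t, 1 ≤ 900 * t * I → 1 - t ≤ 1 - 1 / (900 * I) := fun t ht => by
    have : 1 / (900 * I) ≤ t := by rw [div_le_iff₀ (by positivity)]; linarith
    linarith
  have hα : c.α ≤ 1 - 1 / (900 * I) := by
    rw [h.α_eq]
    exact max_le (key _ w1) (max_le (key _ w2) (max_le (key _ w3) (max_le (key _ w4)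
      (max_le (key _ w5) (key _ w6)))))
  have h1 : 1 / (900 * I) ≤ 1 - c.α := by linarith
  rw [div_le_iff₀ (by positivity)] at h1
  linarith

end Tuning

end DecVI

namespace DecVI

variable {M d n b : ℕ}

/-! ### Iteration, communication and oracle complexity. -/

section Complexity

/-- A unit vector is needed to compare the two constants, hence `0 < d`; dimension zero is treated
separately below. -/
theorem OperatorAssumptions.μ_le {F : Fin M → Fin n → Vec d → Vec d} {L Lbar μ : ℝ}
    (hF : OperatorAssumptions F L Lbar μ) (hM : 0 < M) (hd : 0 < d) : μ ≤ L := by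
  let u : Vec d := EuclideanSpace.single ⟨0, hd⟩ 1
  have hu : ‖u‖ = 1 := by simp [u]
  have h1 := hF.strongMono ⟨0, hM⟩ u 0
  have h2 := hF.lipschitz ⟨0, hM⟩ u 0
  have h3 := real_inner_le_norm (localOp F ⟨0, hM⟩ u - localOp F ⟨0, hM⟩ 0) (u - 0)
  rw [sub_zero, hu] at *
  linarith

theorem pow_mul_le_of_log_le {α I R ε : ℝ} {k : ℕ} (hα0 : 0 ≤ α) (hα1 : α ≤ 1)
    (hI : 1 ≤ 900 * (1 - α) * I) (hR : 0 ≤ R) (hε : 0 < ε)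
    (hk : 900 * I * Real.log (R / ε) ≤ k) : α ^ k * R ≤ ε := by
  have hαk : α ^ k ≤ 1 := pow_le_one₀ hα0 hα1
  -- If R ≤ ε the logarithm is not positive and carries no information, but then no iteration is
  -- needed.
  rcases le_total R ε with h | h
  · calc α ^ k * R ≤ 1 * R := by gcongr
      _ ≤ ε := by linarith
  have hR0 : 0 < R := hε.trans_le h
  have hlog : 0 ≤ Real.log (R / ε) := Real.log_nonneg ((one_le_div hε).2 h)
  have h1 : Real.log (R / ε) ≤ (1 - α) * k := by
    have h2 := mul_le_mul_of_nonneg_left hk (sub_nonneg.2 hα1)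
    have h3 := mul_le_mul_of_nonneg_right hI hlog
    linarith
  have h2 : α ^ k ≤ Real.exp (-Real.log (R / ε)) := by
    calc α ^ k ≤ Real.exp (-(1 - α)) ^ k := by
          gcongr
          linarith [Real.add_one_le_exp (-(1 - α))]
      _ = Real.exp (k * -(1 - α)) := (Real.exp_nat_mul _ _).symm
      _ ≤ _ := by gcongr; linarith
  rw [Real.exp_neg, Real.exp_log (by positivity), inv_div] at h2
  calc α ^ k * R ≤ ε / R * R := by gcongr
    _ = ε := div_mul_cancel₀ _ hR0.ne'

theorem startGap_nonneg {F : Fin M → Fin n → Vec d → Vec d} {c : Params} {L Lbar μ χ p : ℝ}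
    (hc : StepsizeBounds L Lbar μ χ p b c) (hF : OperatorAssumptions F L Lbar μ)
    (z0 y0 x0 : Stack M d) (zs : Vec d) : 0 ≤ startGap F c μ p z0 y0 x0 zs := by
  have hη0 := hc.ηz_pos
  refine le_trans (mul_nonneg (by positivity) (le_trans ?_ (le_lyapunov hc hF zs _)))
    (lyapunov_initState_le hc zs z0 y0 x0)
  positivity

variable {Ω : Type*} [MeasurableSpace Ω] {P : Measure Ω} [IsProbabilityMeasure P] {p : ℝ}
  {ξ : ℕ → Ω → Draw M n b} {F : Fin M → Fin n → Vec d → Vec d} {g : Vec d → EReal} {c : Params}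

/-- The iteration complexity of the algorithm. -/
theorem iteration_complexity {L Lbar μ χ : ℝ} {zs : Vec d} {B : ℕ}
    {G : ℕ → Digraph (Fin M)} {W : ℕ → Matrix (Fin M) (Fin M) ℝ} {z0 y0 x0 : Stack M d}
    (hL : 0 < L) (hLbar : 0 < Lbar) (hμ : 0 < μ) (hb : 1 ≤ b) (hbn : b ≤ n) (hp : 0 < p)
    (hp1 : p ≤ 1 / 16) (hF : OperatorAssumptions F L Lbar μ)
    (hg : ProperClosedConvex g) (hs : IsSolution F g zs) (hW : GossipNetwork B G W)
    {T : ℕ} (hχ : 1 ≤ χ) (hT : ∀ t, Contracts d (multiGossip W T t) χ) (hx0 : ZeroSum x0)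
    (hξ : IsSampling P p ξ) (ht : Tuned L Lbar μ χ p b c) {ε : ℝ} (hε : 0 < ε) {k : ℕ}
    (hk : d = 0 ∨ 900 * iterBound L Lbar μ χ p b
      * Real.log (startGap F c μ p z0 y0 x0 zs / ε) ≤ k) :
    Integrable (fun ω => ‖(run F g c W T z0 y0 x0 (fun i => ξ i ω) k).z - diag M zs‖ ^ 2) P ∧
      ∫ ω, ‖(run F g c W T z0 y0 x0 (fun i => ξ i ω) k).z - diag M zs‖ ^ 2 ∂P ≤ ε := by
  have : NeZero n := ⟨by omega⟩
  have : NeZero b := ⟨by omega⟩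
  refine ⟨hξ.integrable W T z0 y0 x0 k fun s => ‖s.z - diag M zs‖ ^ 2, ?_⟩
  rcases Nat.eq_zero_or_pos d with rfl | hd
  -- In dimension zero μ ≤ L may fail, but every distance is zero.
  · have h0 : ∀ u : Stack M 0, ‖u‖ ^ 2 = 0 := fun u => by
      rw [Stack.norm_sq_eq]
      exact Finset.sum_eq_zero fun m _ => by simp [Subsingleton.elim (u m) 0]
    simp only [h0, integral_zero]
    exact hε.le
  have hk' := hk.resolve_left hd.ne'
  have hμL := hF.μ_le hW.pos hd
  have hc := ht.stepsizeBounds hL hLbar hμ hμL hb hp hp1 hχ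
  exact (integral_norm_sq_le hc hF hg hs hW hT hx0 hξ k).trans
    (pow_mul_le_of_log_le hc.α_nonneg hc.α_le
      (ht.one_le_mul_iterBound hL hLbar hμ hμL hb hp hp1 hχ)
      (startGap_nonneg hc hF z0 y0 x0 zs) hε hk')

theorem IsSampling.integral_draw [NeZero n] (hξ : IsSampling P p ξ) (hp0 : 0 ≤ p) (hp1 : p ≤ 1)
    (k : ℕ) (f : Draw M n b → ℝ) :
    Integrable (fun ω => f (ξ k ω)) P ∧ ∫ ω, f (ξ k ω) ∂P = drawMean p f := by
  have hm := hξ.measurable k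
  have : IsProbabilityMeasure (P.map (ξ k)) := Measure.isProbabilityMeasure_map hm.aemeasurable
  refine ⟨(Integrable.of_finite : Integrable f (P.map (ξ k))).comp_measurable hm, ?_⟩
  rw [← integral_map hm.aemeasurable (measurable_of_finite f).aestronglyMeasurable,
    integral_fintype Integrable.of_finite, ← hξ.sum_law hp0 hp1 k]
  simp only [smul_eq_mul]
  exact Finset.sum_congr rfl fun y _ => by
    rw [map_measureReal_apply hm (measurableSet_singleton y)]

theorem IsSampling.integral_localCalls [NeZero n] (hξ : IsSampling P p ξ) (hp0 : 0 ≤ p)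
    (hp1 : p ≤ 1) (N : ℕ) :
    ∫ ω, (localCalls (fun i => ξ i ω) N : ℝ) ∂P = n + N * (5 * b + p * n) := by
  obtain ⟨f, hf⟩ : ∃ f : Draw M n b → ℝ, f = fun y : Draw M n b => 5 * b + if y.2.2 then (n : ℝ) else 0 :=
    ⟨_, rfl⟩
  have h1 : ∀ ω, (localCalls (fun i => ξ i ω) N : ℝ) = n + ∑ i ∈ Finset.range N, f (ξ i ω) := by
    intro ω
    rw [localCalls, hf]
    push_cast
    congr 1
    exact Finset.sum_congr rfl fun i _ => by ring
  have h2 : drawMean p f = 5 * b + p * n := by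
    rw [hf, drawMean]
    simp only [if_true, Bool.false_eq_true, if_false, Fintype.expect_const]
    ring
  simp only [h1]
  rw [integral_add (integrable_const _)
    (integrable_finsetSum _ fun i _ => (hξ.integral_draw hp0 hp1 i f).1),
    integral_finsetSum _ fun i _ => (hξ.integral_draw hp0 hp1 i f).1]
  simp [(hξ.integral_draw hp0 hp1 _ f).2, h2]
  ring

/-- The iteration complexity for `χ(T) = 2` and the batch size and probability that balance
communication and local computation. -/
theorem iterBound_two_le {L Lbar μ p : ℝ} {n b : ℕ} (hL : 0 < L) (hLbar : 0 < Lbar) (hμ : 0 < μ)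
    (hb : 1 ≤ b) (hbn : b ≤ n) (hp : 0 < p) (h1 : Lbar * √n / L ≤ b)
    (h2 : b / (16 * n) ≤ p) :
    iterBound L Lbar μ 2 p b ≤ 16 * (1 + √n * L / Lbar + L / μ) := by
  have hb0 : (0 : ℝ) < b := by exact_mod_cast hb
  have hn0 : (0 : ℝ) < n := by exact_mod_cast hb.trans hbn
  obtain ⟨r, hr⟩ : ∃ r, r = √(n : ℝ) := ⟨_, rfl⟩
  have hr0 : 0 < r := by rw [hr]; exact Real.sqrt_pos.2 hn0
  have hr2 : (n : ℝ) = r ^ 2 := by rw [hr]; exact (Real.sq_sqrt hn0.le).symm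
  rw [← hr] at h1 ⊢
  rw [hr2] at h2
  rw [div_le_iff₀ hL] at h1
  rw [div_le_iff₀ (by positivity)] at h2
  have e1 : 1 / p ≤ 16 * (r * L / Lbar) := by
    rw [mul_div_assoc', div_le_div_iff₀ hp hLbar]
    have h3 := mul_le_mul_of_nonneg_right h2 hL.le
    have h4 : r * Lbar ≤ r * (16 * r * L * p) := by linarith
    have := le_of_mul_le_mul_left h4 hr0
    linarith
  have hs0 : 0 < √(b * p) := Real.sqrt_pos.2 (by positivity)
  -- Squared, this is b ≤ 16 n p, the lower bound on the probability, multiplied by b.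
  have e2 : (b : ℝ) ≤ 4 * r * √(b * p) := by
    refine le_of_sq_le_sq ?_ (by positivity)
    rw [mul_pow, Real.sq_sqrt (by positivity)]
    have := mul_le_mul_of_nonneg_left h2 hb0.le
    linarith
  have e3 : 1 / √(b * p) * (Lbar / μ) ≤ 4 * (L / μ) := by
    rw [div_mul_div_comm, one_mul, mul_div_assoc', div_le_div_iff₀ (by positivity) hμ]
    have h3 := mul_le_mul_of_nonneg_right e2 hL.le
    have h4 : r * Lbar ≤ r * (4 * √(b * p) * L) := by linarith
    have h5 := mul_le_mul_of_nonneg_right (le_of_mul_le_mul_left h4 hr0) hμ.le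
    linarith
  have e4 : 0 ≤ L / μ := by positivity
  have e5 : 0 ≤ r * L / Lbar := by positivity
  unfold iterBound
  linarith

/-- The batch size turns iterations into local calls: b ≤ 2 Lbar √n / L balances the last two
summands, and b ≤ n the first. -/
theorem batch_mul_bound {L Lbar μ : ℝ} {n b : ℕ} (hL : 0 < L) (hLbar : 0 < Lbar) (hμ : 0 < μ)
    (hbn : b ≤ n) (h : (b : ℝ) ≤ 2 * (Lbar * √n / L)) :
    b * (1 + √n * L / Lbar + L / μ) ≤ 3 * (n + √n * Lbar / μ) := by
  have hbn' : (b : ℝ) ≤ n := by exact_mod_cast hbn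
  have e0 : √(n : ℝ) * √(n : ℝ) = n := Real.mul_self_sqrt (Nat.cast_nonneg n)
  have e1 : b * (√n * L / Lbar) ≤ 2 * n := by
    calc b * (√n * L / Lbar) ≤ 2 * (Lbar * √n / L) * (√n * L / Lbar) := by gcongr
      _ = 2 * (√n * √n) := by field_simp
      _ = 2 * n := by rw [e0]
  have e2 : b * (L / μ) ≤ 2 * (√n * Lbar / μ) := by
    calc b * (L / μ) ≤ 2 * (Lbar * √n / L) * (L / μ) := by gcongr
      _ = 2 * (√n * Lbar / μ) := by field_simp
  have e3 : 0 ≤ √n * Lbar / μ := by positivity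
  linarith

/-- A number of iterations that suffices for accuracy `ε`, with its communication and local
complexity. -/
theorem exists_iterations {L Lbar μ χ I ℓ : ℝ} {S : ℕ} (hL : 0 < L) (hLbar : 0 < Lbar)
    (hμ : 0 < μ) (hμL : μ ≤ L) (hbn : b ≤ n) (hχ : 1 ≤ χ)
    (h2 : (b : ℝ) ≤ 2 * (Lbar * √n / L)) (h4 : p * n ≤ b) (hI0 : 0 ≤ I)
    (hI : I ≤ 16 * (1 + √n * L / Lbar + L / μ)) (hℓ : 1 ≤ ℓ) :
    ∃ N : ℕ, 900 * I * ℓ ≤ N ∧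
      (commRounds (S * ⌈χ * Real.log 2⌉₊) N : ℝ)
        ≤ 300000 * (S * χ * (1 + √n * L / Lbar + L / μ)) * ℓ ∧
      (√n * μ ≤ Lbar → (commRounds (S * ⌈χ * Real.log 2⌉₊) N : ℝ)
        ≤ 300000 * (S * χ * (L / μ)) * ℓ) ∧
      (n + N * (5 * b + p * n) : ℝ) ≤ 300000 * (n + √n * Lbar / μ) * ℓ := by
  obtain ⟨D, hD⟩ : ∃ D, D = 1 + √n * L / Lbar + L / μ := ⟨_, rfl⟩
  have x0 : 0 ≤ √n * L / Lbar := by positivity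
  have y0 : 1 ≤ L / μ := (one_le_div hμ).2 hμL
  have hbatch := batch_mul_bound hL hLbar hμ hbn h2
  rw [← hD] at hI hbatch ⊢
  have hD1 : 1 ≤ D := by linarith
  have hDℓ : 1 ≤ D * ℓ := one_le_mul_of_one_le_of_one_le hD1 hℓ
  -- 14401 = 900 · 16 + 1; the ceiling costs at most 1 ≤ D ℓ.
  have hN : (⌈900 * I * ℓ⌉₊ : ℝ) ≤ 14401 * (D * ℓ) := by
    have h1 := (Nat.ceil_lt_add_one (show 0 ≤ 900 * I * ℓ by positivity)).le
    have h2 := mul_le_mul_of_nonneg_right hI (show 0 ≤ ℓ by linarith)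
    linarith
  have hT : (⌈χ * Real.log 2⌉₊ : ℝ) ≤ 2 * χ := by
    have h0 : 0 ≤ Real.log 2 := Real.log_nonneg (by norm_num)
    have h1 := (Nat.ceil_lt_add_one (show 0 ≤ χ * Real.log 2 by positivity)).le
    have h2 : χ * Real.log 2 ≤ χ * 1 := by
      gcongr
      linarith [Real.log_two_lt_d9]
    linarith
  have hcomm : (commRounds (S * ⌈χ * Real.log 2⌉₊) ⌈900 * I * ℓ⌉₊ : ℝ)
      ≤ 28802 * (S * χ) * (D * ℓ) := by
    unfold commRounds
    push_cast
    calc (S : ℝ) * ⌈χ * Real.log 2⌉₊ * ⌈900 * I * ℓ⌉₊ ≤ S * (2 * χ) * (14401 * (D * ℓ)) := by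
          gcongr
      _ = _ := by ring
  have hSχ : (0 : ℝ) ≤ S * χ := by positivity
  refine ⟨⌈900 * I * ℓ⌉₊, Nat.le_ceil _, hcomm.trans ?_, fun hn => hcomm.trans ?_, ?_⟩
  · have : 0 ≤ S * χ * (D * ℓ) := by positivity
    linarith
  · have hx : √n * L / Lbar ≤ L / μ := by
      rw [div_le_div_iff₀ hLbar hμ]
      have := mul_le_mul_of_nonneg_right hn hL.le
      linarith
    have hD3 : D ≤ 3 * (L / μ) := by linarith
    calc 28802 * (S * χ) * (D * ℓ) ≤ 28802 * (S * χ) * (3 * (L / μ) * ℓ) := by gcongr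
      _ ≤ 300000 * (S * χ * (L / μ)) * ℓ := by
        have : 0 ≤ S * χ * (L / μ) * ℓ := by positivity
        linarith
  -- The local calls fix the universal constant: 14401 · 6 · 3 from the iterations and 1 from the
  -- initial full evaluation stay below 300000.
  · have e0 : 0 ≤ √n * Lbar / μ := by positivity
    have e1 : (5 * b + p * n : ℝ) ≤ 6 * b := by linarith
    have e2 : (⌈900 * I * ℓ⌉₊ : ℝ) * (5 * b + p * n) ≤ 14401 * (D * ℓ) * (6 * b) := by
      calc (⌈900 * I * ℓ⌉₊ : ℝ) * (5 * b + p * n) ≤ ⌈900 * I * ℓ⌉₊ * (6 * b) := by gcongr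
        _ ≤ _ := by gcongr
    have e3 := mul_le_mul_of_nonneg_right hbatch (show 0 ≤ ℓ by linarith)
    have e4 : (n : ℝ) * 1 ≤ n * ℓ := by gcongr
    have e5 : 0 ≤ n * ℓ := by positivity
    have e6 : 0 ≤ √n * Lbar / μ * ℓ := by positivity
    linarith

end Complexity

end DecVI

end

/-! ### The main theorem. -/

open DecVI in
theorem theorem5 :
    ∃ C : ℝ, 0 < C ∧
    ∀ (M d n b : ℕ) (L Lbar μ p : ℝ)
      (F : Fin M → Fin n → Vec d → Vec d) (g : Vec d → EReal) (zs : Vec d)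
      (B : ℕ) (G : ℕ → Digraph (Fin M)) (W : ℕ → Matrix (Fin M) (Fin M) ℝ)
      (z0 y0 x0 : Stack M d)
      (Ω : Type*) [MeasurableSpace Ω] (P : MeasureTheory.Measure Ω)
      [MeasureTheory.IsProbabilityMeasure P] (ξ : ℕ → Ω → Draw M n b),
      0 < L → 0 < Lbar → 0 < μ → 1 ≤ b → b ≤ n → 0 < p → p ≤ 1 / 16 →
      OperatorAssumptions F L Lbar μ → ProperClosedConvex g → IsSolution F g zs →
      1 ≤ B → GossipNetwork B G W →
      (∀ m, g (z0 m) ≠ ⊤) → ZeroSum x0 →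
      IsSampling P p ξ →
      -- the tuning is possible
      (∀ χT : ℝ, 1 ≤ χT → ∃ c : Params, Tuned L Lbar μ χT p b c) ∧
      -- iteration complexity
      (∀ (T : ℕ) (χT : ℝ) (c : Params), B ≤ T → 1 ≤ χT →
        (∀ t, Contracts d (multiGossip W T t) χT) → Tuned L Lbar μ χT p b c →
        ∀ ε : ℝ, 0 < ε → ∀ k : ℕ,
          C * iterBound L Lbar μ χT p b * Real.log (startGap F c μ p z0 y0 x0 zs / ε) ≤ k →
          MeasureTheory.Integrable (fun ω =>
            ‖(run F g c W T z0 y0 x0 (fun i => ξ i ω) k).z - diag M zs‖ ^ 2) P ∧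
          ∫ ω, ‖(run F g c W T z0 y0 x0 (fun i => ξ i ω) k).z - diag M zs‖ ^ 2 ∂P ≤ ε) ∧
      -- multi-consensus with `T = B ⌈χ ln 2⌉`: communication and local complexity
      (∀ (χ : ℝ) (T : ℕ), 1 ≤ χ → (∀ t, Contracts d (multiGossip W B t) χ) →
        T = B * ⌈χ * Real.log 2⌉₊ →
        (∀ t, Contracts d (multiGossip W T t) 2) ∧
        ∀ c : Params, Tuned L Lbar μ 2 p b c →
          Lbar * √n / L ≤ b → b ≤ 2 * (Lbar * √n / L) →
          b / (16 * n) ≤ p → p ≤ b / n →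
          ∀ ε : ℝ, 0 < ε → ∃ N : ℕ,
            (∀ k : ℕ, N ≤ k →
              MeasureTheory.Integrable (fun ω =>
                ‖(run F g c W T z0 y0 x0 (fun i => ξ i ω) k).z - diag M zs‖ ^ 2) P ∧
              ∫ ω, ‖(run F g c W T z0 y0 x0 (fun i => ξ i ω) k).z - diag M zs‖ ^ 2 ∂P ≤ ε) ∧
            (commRounds T N : ℝ) ≤ C * (B * χ * (1 + √n * L / Lbar + L / μ)) *
              max 1 (Real.log (startGap F c μ p z0 y0 x0 zs / ε)) ∧
            (√n * μ ≤ Lbar → (commRounds T N : ℝ) ≤ C * (B * χ * (L / μ)) *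
              max 1 (Real.log (startGap F c μ p z0 y0 x0 zs / ε))) ∧
            ∫ ω, (localCalls (fun i => ξ i ω) N : ℝ) ∂P ≤ C * (n + √n * Lbar / μ) *
              max 1 (Real.log (startGap F c μ p z0 y0 x0 zs / ε))) := by
  refine ⟨300000, by norm_num, ?_⟩
  intro M d n b L Lbar μ p F g zs B G W z0 y0 x0 Ω _ P _ ξ hL hLbar hμ hb hbn hp hp1 hF hg hs
    hB hW hz0 hx0 hξ
  have : NeZero n := ⟨by omega⟩
  refine ⟨fun χT hχ => exists_tuned hL hLbar hμ hb hp hχ, ?_, ?_⟩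
  · intro T χT c _ hχ hT ht ε hε k hk
    refine iteration_complexity hL hLbar hμ hb hbn hp hp1 hF hg hs hW hχ hT hx0 hξ ht hε
      (or_iff_not_imp_left.2 fun hd => ?_)
    have hI := one_le_iterBound (b := b) hL hLbar hμ hp hχ
    -- Enlarging the constant from 900 to 300000 weakens the requirement on k when the logarithm is
    -- negative; then, however, the threshold with 900 is non-positive anyway.
    rcases le_total 0 (Real.log (startGap F c μ p z0 y0 x0 zs / ε)) with h | h
    · refine le_trans ?_ hk
      gcongr
      norm_num
    · exact le_trans (mul_nonpos_of_nonneg_of_nonpos (by linarith) h) (Nat.cast_nonneg k)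
  · intro χ T hχ hB' hT
    have hT2 : ∀ t, Contracts d (multiGossip W T t) 2 := fun t => by
      rw [hT]
      exact hW.contracts_two hχ hB' (Nat.le_ceil _) t
    refine ⟨hT2, ?_⟩
    intro c ht h1 h2 h3 h4 ε hε
    have hn0 : (0 : ℝ) < n := by exact_mod_cast hb.trans hbn
    have hcalls := fun N => hξ.integral_localCalls hp.le (hp1.trans (by norm_num)) N
    have hℓ : 1 ≤ max 1 (Real.log (startGap F c μ p z0 y0 x0 zs / ε)) := le_max_left _ _
    have hI := one_le_iterBound (b := b) hL hLbar hμ hp one_le_two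
    -- In dimension zero N = 0 works, at the cost of the n evaluations made at the start.
    rcases Nat.eq_zero_or_pos d with hd | hd
    · refine ⟨0, fun k _ => iteration_complexity hL hLbar hμ hb hbn hp hp1 hF hg hs hW one_le_two
        hT2 hx0 hξ ht hε (Or.inl hd), ?_, fun _ => ?_, ?_⟩
      · rw [commRounds, mul_zero, Nat.cast_zero]
        positivity
      · rw [commRounds, mul_zero, Nat.cast_zero]
        positivity
      · rw [hcalls, Nat.cast_zero, zero_mul, add_zero]
        have h5 : 0 ≤ √n * Lbar / μ := by positivity
        calc (n : ℝ) ≤ 300000 * (n + √n * Lbar / μ) * 1 := by linarith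
          _ ≤ _ := by gcongr
    · obtain ⟨N, hN, hc1, hc2, hc3⟩ := exists_iterations (p := p) (S := B) hL hLbar hμ
        (hF.μ_le hW.pos hd) hbn hχ h2 ((le_div_iff₀ hn0).1 h4) (by linarith)
        (iterBound_two_le hL hLbar hμ hb hbn hp h1 h3) hℓ
      rw [← hT] at hc1 hc2
      refine ⟨N, fun k hk => iteration_complexity hL hLbar hμ hb hbn hp hp1 hF hg hs hW one_le_two
        hT2 hx0 hξ ht hε (Or.inr (le_trans ?_ (hN.trans (Nat.cast_le.2 hk)))), hc1, hc2, ?_⟩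
      · gcongr
        exact le_max_right _ _
      · rw [hcalls]
        exact hc3
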